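/- Let $X$ be a complex manifold of dimension $2$ and $w\in H^0(X,S^2\Omega^1_X)$ a holomorphic symmetric $2$-differential. Suppose that $w$ is split, i.e. $w=\psi_1\psi_2$ with meromorphic $1$-forms $\psi_i$ on $X$, or $w=\mu_1\mu_2$ with $\mu_1\in H^0(X,\Omega^1_X\otimes\mathcal L)$, $\mu_2\in H^0(X,\Omega^1_X\otimes\mathcal L^{-1})$ for a holomorphic line bundle $\mathcal L$; and that $w$ has rank $2$, i.e. for general $x\in X$ the form $w(x)$ defines two distinct lines in $T_xX$. Let $D$ be the support of the discriminant divisor of $w$, i.e. the analytic set of points $x$ where the quadratic form $w(x)$ on $T_xX$ is degenerate. Near every point outside a discrete set, $w=h\,\mu_1\mu_2$ with $h$ holomorphic and $\mu_1,\mu_2$ nowhere vanishing holomorphic $1$-forms, and the two foliations defined by $w$ are those given by $\mu_1$ and $\mu_2$. Let $L$ be a common leaf of $w$, i.e. an irreducible component of $D$ that is tangent to both of these foliations. Then there is an integer $m\ge 0$ (the order of contact of the two foliations along $L$) such that every point $x$ of $L$ outside a closed discrete subset of $X$ has a neighbourhood $U_x$ with a holomorphic chart $(z_1,z_2)$ in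 which $$w|_{U_x}=f(z_1,z_2)\,dz_1\,d\bigl[z_1(1+z_1^m z_2)\bigr]$$ with $f$ holomorphic. Moreover, $m$ is independent of the choices made: if $x$ is any point of $L$ and $w$ has the displayed form with an exponent $m'$ in some holomorphic chart (and with some holomorphic $f$) on a neighbourhood of $x$, then $m'=m$. -/

import Mathlib

open scoped Manifold ContDiff Topology

noncomputable section

namespace SymDiff

/-- The model space `ℂ²`. -/
abbrev C2 : Type := EuclideanSpace ℂ (Fin 2)

/-- The tangent space at a point of a complex 2-manifold `X`
(a manifold modelled on `C2`). -/
abbrev Tan {X : Type*} [TopologicalSpace X] [ChartedSpace C2 X] (x : X) : Type :=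
  TangentSpace 𝓘(ℂ, C2) x

/-- A (not necessarily holomorphic) 1-form of type `(1, 0)`: a `ℂ`-linear form on every
tangent space. -/
abbrev Form (X : Type*) [TopologicalSpace X] [ChartedSpace C2 X] : Type _ :=
  ∀ x : X, Tan x →L[ℂ] ℂ

/-- The differential of a function, as a linear form on the tangent space. -/
def dd {X : Type*} [TopologicalSpace X] [ChartedSpace C2 X] (f : X → ℂ) : Form X :=
  fun x => mfderiv 𝓘(ℂ, C2) 𝓘(ℂ, ℂ) f x

/-- `f` is a holomorphic function on the (open) set `U`. -/
def HoloOn {X : Type*} [TopologicalSpace X] [ChartedSpace C2 X]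
    (f : X → ℂ) (U : Set X) : Prop :=
  ContMDiffOn 𝓘(ℂ, C2) 𝓘(ℂ, ℂ) ω f U

/-- `μ` is a holomorphic 1-form on the (open) set `U`, that is, a holomorphic section of the
holomorphic cotangent bundle over `U`. -/
def HoloFormOn {X : Type*} [TopologicalSpace X] [ChartedSpace C2 X]
    [IsManifold 𝓘(ℂ, C2) ω X] (μ : Form X) (U : Set X) : Prop :=
  ContMDiffOn 𝓘(ℂ, C2) (𝓘(ℂ, C2).prod 𝓘(ℂ, C2 →L[ℂ] ℂ)) ω
    (fun x : X => Bundle.TotalSpace.mk' (C2 →L[ℂ] ℂ)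
      (E := fun x : X => Tan x →L[ℂ] ℂ) x (μ x)) U

/-- A holomorphic chart of `X`, with its two coordinate functions being the components of
`z : X → C2` on `z.source`. -/
def HoloChart {X : Type*} [TopologicalSpace X] [ChartedSpace C2 X]
    (z : OpenPartialHomeomorph X C2) : Prop :=
  z ∈ IsManifold.maximalAtlas 𝓘(ℂ, C2) ω X

/-- A holomorphic symmetric 2-differential, i.e. an element of `H⁰(X, S²Ω¹_X)`: a holomorphic
family of symmetric bilinear forms on the tangent spaces.  The associated quadratic form
is `a ↦ w x a a`, and the product of two linear forms `α`, `β` is the symmetric bilinear form with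
quadratic form `a ↦ α a * β a`. -/
structure Differential (X : Type*) [TopologicalSpace X] [ChartedSpace C2 X]
    [IsManifold 𝓘(ℂ, C2) ω X] where
  toFun : ∀ x : X, Tan x →L[ℂ] Tan x →L[ℂ] ℂ
  symm : ∀ (x : X) (a b : Tan x), toFun x a b = toFun x b a
  holo : ContMDiff 𝓘(ℂ, C2) (𝓘(ℂ, C2).prod 𝓘(ℂ, C2 →L[ℂ] C2 →L[ℂ] ℂ)) ω
    (fun x : X => Bundle.TotalSpace.mk' (C2 →L[ℂ] C2 →L[ℂ] ℂ)
      (E := fun x : X => Tan x →L[ℂ] Tan x →L[ℂ] ℂ) x (toFun x))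

section

variable {X : Type*} [TopologicalSpace X] [ChartedSpace C2 X]
  [IsManifold 𝓘(ℂ, C2) ω X]

/-- `w(x) = c · α · β` in `S²(T_x^*X)`.  (A symmetric bilinear form is determined by its quadratic
form.) -/
def EqProdAt (w : Differential X) (x : X) (c : ℂ) (α β : Tan x →L[ℂ] ℂ) : Prop :=
  ∀ a : Tan x, w.toFun x a a = c * (α a * β a)

/-- A meromorphic 1-form: locally a quotient `μ / q` of a holomorphic 1-form by a holomorphic
function `q` that does not vanish identically on any nonempty open set.  The values of `ψ` at its
poles carry no information. -/
def MeroForm (ψ : Form X) : Prop :=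
  ∀ x : X, ∃ (U : Set X) (q : X → ℂ) (μ : Form X), IsOpen U ∧ x ∈ U ∧ HoloOn q U ∧
    HoloFormOn μ U ∧ U ⊆ closure {y | y ∈ U ∧ q y ≠ 0} ∧
    ∀ y ∈ U, q y ≠ 0 → q y • ψ y = μ y

/-- `w = ψ₁ ψ₂` for two meromorphic 1-forms on `X`.  An equality of meromorphic objects is an
equality on a dense open set. -/
def MeroSplit (w : Differential X) : Prop :=
  ∃ ψ₁ ψ₂ : Form X, MeroForm ψ₁ ∧ MeroForm ψ₂ ∧
    ∃ G : Set X, IsOpen G ∧ Dense G ∧ ∀ x ∈ G, EqProdAt w x 1 (ψ₁ x) (ψ₂ x)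

/-- `w = μ₁ μ₂` with `μ₁ ∈ H⁰(X, Ω¹ ⊗ 𝓛)` and `μ₂ ∈ H⁰(X, Ω¹ ⊗ 𝓛⁻¹)` for a holomorphic line
bundle `𝓛`.  The line bundle is given by its cocycle `g` for an open cover (indexed by the points of
`X`, the set of index `i` being a neighbourhood of `i`), and the sections by their
components `μ₁ i`, `μ₂ i` in the trivialisations. -/
def BundleSplit (w : Differential X) : Prop :=
  ∃ (U : X → Set X) (g : X → X → X → ℂ) (μ₁ μ₂ : X → Form X),
    (∀ i, IsOpen (U i) ∧ i ∈ U i) ∧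
    (∀ i j, HoloOn (g i j) (U i ∩ U j) ∧ ∀ x ∈ U i ∩ U j, g i j x ≠ 0) ∧
    (∀ i j k, ∀ x ∈ U i ∩ U j ∩ U k, g i k x = g i j x * g j k x) ∧
    (∀ i, HoloFormOn (μ₁ i) (U i) ∧ HoloFormOn (μ₂ i) (U i)) ∧
    (∀ i j, ∀ x ∈ U i ∩ U j, μ₁ i x = g i j x • μ₁ j x ∧ μ₂ i x = (g i j x)⁻¹ • μ₂ j x) ∧
    (∀ i, ∀ x ∈ U i, EqProdAt w x 1 (μ₁ i x) (μ₂ i x))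

/-- `w` is split: it is a product of two meromorphic 1-forms, or of two 1-forms with values in
line bundles. -/
def Split (w : Differential X) : Prop :=
  MeroSplit w ∨ BundleSplit w

/-- `w(x)` defines two distinct lines in `T_x X`, the kernels of two independent linear forms. -/
def TwoLinesAt (w : Differential X) (x : X) : Prop :=
  ∃ α β : Tan x →L[ℂ] ℂ, LinearIndependent ℂ ![α, β] ∧ EqProdAt w x 1 α β

/-- `w` has rank 2: `w(x)` defines two distinct lines for the general `x`.  (The set of these
points is the complement of the analytic set `discSupport w`, so it is enough that it is
dense.) -/
def RankTwo (w : Differential X) : Prop :=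
  Dense {x : X | TwoLinesAt w x}

/-- The support of the discriminant divisor of `w`: the points where the symmetric bilinear form
`w(x)` is degenerate, i.e. its determinant (in one or any basis of `T_x X`) is zero. -/
def discSupport (w : Differential X) : Set X :=
  {x | ∃ a : Tan x, a ≠ 0 ∧ ∀ b : Tan x, w.toFun x a b = 0}

/-- The chart `z` around `x` straightens the curve `A`: in it, `A` is `{z₁ = 0}`.  Then the
tangent line to `A` at `x` is the kernel of `dz₁` at `x`. -/
def Straightens (z : OpenPartialHomeomorph X C2) (A : Set X) (x : X) : Prop :=
  HoloChart z ∧ x ∈ z.source ∧ ∀ y ∈ z.source, y ∈ A ↔ z y 0 = 0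

/-- The regular points of an analytic curve (a closed analytic subset of pure dimension one) `A`:
the points near which `A` is a one-dimensional complex submanifold. -/
def regularPoints (A : Set X) : Set X :=
  {x | x ∈ A ∧ ∃ z : OpenPartialHomeomorph X C2, Straightens z A x}

/-- The (global) irreducible components of an analytic curve `A`: the closures of the connected
components of its regular locus. -/
def IrredComponent (A L : Set X) : Prop :=
  ∃ x ∈ regularPoints A, L = closure (connectedComponentIn (regularPoints A) x)

/-- The regular part of the curve `L` is tangent, over `U`, to the foliation defined by the nowhere
vanishing 1-form `μ`: at every regular point of `L` in `U`, the form `μ` vanishes on the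
tangent line to `L`. -/
def LeafOn (L U : Set X) (μ : Form X) : Prop :=
  ∀ x ∈ U, x ∈ L → ∀ z : OpenPartialHomeomorph X C2, Straightens z L x →
    ∀ a : Tan x, dd (fun y => z y 0) x a = 0 → μ x a = 0

/-- The common leaves of a split differential `w` of rank two: the irreducible components of the
support of its discriminant divisor that are leaves of both foliations defined by `w`.
Where `w = h μ₁ μ₂` with `h` holomorphic and `μ₁`, `μ₂` nowhere vanishing holomorphic
1-forms, the two foliations are those defined by `μ₁` and `μ₂`; for split `w` of rank two,
such a decomposition exists near every point outside a discrete set. -/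
def CommonLeaf (w : Differential X) (L : Set X) : Prop :=
  IrredComponent (discSupport w) L ∧
    ∀ (U : Set X) (h : X → ℂ) (μ₁ μ₂ : Form X), IsOpen U → HoloOn h U →
      HoloFormOn μ₁ U → HoloFormOn μ₂ U → (∀ x ∈ U, μ₁ x ≠ 0 ∧ μ₂ x ≠ 0) →
      (∀ x ∈ U, EqProdAt w x (h x) (μ₁ x) (μ₂ x)) →
      LeafOn L U μ₁ ∧ LeafOn L U μ₂

/-- Some neighbourhood of `x` has a holomorphic chart `(z₁, z₂)` in which
`w = f(z₁, z₂) dz₁ d[z₁ (1 + z₁ ^ m z₂)]` with `f` holomorphic. -/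
def NormalFormAt (w : Differential X) (m : ℕ) (x : X) : Prop :=
  ∃ (z : OpenPartialHomeomorph X C2) (f : C2 → ℂ), HoloChart z ∧ x ∈ z.source ∧
    DifferentiableOn ℂ f z.target ∧
    ∀ y ∈ z.source, EqProdAt w y (f (z y)) (dd (fun p => z p 0) y)
      (dd (fun p => z p 0 * (1 + z p 0 ^ m * z p 1)) y)

end

end SymDiff

end

/-! Near any point a multiple `q w` is a product of two holomorphic 1-forms
(`Split.exists_product`). Multiply `q`, the wedge of the two forms and those of their coefficients
that are not identically zero. The result `F` is a nonzero germ of two variables. Singularities of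
plane analytic curves are isolated (`eventually_eq_pow_mul`), so at each nearby zero other than the
centre, `F` is a unit times a power of a function with nonzero differential. Take that function as
coordinate `z₁`. Every factor of `F` is then itself a unit times a power of `z₁`, and cancelling
these powers gives `w = h μ₁ μ₂` with `μ₁`, `μ₂` nowhere zero and `μ₁ ∧ μ₂ = z₁ ^ n · unit`
(`eventually_productNear`).

If `{z₁ = 0}` is a leaf of both foliations, then both forms are multiples of `dz₁` on it, so `n = m
+ 1` for some `m`. Let `x` and `y` be first integrals of the two foliations that agree on the
transversal `{z₂ = 0}`; in particular `x` is a unit times `z₁`. Written in the coordinates `(x,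
z₂)`, the `z₂`-derivative of `y` is `x ^ (m + 1)` times a unit. Integrating from the transversal,
where `y = x`, gives `y = x + x ^ (m + 1) Y`, and `(x, Y)` is a chart. As `μ₁`, `μ₂` are
proportional to `dx`, `dy`, this is the normal form (`exists_normal_coordinates`).

For uniqueness, the discriminant of a normal form is the square of `f z₁ ^ (m + 1)` up to a
constant, and it changes by the square of a Jacobian. Evaluating `w` on suitable vectors shows that
the functions `f` of two charts differ by a continuous factor. Hence `z₁ ^ (2(m + 1))` and `z₁' ^
(2(m' + 1))` bound each other, and on a disc transverse to the discriminant this forces `m = m'`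
(`StrictNormalFormAt.exponent_eq`).

The exponent is thus locally constant along the curve where it is defined. A punctured disc is
connected, so isolated exceptional points of the regular locus do no harm, and connectedness of a
component gives a single `m` (`exists_order`). A normal form at an arbitrary point of `L` is valid
on a whole chart domain, which contains points of `L` where the exponent is already known.

Isolation of singularities is proved by induction on the number of `z₂`-derivatives needed to reach
a nonzero value at the centre (`graphZeros_of_iterate_d2_ne_zero`). The inductive step must know
that a second function `H` vanishes along a branch of `{G = 0}` as soon as it vanishes at one point
of it close to the centre. This is a count of the nonzero values of `H` on the fibres of `{G = 0}`,
by elementary symmetric functions and removable singularities (`eventually_eq_zero_of_common_zero`).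
-/

noncomputable section

namespace SymDiff

/-! ### Osgood's theorem: separate holomorphy with continuity gives analyticity. -/

section

open Set Metric MeasureTheory Filter

/-- A continuous function of two complex variables that is holomorphic in each of them is
analytic. -/
theorem analyticAt_of_separately {f : ℂ × ℂ → ℂ} {a b : ℂ} {R : ℝ} (hR : 0 < R)
    (hf : ContinuousOn f (closedBall a R ×ˢ closedBall b R))
    (h₁ : ∀ t ∈ closedBall b R, DifferentiableOn ℂ (fun s => f (s, t)) (ball a R))
    (h₂ : ∀ s ∈ closedBall a R, DifferentiableOn ℂ (fun t => f (s, t)) (ball b R)) :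
    AnalyticAt ℂ f (a, b) := by
  classical
  let K := Icc (0 : ℝ) (2 * Real.pi)
  have h2pi : (0 : ℝ) ≤ 2 * Real.pi := by positivity
  let cm : C(K, ℂ) := ⟨fun θ => circleMap a R θ, by fun_prop⟩
  let dm : C(K, ℂ) := ⟨fun θ => circleMap 0 R θ * Complex.I, by fun_prop⟩
  have hcm : ∀ θ : ℝ, circleMap a R θ ∈ closedBall a R := fun θ => circleMap_mem_closedBall a hR.le θ
  let F : C(closedBall b R, C(K, ℂ)) := ContinuousMap.curry
    ⟨fun p => f (circleMap a R p.2, p.1), by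
      refine hf.comp_continuous (by fun_prop) fun p => ⟨hcm _, p.1.2⟩⟩
  let A : ℂ → C(K, ℂ) := fun t => if h : t ∈ closedBall b R then F ⟨t, h⟩ else 0
  have hA : ContinuousOn A (closedBall b R) := by
    rw [continuousOn_iff_continuous_domRestrict]
    have : (closedBall b R).domRestrict A = F := by
      ext1 t
      simp only [Set.domRestrict_apply, A, dif_pos t.2]
    rw [this]; exact F.continuous
  have hAval : ∀ t ∈ closedBall b R, ∀ θ : K, A t θ = f (circleMap a R θ, t) := by
    intro t ht θ
    simp only [A, dif_pos ht]
    rfl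
  -- `A` sends `t` to the values of `f (·, t)` on the circle and is only known to be continuous. Its
  -- Cauchy integral has a power series with values in the Banach space `C(K, ℂ)`, and Cauchy's
  -- formula for each fixed `θ` shows that it equals `A`.
  let A' : ℂ → C(K, ℂ) := fun t =>
    (2 * Real.pi * Complex.I : ℂ)⁻¹ • ∮ ξ in C(b, R), (ξ - t)⁻¹ • A ξ
  have hint : CircleIntegrable A b R := (hA.mono sphere_subset_closedBall).circleIntegrable hR.le
  lift R to NNReal using hR.le
  have hA' : AnalyticAt ℂ A' b :=
    (hasFPowerSeriesOn_cauchy_integral hint (by exact_mod_cast hR)).analyticAt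
  have hA'val : ∀ t ∈ ball b (R : ℝ), ∀ θ : K, A' t θ = f (circleMap a R θ, t) := by
    intro t ht θ
    have hev : ∀ x : C(K, ℂ), x θ = ContinuousMap.evalCLM ℂ θ x := fun x => rfl
    have hci : CircleIntegrable (fun ξ => (ξ - t)⁻¹ • A ξ) b R := by
      refine ContinuousOn.circleIntegrable hR.le (ContinuousOn.smul (ContinuousOn.inv₀ (f := fun ξ : ℂ => ξ - t) (by fun_prop) ?_)
        (hA.mono sphere_subset_closedBall))
      intro ξ hξ h0
      rw [sub_eq_zero.1 h0, mem_sphere] at hξ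
      rw [mem_ball] at ht
      linarith
    have hcomm : (∮ ξ in C(b, R), (ξ - t)⁻¹ • A ξ) θ = ∮ ξ in C(b, R), (ξ - t)⁻¹ • (A ξ θ) := by
      rw [hev]
      unfold circleIntegral
      have := (ContinuousMap.evalCLM ℂ θ).intervalIntegral_comp_comm
        (f := fun x => deriv (circleMap b R) x • (fun ξ => (ξ - t)⁻¹ • A ξ) (circleMap b R x))
        (a := 0) (b := 2 * Real.pi) (μ := volume) hci.out
      rw [← this]
      rfl
    change (2 * Real.pi * Complex.I : ℂ)⁻¹ • (∮ ξ in C(b, R), (ξ - t)⁻¹ • A ξ) θ = _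
    rw [hcomm]
    have hd : DiffContOnCl ℂ (fun t => f (circleMap a R θ, t)) (ball b R) := by
      refine ⟨h₂ _ (hcm θ), ?_⟩
      rw [closure_ball b hR.ne']
      exact hf.comp (by fun_prop) fun t ht => ⟨hcm _, ht⟩
    rw [← hd.two_pi_i_inv_smul_circleIntegral_sub_inv_smul ht]
    congr 1
    refine circleIntegral.integral_congr hR.le fun ξ hξ => ?_
    simp only [hAval ξ (sphere_subset_closedBall hξ)]
  -- The Cauchy kernel in the variable `s`, as an element of `C(K, ℂ)`. It is analytic in `s`
  -- because inversion in a Banach algebra is analytic at units.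
  let k : ℂ → C(K, ℂ) := fun s => dm * Ring.inverse (cm - algebraMap ℂ C(K, ℂ) s)
  have hunit : ∀ s ∈ ball a (R : ℝ), IsUnit (cm - algebraMap ℂ C(K, ℂ) s) := by
    intro s hs
    rw [ContinuousMap.isUnit_iff_forall_ne_zero]
    intro θ h0
    have h1 : circleMap a R θ = s := sub_eq_zero.1 h0
    have h2 := circleMap_mem_sphere a hR.le (θ : ℝ)
    rw [h1, mem_sphere] at h2
    rw [mem_ball] at hs
    linarith
  have hkval : ∀ s ∈ ball a (R : ℝ), ∀ θ : K,
      k s θ = circleMap 0 R θ * Complex.I * (circleMap a R θ - s)⁻¹ := by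
    intro s hs θ
    have h1 := Ring.mul_inverse_cancel _ (hunit s hs)
    have h2 := congrArg (fun x : C(K, ℂ) => x θ) h1
    have h3 : (circleMap a R θ - s) * (Ring.inverse (cm - algebraMap ℂ C(K, ℂ) s)) θ = 1 := h2
    change circleMap 0 R θ * Complex.I * (Ring.inverse (cm - algebraMap ℂ C(K, ℂ) s)) θ = _
    rw [eq_inv_of_mul_eq_one_right h3]
  have hk : AnalyticAt ℂ k a := by
    obtain ⟨u, hu⟩ := hunit a (mem_ball_self hR)
    have h1 : AnalyticAt ℂ (fun s : ℂ => cm - algebraMap ℂ C(K, ℂ) s) a :=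
      analyticAt_const.sub ((Algebra.linearMap ℂ C(K, ℂ)).toContinuousLinearMap.analyticAt a)
    have h2 : AnalyticAt ℂ Ring.inverse (cm - algebraMap ℂ C(K, ℂ) a) := by
      rw [← hu]; exact analyticAt_inverse u
    exact analyticAt_const.mul (AnalyticAt.fun_comp (g := Ring.inverse)
      (f := fun s : ℂ => cm - algebraMap ℂ C(K, ℂ) s) h2 h1)
  let I : C(K, ℂ) →L[ℂ] ℂ := LinearMap.mkContinuous
    { toFun := fun h => ∫ θ in (0 : ℝ)..2 * Real.pi, IccExtend h2pi h θ
      map_add' := fun x y => by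
        rw [← intervalIntegral.integral_add]
        · rfl
        · exact (x.continuous.Icc_extend' (h := h2pi)).intervalIntegrable _ _
        · exact (y.continuous.Icc_extend' (h := h2pi)).intervalIntegrable _ _
      map_smul' := fun c x => by
        simp only [RingHom.id_apply]
        rw [← intervalIntegral.integral_smul]
        rfl } (2 * Real.pi) (fun x => by
      have := intervalIntegral.norm_integral_le_of_norm_le_const (a := 0) (b := 2 * Real.pi)
        (f := IccExtend h2pi x) (C := ‖x‖) (fun θ _ => x.norm_coe_le_norm _)
      rw [sub_zero, abs_of_nonneg h2pi] at this
      simpa [mul_comm] using this)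
  have hI : ∀ x : C(K, ℂ), I x = ∫ θ in (0 : ℝ)..2 * Real.pi, IccExtend h2pi x θ := fun x => rfl
  -- Cauchy's formula in `s` separates the variables: `f` is a continuous linear functional of the
  -- product of an analytic function of `s` alone and one of `t` alone.
  have key : ∀ s ∈ ball a (R : ℝ), ∀ t ∈ ball b (R : ℝ),
      f (s, t) = (2 * Real.pi * Complex.I : ℂ)⁻¹ • I (k s * A' t) := by
    intro s hs t ht
    have hd : DiffContOnCl ℂ (fun s => f (s, t)) (ball a R) := by
      refine ⟨h₁ _ (ball_subset_closedBall ht), ?_⟩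
      rw [closure_ball a hR.ne']
      exact hf.comp (by fun_prop) fun s hs => ⟨hs, ball_subset_closedBall ht⟩
    rw [← hd.two_pi_i_inv_smul_circleIntegral_sub_inv_smul hs, hI]
    congr 1
    unfold circleIntegral
    refine intervalIntegral.integral_congr fun θ hθ => ?_
    rw [uIcc_of_le h2pi] at hθ
    rw [IccExtend_of_mem _ _ hθ]
    change _ = k s ⟨θ, hθ⟩ * A' t ⟨θ, hθ⟩
    rw [hkval s hs, hA'val t ht]
    simp only [deriv_circleMap, smul_eq_mul]
    ring
  have hfin : AnalyticAt ℂ (fun p : ℂ × ℂ => (2 * Real.pi * Complex.I : ℂ)⁻¹ • I (k p.1 * A' p.2))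
      (a, b) := by
    have e1 : AnalyticAt ℂ (fun p : ℂ × ℂ => k p.1) (a, b) :=
      AnalyticAt.fun_comp (g := k) (f := fun p : ℂ × ℂ => p.1) hk analyticAt_fst
    have e2 : AnalyticAt ℂ (fun p : ℂ × ℂ => A' p.2) (a, b) :=
      AnalyticAt.fun_comp (g := A') (f := fun p : ℂ × ℂ => p.2) hA' analyticAt_snd
    exact AnalyticAt.fun_mul analyticAt_const (AnalyticAt.fun_comp (g := I)
      (f := fun p : ℂ × ℂ => k p.1 * A' p.2) (I.analyticAt _) (e1.mul e2))
  refine hfin.congr ?_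
  have : ball a (R : ℝ) ×ˢ ball b (R : ℝ) ∈ 𝓝 (a, b) :=
    prod_mem_nhds (ball_mem_nhds a hR) (ball_mem_nhds b hR)
  filter_upwards [this] with p hp
  exact (key p.1 hp.1 p.2 hp.2).symm

/-- A complex differentiable function of two variables is analytic. -/
theorem analyticAt_of_differentiableOn {f : ℂ × ℂ → ℂ} {s : Set (ℂ × ℂ)} {p : ℂ × ℂ}
    (hs : s ∈ 𝓝 p) (hf : DifferentiableOn ℂ f s) : AnalyticAt ℂ f p := by
  obtain ⟨R, hR, hsub⟩ := nhds_basis_closedBall.mem_iff.1 hs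
  have hb : closedBall p.1 R ×ˢ closedBall p.2 R ⊆ s := by
    rw [closedBall_prod_same]; exact hsub
  refine analyticAt_of_separately hR (hf.continuousOn.mono hb) (fun t ht => ?_) fun u hu => ?_
  · exact hf.comp (by fun_prop) fun u hu => hb ⟨ball_subset_closedBall hu, ht⟩
  · exact hf.comp (by fun_prop) fun t ht => hb ⟨hu, ball_subset_closedBall ht⟩

end

/-! ### Averages along scalings and division by powers of a coordinate. -/

section

open Set Metric MeasureTheory Filter Interval

/-- Differentiation under the integral sign. Compactness of `[0, 1]` gives one bound for the
derivatives of the integrands, valid near `p` for all `r` at once. With `M r` a scaling of one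
variable, such averages provide the quotients and primitives used below. -/
theorem differentiableOn_average {u : ℂ × ℂ → ℂ} {Ω : Set (ℂ × ℂ)} (hΩ : IsOpen Ω)
    (hu : AnalyticOnNhd ℂ u Ω) (M : ℝ → ℂ × ℂ →L[ℂ] ℂ × ℂ) (hM : Continuous M)
    (hmaps : ∀ r ∈ Icc (0 : ℝ) 1, ∀ p ∈ Ω, M r p ∈ Ω) (c : ℝ → ℂ) (hc : Continuous c) :
    DifferentiableOn ℂ (fun p => ∫ r in (0 : ℝ)..1, c r * u (M r p)) Ω := by
  intro p hp
  have hMp : Continuous fun x : (ℂ × ℂ) × ℝ => M x.2 x.1 := by fun_prop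
  let G : ℂ × ℂ → ℝ → ℂ × ℂ →L[ℂ] ℂ := fun x r => c r • (fderiv ℂ u (M r x)).comp (M r)
  have hGc : ∀ x r, M r x ∈ Ω → ContinuousAt (fun y : (ℂ × ℂ) × ℝ => G y.1 y.2) (x, r) := by
    intro x r hx
    have h1 : ContinuousAt (fun y : (ℂ × ℂ) × ℝ => fderiv ℂ u (M y.2 y.1)) (x, r) :=
      ContinuousAt.comp (f := fun y : (ℂ × ℂ) × ℝ => M y.2 y.1) (g := fderiv ℂ u)
        (hu _ hx).fderiv.continuousAt hMp.continuousAt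
    exact (hc.comp continuous_snd).continuousAt.smul
      (h1.clm_comp (hM.comp continuous_snd).continuousAt)
  have hGr : ContinuousOn (G p) (Icc 0 1) := fun r hr =>
    (ContinuousAt.comp (f := fun r : ℝ => (p, r)) (hGc p r (hmaps r hr p hp))
      (by fun_prop)).continuousWithinAt
  obtain ⟨B, hB⟩ := isCompact_Icc.exists_bound_of_continuousOn hGr
  have hev : ∀ᶠ x in 𝓝 p, ∀ r ∈ Icc (0 : ℝ) 1, ‖G x r‖ ≤ B + 1 := by
    refine isCompact_Icc.eventually_forall_of_forall_eventually fun r hr => ?_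
    have := (hGc p r (hmaps r hr p hp)).norm.eventually_lt_const
      (show ‖G p r‖ < B + 1 by linarith [hB r hr])
    exact this.mono fun _ h => h.le
  have hs : {x | x ∈ Ω ∧ ∀ r ∈ Icc (0 : ℝ) 1, ‖G x r‖ ≤ B + 1} ∈ 𝓝 p :=
    Filter.Eventually.and (hΩ.eventually_mem hp) hev
  have hI : Ι (0 : ℝ) 1 ⊆ Icc 0 1 := by
    rw [uIoc_of_le zero_le_one]; exact Ioc_subset_Icc_self
  have hFc : ∀ x ∈ Ω, ContinuousOn (fun r : ℝ => c r * u (M r x)) (Icc 0 1) := by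
    intro x hx r hr
    refine (hc.continuousAt.mul ?_).continuousWithinAt
    exact ContinuousAt.comp (f := fun r : ℝ => M r x) (g := u)
      (hu _ (hmaps r hr x hx)).continuousAt (by fun_prop)
  have := intervalIntegral.hasFDerivAt_integral_of_dominated_of_fderiv_le (μ := volume)
    (F := fun x r => c r * u (M r x)) (F' := G) (bound := fun _ => B + 1) (a := 0) (b := 1)
    hs ?_ ?_ ?_ ?_ ?_ ?_
  · exact this.differentiableAt.differentiableWithinAt
  · filter_upwards [hΩ.mem_nhds hp] with x hx
    exact ((hFc x hx).mono hI).aestronglyMeasurable measurableSet_uIoc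
  · refine ContinuousOn.intervalIntegrable ?_
    rw [uIcc_of_le zero_le_one]; exact hFc p hp
  · exact (hGr.mono hI).aestronglyMeasurable measurableSet_uIoc
  · exact Eventually.of_forall fun r hr x hx => hx.2 r (hI hr)
  · exact intervalIntegrable_const
  · refine Eventually.of_forall fun r hr x hx => ?_
    have h1 := (hu _ (hmaps r (hI hr) x hx.1)).differentiableAt.hasFDerivAt
    exact (h1.comp x (M r).hasFDerivAt).const_mul (c r)

/-- Partial derivatives of functions of two complex variables. -/
def d1 (f : ℂ × ℂ → ℂ) (p : ℂ × ℂ) : ℂ := fderiv ℂ f p (1, 0)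

/-- The derivative in the second variable. -/
def d2 (f : ℂ × ℂ → ℂ) (p : ℂ × ℂ) : ℂ := fderiv ℂ f p (0, 1)

theorem analyticAt_d1 {f : ℂ × ℂ → ℂ} {p : ℂ × ℂ} (hf : AnalyticAt ℂ f p) :
    AnalyticAt ℂ (d1 f) p :=
  ((ContinuousLinearMap.apply ℂ ℂ ((1, 0) : ℂ × ℂ)).analyticAt _).comp hf.fderiv

theorem analyticAt_d2 {f : ℂ × ℂ → ℂ} {p : ℂ × ℂ} (hf : AnalyticAt ℂ f p) :
    AnalyticAt ℂ (d2 f) p :=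
  ((ContinuousLinearMap.apply ℂ ℂ ((0, 1) : ℂ × ℂ)).analyticAt _).comp hf.fderiv

theorem fderiv_eq_d1_d2 (f : ℂ × ℂ → ℂ) (p v : ℂ × ℂ) :
    fderiv ℂ f p v = d1 f p * v.1 + d2 f p * v.2 := by
  have : v = v.1 • ((1, 0) : ℂ × ℂ) + v.2 • ((0, 1) : ℂ × ℂ) := by
    ext <;> simp
  conv_lhs => rw [this, map_add, map_smul, map_smul]
  simp only [d1, d2, smul_eq_mul]; ring

theorem hasDerivAt_fst {f : ℂ × ℂ → ℂ} {s t : ℂ} (hf : DifferentiableAt ℂ f (s, t)) :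
    HasDerivAt (fun s => f (s, t)) (d1 f (s, t)) s :=
  hf.hasFDerivAt.comp_hasDerivAt s ((hasDerivAt_id s).prodMk (hasDerivAt_const s t))

theorem hasDerivAt_snd {f : ℂ × ℂ → ℂ} {s t : ℂ} (hf : DifferentiableAt ℂ f (s, t)) :
    HasDerivAt (fun t => f (s, t)) (d2 f (s, t)) t :=
  hf.hasFDerivAt.comp_hasDerivAt t ((hasDerivAt_const t s).prodMk (hasDerivAt_id t))

/-- A function that vanishes on `{s = 0}` and whose `s`-derivative is `s ^ k * u` is divisible by
`s ^ (k + 1)`. -/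
theorem exists_eq_pow_mul_of_hasDerivAt {f u : ℂ × ℂ → ℂ} {w : ℂ → ℂ} {b : ℂ} {k : ℕ}
    (hu : AnalyticAt ℂ u (0, b)) (h0 : ∀ᶠ t in 𝓝 b, f (0, t) = 0)
    (hd : ∀ᶠ p in 𝓝 ((0 : ℂ), b), HasDerivAt (fun s => f (s, p.2)) (p.1 ^ k * (w p.2 * u p)) p.1) :
    ∃ g : ℂ × ℂ → ℂ, AnalyticAt ℂ g (0, b) ∧ (k + 1) * g (0, b) = u (0, b) ∧
      ∀ᶠ p in 𝓝 ((0 : ℂ), b), f p = p.1 ^ (k + 1) * (w p.2 * g p) := by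
  have h0' : ∀ᶠ p in 𝓝 ((0 : ℂ), b), f (0, p.2) = 0 :=
    (continuous_snd.tendsto ((0 : ℂ), b)).eventually h0
  obtain ⟨R, hR, hball⟩ := eventually_nhds_iff_ball.1 ((hu.eventually_analyticAt.and hd).and h0')
  let M : ℝ → ℂ × ℂ →L[ℂ] ℂ × ℂ := fun r =>
    (r : ℂ) • (ContinuousLinearMap.fst ℂ ℂ ℂ).prod 0 +
      ContinuousLinearMap.prod 0 (ContinuousLinearMap.snd ℂ ℂ ℂ)
  have hMval : ∀ r p, M r p = ((r : ℂ) * p.1, p.2) := fun r p => by simp [M]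
  have hM : Continuous M := by fun_prop
  have hmem : ∀ p : ℂ × ℂ, p ∈ ball ((0 : ℂ), b) R ↔ ‖p.1‖ < R ∧ dist p.2 b < R := by
    intro p
    rw [← ball_prod_same]; simp
  have hmaps : ∀ r ∈ Icc (0 : ℝ) 1, ∀ p ∈ ball ((0 : ℂ), b) R, M r p ∈ ball ((0 : ℂ), b) R := by
    intro r hr p hp
    rw [hmem] at hp ⊢
    refine ⟨?_, by simpa [hMval] using hp.2⟩
    simp only [hMval, norm_mul, Complex.norm_real, Real.norm_eq_abs, abs_of_nonneg hr.1]
    exact (mul_le_of_le_one_left (norm_nonneg _) hr.2).trans_lt hp.1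
  have hdiff := differentiableOn_average isOpen_ball (fun p hp => (hball p hp).1.1) M hM hmaps
    (fun r => (r : ℂ) ^ k) (by fun_prop)
  -- The quotient is `g p = ∫ r ^ k * u (r * p.1, p.2)` over `[0, 1]`. The factor `w p.2` is
  -- constant along the segment of integration, so it needs no regularity.
  refine ⟨_, analyticAt_of_differentiableOn (ball_mem_nhds _ hR) hdiff, ?_, ?_⟩
  · simp only [hMval, mul_zero]
    rw [intervalIntegral.integral_mul_const]
    have : ∫ x in (0 : ℝ)..1, (x : ℂ) ^ k = 1 / (k + 1) := by
      have := integral_pow (a := 0) (b := 1) k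
      have h2 : ∫ x in (0 : ℝ)..1, (x : ℂ) ^ k = ((∫ x in (0 : ℝ)..1, x ^ k : ℝ) : ℂ) := by
        rw [← intervalIntegral.integral_ofReal]; simp
      rw [h2, this]; simp
    rw [this]
    have : (k : ℂ) + 1 ≠ 0 := by exact_mod_cast k.succ_ne_zero
    field_simp
  · filter_upwards [ball_mem_nhds _ hR] with p hp
    have hder : ∀ r ∈ uIcc (0 : ℝ) 1, HasDerivAt (fun r : ℝ => f ((r : ℂ) * p.1, p.2))
        (p.1 ^ (k + 1) * w p.2 * ((r : ℂ) ^ k * u (M r p))) r := by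
      intro r hr
      rw [uIcc_of_le zero_le_one] at hr
      have h1 := (hball _ (hmaps r hr p hp)).1.2
      rw [hMval] at h1
      have h2 : HasDerivAt (fun r : ℝ => (r : ℂ) * p.1) (1 * p.1) r :=
        (Complex.ofRealCLM.hasDerivAt (x := r)).mul_const p.1
      have h3 := HasDerivAt.scomp r h1 h2
      convert! h3 using 1
      simp only [smul_eq_mul, hMval]; ring
    have hcont : ContinuousOn (fun r : ℝ => p.1 ^ (k + 1) * w p.2 * ((r : ℂ) ^ k * u (M r p)))
        (uIcc 0 1) := by
      rw [uIcc_of_le zero_le_one]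
      intro r hr
      refine ContinuousAt.continuousWithinAt ?_
      refine continuousAt_const.mul (ContinuousAt.mul (by fun_prop) ?_)
      exact ContinuousAt.comp (f := fun r : ℝ => M r p) (g := u)
        (hball _ (hmaps r hr p hp)).1.1.continuousAt (by fun_prop)
    have := intervalIntegral.integral_eq_sub_of_hasDerivAt hder hcont.intervalIntegrable
    rw [intervalIntegral.integral_const_mul] at this
    rw [← mul_assoc, this]
    simp only [Complex.ofReal_one, one_mul, Complex.ofReal_zero, zero_mul]
    rw [(hball p hp).2, sub_zero]

/-- An analytic function that vanishes on `{s = 0}` is divisible by `s`. -/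
theorem exists_eq_mul_of_eq_zero {f : ℂ × ℂ → ℂ} {b : ℂ} (hf : AnalyticAt ℂ f (0, b))
    (h0 : ∀ᶠ t in 𝓝 b, f (0, t) = 0) :
    ∃ g : ℂ × ℂ → ℂ, AnalyticAt ℂ g (0, b) ∧ g (0, b) = d1 f (0, b) ∧
      ∀ᶠ p in 𝓝 ((0 : ℂ), b), f p = p.1 * g p := by
  obtain ⟨g, hg, hg0, hfg⟩ := exists_eq_pow_mul_of_hasDerivAt (k := 0) (w := fun _ => 1) (analyticAt_d1 hf) h0
    (by
      filter_upwards [hf.eventually_analyticAt] with p hp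
      simpa using hasDerivAt_fst (s := p.1) (t := p.2) hp.differentiableAt)
  exact ⟨g, hg, by simpa using hg0, by simpa using hfg⟩

/-- A function that vanishes on `{t = 0}` and whose `t`-derivative is `s ^ n * u` is divisible by
`s ^ n * t`. -/
theorem exists_eq_pow_mul_snd {f u : ℂ × ℂ → ℂ} {a : ℂ} {n : ℕ} (hu : AnalyticAt ℂ u (a, 0))
    (h0 : ∀ᶠ s in 𝓝 a, f (s, 0) = 0)
    (hd : ∀ᶠ p in 𝓝 (a, (0 : ℂ)), HasDerivAt (fun t => f (p.1, t)) (p.1 ^ n * u p) p.2) :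
    ∃ g : ℂ × ℂ → ℂ, AnalyticAt ℂ g (a, 0) ∧ g (a, 0) = u (a, 0) ∧
      ∀ᶠ p in 𝓝 (a, (0 : ℂ)), f p = p.1 ^ n * (p.2 * g p) := by
  have hsw : Tendsto (Prod.swap : ℂ × ℂ → ℂ × ℂ) (𝓝 ((0 : ℂ), a)) (𝓝 (a, (0 : ℂ))) :=
    continuous_swap.tendsto _
  have hsw' : Tendsto (Prod.swap : ℂ × ℂ → ℂ × ℂ) (𝓝 (a, (0 : ℂ))) (𝓝 ((0 : ℂ), a)) :=
    continuous_swap.tendsto _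
  have hswa : ∀ p, AnalyticAt ℂ (Prod.swap : ℂ × ℂ → ℂ × ℂ) p := fun p =>
    analyticAt_snd.prod analyticAt_fst
  -- After the swap, `s ^ n` depends only on the variable that is not integrated, so it can play the
  -- role of `w`.
  obtain ⟨g, hg, hg0, hfg⟩ := exists_eq_pow_mul_of_hasDerivAt (k := 0) (f := f ∘ Prod.swap)
    (u := u ∘ Prod.swap) (w := fun s => s ^ n) (b := a) (AnalyticAt.comp hu (hswa _)) h0
    (by
      filter_upwards [hsw.eventually hd] with p hp
      simpa using! hp)
  refine ⟨g ∘ Prod.swap, AnalyticAt.comp hg (hswa _), by simpa using hg0, ?_⟩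
  filter_upwards [hsw'.eventually hfg] with p hp
  have : f p = p.2 * (p.1 ^ n * g p.swap) := by simpa using hp
  rw [this, Function.comp_apply]; ring

end

/-! ### Branches of a zero set over a disc, and symmetric functions on them. -/

section

open Set Metric Filter

/-- A punctured disc is the image of a half-plane under the exponential. -/
theorem isPreconnected_ball_diff_zero (r : ℝ) : IsPreconnected (ball (0 : ℂ) r \ {0}) := by
  rcases le_or_gt r 0 with hr | hr
  · rw [ball_eq_empty.2 hr]; simpa using isPreconnected_empty
  have : ball (0 : ℂ) r \ {0} = Complex.exp '' {z | z.re < Real.log r} := by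
    ext z
    simp only [Set.mem_sdiff, mem_ball_zero_iff, mem_singleton_iff, mem_image, mem_ofPred_eq]
    constructor
    · rintro ⟨h1, h2⟩
      refine ⟨Complex.log z, ?_, Complex.exp_log h2⟩
      rw [Complex.log_re]
      exact Real.log_lt_log (norm_pos_iff.2 h2) h1
    · rintro ⟨y, hy, rfl⟩
      refine ⟨?_, Complex.exp_ne_zero y⟩
      rw [Complex.norm_exp]
      exact (Real.lt_log_iff_exp_lt hr).1 hy
  rw [this]
  exact (convex_halfSpace_re_lt _).isPreconnected.image _ Complex.continuous_exp.continuousOn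

section branches

variable {G : ℂ × ℂ → ℂ} {r : ℝ}

/-- The zeros of `G (a, ·)` in the closed disc of radius `r` are, for `a` near `a₀`, the values of
finitely many analytic functions with distinct values. -/
theorem exists_branches {a₀ : ℂ}
    (hG : ∀ b ∈ closedBall (0 : ℂ) r, ContinuousAt G (a₀, b))
    (hbd : ∀ b ∈ sphere (0 : ℂ) r, G (a₀, b) ≠ 0)
    (hgr : ∀ b ∈ closedBall (0 : ℂ) r, G (a₀, b) = 0 → ∃ φ : ℂ → ℂ, AnalyticAt ℂ φ a₀ ∧ φ a₀ = b ∧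
      ∀ᶠ z in 𝓝 (a₀, b), G z = 0 ↔ z.2 = φ z.1) :
    ∃ (s : Finset ℂ) (φ : ℂ → ℂ → ℂ),
      (∀ b, b ∈ s ↔ b ∈ closedBall (0 : ℂ) r ∧ G (a₀, b) = 0) ∧
      (∀ b ∈ s, AnalyticAt ℂ (φ b) a₀ ∧ φ b a₀ = b ∧
        ∀ᶠ z in 𝓝 (a₀, b), G z = 0 ↔ z.2 = φ b z.1) ∧
      ∀ᶠ a in 𝓝 a₀, InjOn (fun b => φ b a) s ∧
        ∀ b', (b' ∈ closedBall (0 : ℂ) r ∧ G (a, b') = 0) ↔ ∃ b ∈ s, φ b a = b' := by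
  -- Infinitely many zeros would accumulate in the compact disc. An accumulation point cannot be a
  -- zero, since the zero set near it is a graph, nor a nonzero, by continuity.
  have hfin : {b | b ∈ closedBall (0 : ℂ) r ∧ G (a₀, b) = 0}.Finite := by
    by_contra hinf
    obtain ⟨b, hb, hacc⟩ := Set.Infinite.exists_accPt_of_subset_isCompact hinf
      (isCompact_closedBall (0 : ℂ) r) (fun b hb => hb.1)
    rw [accPt_iff_frequently] at hacc
    have hmk : ContinuousAt (fun b : ℂ => (a₀, b)) b := by fun_prop
    by_cases hGb : G (a₀, b) = 0
    · obtain ⟨φ, -, hφb, hφ⟩ := hgr b hb hGb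
      obtain ⟨b', ⟨h1, h2, h3⟩, h4⟩ := (hacc.and_eventually (hmk.eventually hφ)).exists
      exact h1 ((h4.1 h3).trans hφb)
    · have : ∀ᶠ b' in 𝓝 b, G (a₀, b') ≠ 0 :=
        (ContinuousAt.comp (f := fun b : ℂ => (a₀, b)) (hG b hb) hmk).eventually_ne hGb
      obtain ⟨b', ⟨h1, h2, h3⟩, h4⟩ := (hacc.and_eventually this).exists
      exact h4 h3
  have hs : ∀ b, b ∈ hfin.toFinset ↔ b ∈ closedBall (0 : ℂ) r ∧ G (a₀, b) = 0 := fun b => by simp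
  generalize hfin.toFinset = s at hs
  have : ∀ b ∈ s, ∃ φ : ℂ → ℂ, AnalyticAt ℂ φ a₀ ∧ φ a₀ = b ∧
      ∀ᶠ z in 𝓝 (a₀, b), G z = 0 ↔ z.2 = φ z.1 := fun b hb =>
    hgr b ((hs b).1 hb).1 ((hs b).1 hb).2
  choose! φ hφ using this
  refine ⟨s, φ, hs, hφ, ?_⟩
  have e1 : ∀ᶠ a in 𝓝 a₀, InjOn (fun b => φ b a) s := by
    have : ∀ᶠ a in 𝓝 a₀, ∀ b ∈ s, ∀ b' ∈ s, b ≠ b' → φ b a ≠ φ b' a := by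
      rw [Filter.eventually_all_finset]
      intro b hb
      rw [Filter.eventually_all_finset]
      intro b' hb'
      by_cases hbb : b = b'
      · exact Eventually.of_forall fun _ h => absurd hbb h
      · have hne : φ b a₀ ≠ φ b' a₀ := by rwa [(hφ b hb).2.1, (hφ b' hb').2.1]
        have := ((hφ b hb).1.continuousAt.sub (hφ b' hb').1.continuousAt).eventually_ne
          (sub_ne_zero.2 hne)
        filter_upwards [this] with a ha _
        exact sub_ne_zero.1 ha
    filter_upwards [this] with a ha b hb b' hb' h
    by_contra hne
    exact ha b hb b' hb' hne h
  -- A branch starting in the closed disc starts in the open one, as `G` has no zero on the circle,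
  -- and therefore stays inside.
  have e2 : ∀ᶠ a in 𝓝 a₀, ∀ b ∈ s, φ b a ∈ closedBall (0 : ℂ) r ∧ G (a, φ b a) = 0 := by
    rw [Filter.eventually_all_finset]
    intro b hb
    have hbr : φ b a₀ ∈ ball (0 : ℂ) r := by
      rw [(hφ b hb).2.1]
      have h1 := (hs b).1 hb
      rcases (mem_closedBall_zero_iff.1 h1.1).lt_or_eq with h | h
      · exact mem_ball_zero_iff.2 h
      · exact absurd h1.2 (hbd b (mem_sphere_zero_iff_norm.2 h))
    have hc : ContinuousAt (fun a => (a, φ b a)) a₀ := continuousAt_id.prodMk (hφ b hb).1.continuousAt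
    have h3 : ∀ᶠ z in 𝓝 (a₀, φ b a₀), G z = 0 ↔ z.2 = φ b z.1 := by
      rw [(hφ b hb).2.1]; exact (hφ b hb).2.2
    filter_upwards [(hφ b hb).1.continuousAt.eventually (isOpen_ball.mem_nhds hbr),
      hc.eventually h3] with a h1 h2
    exact ⟨ball_subset_closedBall h1, h2.2 rfl⟩
  -- No zeros other than the branches appear: compactness of the disc makes the local alternatives
  -- uniform in `b'`.
  have e3 : ∀ᶠ a in 𝓝 a₀, ∀ b' ∈ closedBall (0 : ℂ) r, G (a, b') = 0 → ∃ b ∈ s, φ b a = b' := by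
    refine (isCompact_closedBall (0 : ℂ) r).eventually_forall_of_forall_eventually
      (P := fun a b' => G (a, b') = 0 → ∃ b ∈ s, φ b a = b') fun b' hb' => ?_
    by_cases hGb : G (a₀, b') = 0
    · have hb's := (hs b').2 ⟨hb', hGb⟩
      filter_upwards [(hφ b' hb's).2.2] with z hz h
      exact ⟨b', hb's, (hz.1 h).symm⟩
    · filter_upwards [(hG b' hb').eventually_ne hGb] with z hz h
      exact absurd h hz
  filter_upwards [e1, e2, e3] with a h1 h2 h3
  refine ⟨h1, fun b' => ⟨fun h => h3 b' h.1 h.2, ?_⟩⟩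
  rintro ⟨b, hb, rfl⟩
  exact h2 b hb

end branches

/-- A multiset has exactly as many nonzero elements as the largest index of a nonzero elementary
symmetric function. -/
theorem esymm_map_eq_zero_of_lt {s : Finset ℂ} {f : ℂ → ℂ} {j : ℕ}
    (hj : (s.filter fun b => f b ≠ 0).card < j) : (s.val.map f).esymm j = 0 := by
  rw [Finset.esymm_map_val]
  refine Finset.sum_eq_zero fun t ht => ?_
  rw [Finset.mem_powersetCard] at ht
  obtain ⟨b, hb, hb'⟩ : ∃ b ∈ t, b ∉ s.filter fun b => f b ≠ 0 :=
    Finset.exists_mem_notMem_of_card_lt_card (by omega)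
  refine Finset.prod_eq_zero hb ?_
  by_contra h
  exact hb' (Finset.mem_filter.2 ⟨ht.1 hb, h⟩)

/-- In this degree a single product survives, that of all the nonzero values; any other index set of
this size contains a zero value. -/
theorem esymm_map_card_ne_zero (s : Finset ℂ) (f : ℂ → ℂ) :
    (s.val.map f).esymm (s.filter fun b => f b ≠ 0).card ≠ 0 := by
  rw [Finset.esymm_map_val, Finset.sum_eq_single (s.filter fun b => f b ≠ 0)]
  · exact Finset.prod_ne_zero_iff.2 fun b hb => (Finset.mem_filter.1 hb).2
  · intro t ht hne
    rw [Finset.mem_powersetCard] at ht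
    have : ¬ t ⊆ s.filter fun b => f b ≠ 0 := fun h =>
      hne (Finset.eq_of_subset_of_card_le h ht.2.ge)
    obtain ⟨b, hb, hb'⟩ := Finset.not_subset.1 this
    refine Finset.prod_eq_zero hb ?_
    by_contra h
    exact hb' (Finset.mem_filter.2 ⟨ht.1 hb, h⟩)
  · intro h
    exact absurd (Finset.mem_powersetCard.2 ⟨Finset.filter_subset _ _, rfl⟩) h

/-- A bounded holomorphic function on a punctured disc either vanishes near the puncture, or
has no zeros near it. -/
theorem eventually_zero_or_ne_of_bounded {f : ℂ → ℂ} {ε C : ℝ} (hε : 0 < ε)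
    (hf : ∀ a ∈ ball (0 : ℂ) ε \ {0}, AnalyticAt ℂ f a)
    (hC : ∀ a ∈ ball (0 : ℂ) ε \ {0}, ‖f a‖ ≤ C) :
    (∀ᶠ a in 𝓝[≠] (0 : ℂ), f a = 0) ∨ ∀ᶠ a in 𝓝[≠] (0 : ℂ), f a ≠ 0 := by
  -- The singularity at the puncture is removable, and zeros of the extension are isolated unless it
  -- vanishes identically near `0`.
  have hd := Complex.differentiableOn_update_limUnder_of_bddAbove (f := f) (c := 0)
    (ball_mem_nhds (0 : ℂ) hε) (fun a ha => (hf a ha).differentiableAt.differentiableWithinAt)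
    ⟨C, by rintro _ ⟨a, ha, rfl⟩; exact hC a ha⟩
  have ha := hd.analyticAt (ball_mem_nhds (0 : ℂ) hε)
  have hcongr : ∀ᶠ a in 𝓝[≠] (0 : ℂ), Function.update f 0 (limUnder (𝓝[≠] 0) f) a = f a := by
    filter_upwards [self_mem_nhdsWithin] with a ha
    exact Function.update_of_ne ha _ _
  rcases ha.eventually_eq_zero_or_eventually_ne_zero with h | h
  · left
    filter_upwards [hcongr, h.filter_mono nhdsWithin_le_nhds] with a h1 h2
    rw [← h1, h2]
  · right
    filter_upwards [hcongr, h] with a h1 h2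
    rwa [← h1]

end

/-! ### Common zeros of two functions spread along branches. -/

section

open Set Metric Filter

/-- Let `G` and `H` be analytic at `0`, and suppose that the zeros of `G` off `{z₁ = 0}` are locally
graphs.  If `G` and `H` vanish at a point off `{z₁ = 0}` near `0`, then `H` vanishes on the zeros of
`G` near that point. -/
theorem eventually_eq_zero_of_common_zero {G H : ℂ × ℂ → ℂ} (hG : AnalyticAt ℂ G 0)
    (hH : AnalyticAt ℂ H 0) (h0 : ∀ᶠ t in 𝓝[≠] (0 : ℂ), G (0, t) ≠ 0)
    (hgr : ∀ᶠ p in 𝓝 (0 : ℂ × ℂ), p.1 ≠ 0 → G p = 0 → ∃ φ : ℂ → ℂ, AnalyticAt ℂ φ p.1 ∧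
      φ p.1 = p.2 ∧ ∀ᶠ z in 𝓝 p, G z = 0 ↔ z.2 = φ z.1) :
    ∀ᶠ p in 𝓝 (0 : ℂ × ℂ), p.1 ≠ 0 → G p = 0 → H p = 0 → ∀ᶠ z in 𝓝 p, G z = 0 → H z = 0 := by
  classical
  have hHb : ∀ᶠ p in 𝓝 (0 : ℂ × ℂ), ‖H p‖ < ‖H 0‖ + 1 :=
    hH.continuousAt.norm.eventually_lt_const (by linarith)
  obtain ⟨R, hR, hball⟩ := eventually_nhds_iff_ball.1
    (((hG.eventually_analyticAt.and hH.eventually_analyticAt).and hHb).and hgr)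
  set M := ‖H 0‖ + 1 with hM
  have hM1 : 1 ≤ M := by rw [hM]; linarith [norm_nonneg (H 0)]
  have hmem : ∀ p : ℂ × ℂ, p ∈ ball (0 : ℂ × ℂ) R ↔ ‖p.1‖ < R ∧ ‖p.2‖ < R := by
    intro p
    rw [mem_ball_zero_iff, Prod.norm_def, max_lt_iff]
  obtain ⟨r₀, hr₀, hr₀'⟩ := eventually_nhds_iff_ball.1 (eventually_nhdsWithin_iff.1 h0)
  obtain ⟨r, hr, hrm⟩ := exists_between (lt_min hr₀ hR)
  have hrr₀ := hrm.trans_le (min_le_left _ _)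
  have hrR := hrm.trans_le (min_le_right _ _)
  -- For small `a`, zeros of `G (a, ·)` cannot cross the circle of radius `r`, so their number in
  -- the disc can be controlled.
  have htube : ∀ᶠ a in 𝓝 (0 : ℂ), ∀ b ∈ sphere (0 : ℂ) r, G (a, b) ≠ 0 := by
    refine (isCompact_sphere (0 : ℂ) r).eventually_forall_of_forall_eventually
      (P := fun a b => G (a, b) ≠ 0) fun b hb => ?_
    rw [mem_sphere_zero_iff_norm] at hb
    have h1 : G (0, b) ≠ 0 := by
      refine hr₀' b (mem_ball_zero_iff.2 (by linarith)) ?_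
      rintro rfl
      simp at hb; linarith
    have h2 : ((0 : ℂ), b) ∈ ball (0 : ℂ × ℂ) R := by
      rw [hmem]; simp [hR, hb, hrR]
    exact (hball _ h2).1.1.1.continuousAt.eventually_ne h1
  obtain ⟨ε₀, hε₀, hε₀'⟩ := eventually_nhds_iff_ball.1 htube
  obtain ⟨ε, hε, hεm⟩ := exists_between (lt_min hε₀ hR)
  have hεε₀ := hεm.trans_le (min_le_left _ _)
  have hεR := hεm.trans_le (min_le_right _ _)
  have hin : ∀ a ∈ ball (0 : ℂ) ε, ∀ b ∈ closedBall (0 : ℂ) r, (a, b) ∈ ball (0 : ℂ × ℂ) R := by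
    intro a ha b hb
    rw [hmem]
    exact ⟨(mem_ball_zero_iff.1 ha).trans hεR, (mem_closedBall_zero_iff.1 hb).trans_lt hrR⟩
  have hbr := fun (a : ℂ) (ha : a ∈ ball (0 : ℂ) ε \ {0}) => exists_branches (G := G) (r := r) (a₀ := a)
    (fun b hb => (hball _ (hin a ha.1 b hb)).1.1.1.continuousAt)
    (fun b hb => hε₀' a (ball_subset_ball hεε₀.le ha.1) b hb)
    (fun b hb hGb => (hball _ (hin a ha.1 b hb)).2 ha.2 hGb)
  choose! Z φ hZ hφ hev using hbr
  have hopen : IsOpen (ball (0 : ℂ) ε \ {0}) := isOpen_ball.sdiff isClosed_singleton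
  have hZim : ∀ a₀ ∈ ball (0 : ℂ) ε \ {0}, ∀ᶠ a in 𝓝 a₀,
      (Z a).val = (Z a₀).val.map (fun b => φ a₀ b a) ∧ InjOn (fun b => φ a₀ b a) (Z a₀) ∧
      ∀ b ∈ Z a₀, φ a₀ b a ∈ Z a := by
    intro a₀ ha₀
    filter_upwards [hev a₀ ha₀, hopen.mem_nhds ha₀] with a h1 h2
    have : Z a = (Z a₀).image (fun b => φ a₀ b a) := by
      ext b
      rw [hZ a h2, h1.2 b, Finset.mem_image]
    refine ⟨?_, h1.1, fun b hb => ?_⟩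
    · rw [this, Finset.image_val_of_injOn h1.1]
    · rw [this]; exact Finset.mem_image_of_mem _ hb
  -- The number of zeros is locally constant by the branch description, and the punctured disc is
  -- connected.
  have hcard : ∃ N, ∀ a ∈ ball (0 : ℂ) ε \ {0}, (Z a).card = N := by
    have hc : ContinuousOn (fun a => (Z a).card) (ball (0 : ℂ) ε \ {0}) := by
      intro a₀ ha₀
      refine ContinuousAt.continuousWithinAt ?_
      refine (continuousAt_const (y := (Z a₀).card)).congr ?_
      filter_upwards [hZim a₀ ha₀] with a ha
      rw [Finset.card_def, Finset.card_def, ha.1, Multiset.card_map]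
    obtain ⟨a₁, ha₁⟩ : (ball (0 : ℂ) ε \ {0}).Nonempty := by
      refine ⟨((ε / 2 : ℝ) : ℂ), mem_ball_zero_iff.2 ?_, ?_⟩
      · rw [Complex.norm_real, Real.norm_eq_abs, abs_of_pos (by positivity)]; linarith
      · simp [hε.ne']
    exact ⟨(Z a₁).card, fun a ha =>
      (isPreconnected_ball_diff_zero ε).constant hc ha ha₁⟩
  obtain ⟨N, hN⟩ := hcard
  -- The branches may be permuted around the puncture, but symmetric functions of the values of `H`
  -- on them are single-valued. They are bounded and analytic on the punctured disc.
  let e : ℕ → ℂ → ℂ := fun j a => ((Z a).val.map fun b => H (a, b)).esymm j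
  have hdich : ∀ j, (∀ᶠ a in 𝓝[≠] (0 : ℂ), e j a = 0) ∨ ∀ᶠ a in 𝓝[≠] (0 : ℂ), e j a ≠ 0 := by
    intro j
    refine eventually_zero_or_ne_of_bounded (C := (N.choose j) * M ^ j) hε ?_ ?_
    · intro a₀ ha₀
      have : AnalyticAt ℂ (fun a => ∑ t ∈ (Z a₀).powersetCard j, ∏ b ∈ t, H (a, φ a₀ b a)) a₀ := by
        refine Finset.analyticAt_fun_sum _ fun t ht => Finset.analyticAt_fun_prod _ fun b hb => ?_
        have hbZ := (Finset.mem_powersetCard.1 ht).1 hb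
        have h1 := hφ a₀ ha₀ b hbZ
        have h2 : AnalyticAt ℂ H (a₀, φ a₀ b a₀) := by
          rw [h1.2.1]
          exact (hball _ (hin a₀ ha₀.1 b ((hZ a₀ ha₀ b).1 hbZ).1)).1.1.2
        exact AnalyticAt.fun_comp (g := H) (f := fun a => (a, φ a₀ b a)) h2
          (analyticAt_id.prod h1.1)
      refine this.congr ?_
      filter_upwards [hZim a₀ ha₀] with a ha
      simp only [e]
      rw [ha.1, Multiset.map_map, Finset.esymm_map_val]
      rfl
    · intro a ha
      simp only [e]
      rw [Finset.esymm_map_val]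
      refine (norm_sum_le _ _).trans ?_
      have : ∀ t ∈ (Z a).powersetCard j, ‖∏ b ∈ t, H (a, b)‖ ≤ M ^ j := by
        intro t ht
        rw [Finset.mem_powersetCard] at ht
        rw [norm_prod, ← ht.2]
        rw [← Finset.prod_const]
        refine Finset.prod_le_prod (fun b _ => norm_nonneg _) fun b hb => ?_
        exact (hball _ (hin a ha.1 b ((hZ a ha b).1 (ht.1 hb)).1)).1.2.le
      refine (Finset.sum_le_card_nsmul _ _ _ this).trans ?_
      rw [Finset.card_powersetCard, hN a ha, nsmul_eq_mul]
  -- The degrees whose symmetric function has no zeros near the puncture; the others vanish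
  -- identically there. The largest such degree is the number of branches on which `H` is nonzero,
  -- which is thus the same for all small `a ≠ 0`.
  let S := (Finset.range (N + 1)).filter fun j => ∀ᶠ a in 𝓝[≠] (0 : ℂ), e j a ≠ 0
  have hS0 : S.Nonempty := by
    refine ⟨0, Finset.mem_filter.2 ⟨by simp, Eventually.of_forall fun a => ?_⟩⟩
    simp only [e]
    rw [Finset.esymm_map_val]; simp
  set j₀ := S.max' hS0 with hj₀
  have hj₀S : j₀ ∈ S := S.max'_mem hS0
  have hcount : ∀ᶠ a in 𝓝[≠] (0 : ℂ), a ∈ ball (0 : ℂ) ε →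
      ((Z a).filter fun b => H (a, b) ≠ 0).card = j₀ := by
    have hz : ∀ᶠ a in 𝓝[≠] (0 : ℂ), ∀ j ∈ Finset.range (N + 1), j ∉ S → e j a = 0 := by
      rw [Filter.eventually_all_finset]
      intro j hj
      rcases hdich j with h | h
      · exact h.mono fun a ha _ => ha
      · exact Eventually.of_forall fun a hjS => absurd (Finset.mem_filter.2 ⟨hj, h⟩) hjS
    filter_upwards [hz, (Finset.mem_filter.1 hj₀S).2, self_mem_nhdsWithin] with a h1 h2 h3 h4
    have ha : a ∈ ball (0 : ℂ) ε \ {0} := ⟨h4, h3⟩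
    refine le_antisymm ?_ ?_
    · have hne : e ((Z a).filter fun b => H (a, b) ≠ 0).card a ≠ 0 :=
        esymm_map_card_ne_zero (Z a) fun b => H (a, b)
      refine S.le_max' _ ?_
      by_contra hS
      refine hne (h1 _ ?_ hS)
      rw [Finset.mem_range, ← hN a ha]
      exact Nat.lt_succ_of_le (Finset.card_filter_le _ _)
    · by_contra hlt
      exact h2 (esymm_map_eq_zero_of_lt (not_le.1 hlt))
  obtain ⟨ε₁, hε₁, hε₁'⟩ := eventually_nhds_iff_ball.1 (eventually_nhdsWithin_iff.1 hcount)
  have hfinal : ∀ᶠ p in 𝓝 (0 : ℂ × ℂ), p ∈ ball (0 : ℂ) (min ε ε₁) ×ˢ ball (0 : ℂ) r :=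
    prod_mem_nhds (ball_mem_nhds _ (lt_min hε hε₁)) (ball_mem_nhds _ hr)
  filter_upwards [hfinal] with p hp hp1 hGp hHp
  have hpε : p.1 ∈ ball (0 : ℂ) ε \ {0} := ⟨ball_subset_ball (min_le_left _ _) hp.1, hp1⟩
  have hp2 : p.2 ∈ Z p.1 := (hZ _ hpε _).2 ⟨ball_subset_closedBall hp.2, hGp⟩
  have hpos : ∀ᶠ a in 𝓝 p.1, ∀ b ∈ (Z p.1).filter fun b => H (p.1, b) ≠ 0,
      H (a, φ p.1 b a) ≠ 0 := by
    rw [Filter.eventually_all_finset]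
    intro b hb
    rw [Finset.mem_filter] at hb
    have h1 := hφ _ hpε b hb.1
    have h2 : ContinuousAt H (p.1, φ p.1 b p.1) := by
      rw [h1.2.1]
      exact (hball _ (hin _ hpε.1 b ((hZ _ hpε b).1 hb.1).1)).1.1.2.continuousAt
    have h3 : ContinuousAt (fun a => H (a, φ p.1 b a)) p.1 :=
      ContinuousAt.comp (f := fun a => (a, φ p.1 b a)) (g := H) h2
        (continuousAt_id.prodMk h1.1.continuousAt)
    refine h3.eventually_ne ?_
    rw [h1.2.1]; exact hb.2
  -- The branches with `H ≠ 0` at `p.1` keep this property nearby. If the branch through `p` joined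
  -- them, the constant count would be exceeded.
  have hzero : ∀ᶠ a in 𝓝 p.1, H (a, φ p.1 p.2 a) = 0 := by
    have hmemε : ∀ᶠ a in 𝓝 p.1, a ∈ ball (0 : ℂ) (min ε ε₁) := isOpen_ball.mem_nhds hp.1
    filter_upwards [hpos, hZim _ hpε, hmemε, isOpen_ne.mem_nhds hp1] with a h1 h2 h3 h4
    by_contra hne
    have hc1 := hε₁' a (ball_subset_ball (min_le_right _ _) h3) h4
      (ball_subset_ball (min_le_left _ _) h3)
    have hc2 := hε₁' p.1 (ball_subset_ball (min_le_right _ _) hp.1) hp1 hpε.1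
    have hsub : (insert p.2 ((Z p.1).filter fun b => H (p.1, b) ≠ 0)).image (fun b => φ p.1 b a) ⊆
        (Z a).filter fun b => H (a, b) ≠ 0 := by
      intro b' hb'
      obtain ⟨b, hb, rfl⟩ := Finset.mem_image.1 hb'
      rcases Finset.mem_insert.1 hb with rfl | hb
      · exact Finset.mem_filter.2 ⟨h2.2.2 _ hp2, hne⟩
      · exact Finset.mem_filter.2 ⟨h2.2.2 _ (Finset.mem_filter.1 hb).1, h1 b hb⟩
    have hcle := Finset.card_le_card hsub
    rw [Finset.card_image_of_injOn (h2.2.1.mono ?_), Finset.card_insert_of_notMem, hc1, hc2] at hcle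
    · omega
    · simp [hHp]
    · intro b hb
      rcases Finset.mem_insert.1 hb with rfl | hb
      · exact hp2
      · exact (Finset.mem_filter.1 hb).1
  have hφp := hφ _ hpε _ hp2
  filter_upwards [hφp.2.2, (continuous_fst.tendsto p).eventually hzero] with z h1 h2 h3
  rw [← (h1.1 h3)] at h2
  exact h2

end

/-! ### The inverse function theorem, and zero sets that are locally graphs. -/

section

open Set Metric Filter

/-- The linear automorphism of `ℂ²` with invertible matrix `!![a, b; c, d]`. -/
def linEquiv (a b c d : ℂ) (h : a * d - b * c ≠ 0) : (ℂ × ℂ) ≃L[ℂ] ℂ × ℂ :=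
  ContinuousLinearEquiv.equivOfInverse
    ((a • ContinuousLinearMap.fst ℂ ℂ ℂ + b • ContinuousLinearMap.snd ℂ ℂ ℂ).prod
      (c • ContinuousLinearMap.fst ℂ ℂ ℂ + d • ContinuousLinearMap.snd ℂ ℂ ℂ))
    ((a * d - b * c)⁻¹ • ((d • ContinuousLinearMap.fst ℂ ℂ ℂ - b • ContinuousLinearMap.snd ℂ ℂ ℂ).prod
      (a • ContinuousLinearMap.snd ℂ ℂ ℂ - c • ContinuousLinearMap.fst ℂ ℂ ℂ)))
    (fun v => Prod.ext (by simp; linear_combination v.1 * mul_inv_cancel₀ h)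
      (by simp; linear_combination v.2 * mul_inv_cancel₀ h))
    (fun v => Prod.ext (by simp; linear_combination v.1 * mul_inv_cancel₀ h)
      (by simp; linear_combination v.2 * mul_inv_cancel₀ h))

@[simp] theorem linEquiv_apply (a b c d : ℂ) (h : a * d - b * c ≠ 0) (v : ℂ × ℂ) :
    linEquiv a b c d h v = (a * v.1 + b * v.2, c * v.1 + d * v.2) := rfl

/-- The inverse function theorem for analytic maps `(f, g)` of `ℂ²`. -/
theorem exists_local_inverse {f g : ℂ × ℂ → ℂ} {p : ℂ × ℂ} (hf : AnalyticAt ℂ f p)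
    (hg : AnalyticAt ℂ g p) (hdet : d1 f p * d2 g p - d2 f p * d1 g p ≠ 0) :
    ∃ Φ : OpenPartialHomeomorph (ℂ × ℂ) (ℂ × ℂ), p ∈ Φ.source ∧ (∀ z, Φ z = (f z, g z)) ∧
      AnalyticOnNhd ℂ Φ Φ.source ∧ AnalyticOnNhd ℂ Φ.symm Φ.target := by
  have hder : ∀ z, AnalyticAt ℂ f z → AnalyticAt ℂ g z →
      ∀ hz : d1 f z * d2 g z - d2 f z * d1 g z ≠ 0,
      HasStrictFDerivAt (fun z => (f z, g z))
        (linEquiv (d1 f z) (d2 f z) (d1 g z) (d2 g z) hz : (ℂ × ℂ) →L[ℂ] ℂ × ℂ) z := by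
    intro z hfz hgz hz
    have h1 := hfz.hasStrictFDerivAt.prodMk hgz.hasStrictFDerivAt
    convert! h1 using 1
    ext <;> simp [d1, d2]
  let Φ₀ := (hder p hf hg hdet).toOpenPartialHomeomorph (fun z => (f z, g z))
  have hU : ∀ᶠ z in 𝓝 p, AnalyticAt ℂ f z ∧ AnalyticAt ℂ g z ∧
      d1 f z * d2 g z - d2 f z * d1 g z ≠ 0 := by
    have hc : ContinuousAt (fun z => d1 f z * d2 g z - d2 f z * d1 g z) p :=
      ((analyticAt_d1 hf).continuousAt.mul (analyticAt_d2 hg).continuousAt).sub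
        ((analyticAt_d2 hf).continuousAt.mul (analyticAt_d1 hg).continuousAt)
    exact hf.eventually_analyticAt.and (hg.eventually_analyticAt.and (hc.eventually_ne hdet))
  obtain ⟨U, hUsub, hUo, hpU⟩ := _root_.mem_nhds_iff.1 hU
  refine ⟨Φ₀.restrOpen U hUo, ?_, fun z => rfl, ?_, ?_⟩
  · rw [OpenPartialHomeomorph.restrOpen_source]
    exact ⟨(hder p hf hg hdet).mem_toOpenPartialHomeomorph_source, hpU⟩
  · intro z hz
    rw [OpenPartialHomeomorph.restrOpen_source] at hz
    exact (hUsub hz.2).1.prod (hUsub hz.2).2.1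
  · intro y hy
    have hz := (Φ₀.restrOpen U hUo).map_target hy
    rw [OpenPartialHomeomorph.restrOpen_source] at hz
    obtain ⟨h1, h2, h3⟩ := hUsub hz.2
    exact (Φ₀.restrOpen U hUo).analyticAt_symm hy (h1.prod h2) (hder _ h1 h2 h3).hasFDerivAt.fderiv

/-- If `F` vanishes on the graph of `φ` and its second derivative has order `k` on it, then `F` has
order `k + 1` on it. -/
theorem exists_eq_graph_pow {F u : ℂ × ℂ → ℂ} {φ : ℂ → ℂ} {p : ℂ × ℂ} {k : ℕ}
    (hF : AnalyticAt ℂ F p) (hφ : AnalyticAt ℂ φ p.1) (hφp : φ p.1 = p.2) (hu : AnalyticAt ℂ u p)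
    (hup : u p ≠ 0) (h0 : ∀ᶠ a in 𝓝 p.1, F (a, φ a) = 0)
    (hd : ∀ᶠ z in 𝓝 p, d2 F z = (z.2 - φ z.1) ^ k * u z) :
    ∃ v : ℂ × ℂ → ℂ, AnalyticAt ℂ v p ∧ v p ≠ 0 ∧
      ∀ᶠ z in 𝓝 p, F z = (z.2 - φ z.1) ^ (k + 1) * v z := by
  -- A shear combined with a swap turns the graph of `φ` into `{s = 0}`; `τ` is its inverse.
  let σ : ℂ × ℂ → ℂ × ℂ := fun q => (q.2, q.1 + φ q.2)
  let τ : ℂ × ℂ → ℂ × ℂ := fun z => (z.2 - φ z.1, z.1)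
  have hσp : σ (0, p.1) = p := by simp [σ, hφp]
  have hτp : τ p = (0, p.1) := by simp [τ, hφp]
  have hφ2 : AnalyticAt ℂ (fun q : ℂ × ℂ => φ q.2) (0, p.1) :=
    AnalyticAt.fun_comp (g := φ) (f := fun q : ℂ × ℂ => q.2) hφ analyticAt_snd
  have hφ1 : AnalyticAt ℂ (fun q : ℂ × ℂ => φ q.1) p :=
    AnalyticAt.fun_comp (g := φ) (f := fun q : ℂ × ℂ => q.1) hφ analyticAt_fst
  have hσ : AnalyticAt ℂ σ (0, p.1) := analyticAt_snd.prod (analyticAt_fst.add hφ2)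
  have hτ : AnalyticAt ℂ τ p := (analyticAt_snd.sub hφ1).prod analyticAt_fst
  have hστ : ∀ z, σ (τ z) = z := fun z => by simp [σ, τ]
  have hσt : Tendsto σ (𝓝 (0, p.1)) (𝓝 p) := by
    have := hσ.continuousAt.tendsto; rwa [hσp] at this
  have hτt : Tendsto τ (𝓝 p) (𝓝 (0, p.1)) := by
    have := hτ.continuousAt.tendsto; rwa [hτp] at this
  obtain ⟨g, hg, hg0, hfg⟩ := exists_eq_pow_mul_of_hasDerivAt (f := F ∘ σ) (u := u ∘ σ)
    (w := fun _ => 1) (b := p.1) (k := k)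
    (AnalyticAt.comp (by rw [hσp]; exact hu) hσ) (by simpa [σ] using h0)
    (by
      filter_upwards [hσt.eventually hd, hσt.eventually hF.eventually_analyticAt] with q h1 h2
      have h3 := hasDerivAt_snd (s := q.2) (t := q.1 + φ q.2) h2.differentiableAt
      have h4 := HasDerivAt.comp_add_const q.1 (φ q.2) h3
      rw [show ((q.2, q.1 + φ q.2) : ℂ × ℂ) = σ q from rfl, h1] at h4
      simpa [σ] using h4)
  refine ⟨g ∘ τ, AnalyticAt.comp (by rw [hτp]; exact hg) hτ, ?_, ?_⟩
  · intro h
    rw [Function.comp_apply, hτp] at h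
    rw [h, mul_zero, Function.comp_apply, hσp] at hg0
    exact hup hg0.symm
  · filter_upwards [hτt.eventually hfg] with z hz
    simpa [hστ, τ] using hz

/-- Off `{z₁ = 0}` and near `0`, the zeros of `F` are graphs `z₂ = φ(z₁)`, along which `F` has
constant order. -/
def GraphZeros (F : ℂ × ℂ → ℂ) : Prop :=
  ∀ᶠ p in 𝓝 (0 : ℂ × ℂ), p.1 ≠ 0 → F p = 0 → ∃ (φ : ℂ → ℂ) (k : ℕ) (u : ℂ × ℂ → ℂ),
    AnalyticAt ℂ φ p.1 ∧ φ p.1 = p.2 ∧ AnalyticAt ℂ u p ∧ u p ≠ 0 ∧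
      ∀ᶠ z in 𝓝 p, F z = (z.2 - φ z.1) ^ k * u z

theorem iterate_d2_eq_zero {n : ℕ} : ∀ {F : ℂ × ℂ → ℂ}, AnalyticAt ℂ F 0 →
    (∀ᶠ t in 𝓝 (0 : ℂ), F (0, t) = 0) → d2^[n] F 0 = 0 := by
  induction n with
  | zero => intro F _ h; exact h.self_of_nhds
  | succ n ih =>
    intro F hF h
    rw [Function.iterate_succ_apply]
    refine ih (analyticAt_d2 hF) ?_
    have hc : Tendsto (fun t : ℂ => ((0 : ℂ), t)) (𝓝 0) (𝓝 (0 : ℂ × ℂ)) :=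
      Continuous.tendsto' (by fun_prop) _ _ rfl
    filter_upwards [h.eventually_nhds, hc.eventually hF.eventually_analyticAt] with t h1 h2
    have h3 := hasDerivAt_snd h2.differentiableAt
    have h4 : HasDerivAt (fun t => F (0, t)) 0 t :=
      (hasDerivAt_const t (0 : ℂ)).congr_of_eventuallyEq h1
    exact h3.unique h4

theorem eventually_eq_zero_of_iterate_d2 {F : ℂ × ℂ → ℂ} (hF : AnalyticAt ℂ F 0)
    (h : ∀ n, d2^[n] F 0 = 0) : ∀ᶠ t in 𝓝 (0 : ℂ), F (0, t) = 0 := by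
  have hc : Tendsto (fun t : ℂ => ((0 : ℂ), t)) (𝓝 0) (𝓝 (0 : ℂ × ℂ)) :=
    Continuous.tendsto' (by fun_prop) _ _ rfl
  have key : ∀ n, ∀ F : ℂ × ℂ → ℂ, AnalyticAt ℂ F 0 →
      ∀ᶠ t in 𝓝 (0 : ℂ), iteratedDeriv n (fun t => F (0, t)) t = d2^[n] F (0, t) := by
    intro n
    induction n with
    | zero => intro F _; simp
    | succ n ih =>
      intro F hF
      have h1 : (deriv fun t => F (0, t)) =ᶠ[𝓝 0] fun t => d2 F (0, t) := by
        filter_upwards [hc.eventually hF.eventually_analyticAt] with t h2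
        exact (hasDerivAt_snd h2.differentiableAt).deriv
      filter_upwards [ih (d2 F) (analyticAt_d2 hF), h1.eventually_nhds] with t h2 h3
      rw [iteratedDeriv_succ', Function.iterate_succ_apply, ← h2]
      exact Filter.EventuallyEq.iteratedDeriv_eq n h3
  have ha : AnalyticAt ℂ (fun t => F (0, t)) 0 :=
    AnalyticAt.fun_comp (g := F) (f := fun t : ℂ => ((0 : ℂ), t)) hF
      (analyticAt_const.prod analyticAt_id)
  have : analyticOrderAt (fun t => F (0, t)) 0 = ⊤ := by
    by_contra hne
    obtain ⟨n, hn⟩ := ENat.ne_top_iff_exists.1 hne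
    have := ((_root_.analyticOrderAt_eq_nat_iff_iteratedDeriv_eq_zero ha).1 hn.symm).2
    rw [(key n F hF).self_of_nhds] at this
    exact this (h n)
  exact analyticOrderAt_eq_top.1 this

/-- Induction by differentiation. Where `d2 F ≠ 0`, the zeros of `F` form a graph by the implicit
function theorem. A common zero of `F` and `d2 F` lies on a graph of zeros of `d2 F` by induction.
There `F` vanishes along the whole graph by `eventually_eq_zero_of_common_zero`, so its order on it
is one more than that of `d2 F`. -/
theorem graphZeros_of_iterate_d2_ne_zero (n : ℕ) : ∀ {F : ℂ × ℂ → ℂ}, AnalyticAt ℂ F 0 →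
    d2^[n] F 0 ≠ 0 → GraphZeros F := by
  induction n with
  | zero =>
    intro F hF h
    filter_upwards [hF.continuousAt.eventually_ne h] with p hp _ h0
    exact absurd h0 hp
  | succ n ih =>
    intro F hF h
    rw [Function.iterate_succ_apply] at h
    have hG := analyticAt_d2 hF
    have hgr := ih hG h
    have ha : AnalyticAt ℂ (fun t => d2 F (0, t)) 0 :=
      AnalyticAt.fun_comp (g := d2 F) (f := fun t : ℂ => ((0 : ℂ), t)) hG
        (analyticAt_const.prod analyticAt_id)
    have hne := ha.eventually_eq_zero_or_eventually_ne_zero.resolve_left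
      fun h0 => h (iterate_d2_eq_zero hG h0)
    have hdich := eventually_eq_zero_of_common_zero hG hF hne (by
      filter_upwards [hgr] with p hp h1 h2
      obtain ⟨φ, k, u, hφ, hφp, hu, hup, hFz⟩ := hp h1 h2
      refine ⟨φ, hφ, hφp, ?_⟩
      have hk : k ≠ 0 := by
        rintro rfl
        have := hFz.self_of_nhds
        rw [h2, pow_zero, one_mul] at this
        exact hup this.symm
      filter_upwards [hFz, hu.continuousAt.eventually_ne hup] with z h3 h4
      rw [h3, mul_eq_zero, or_iff_left h4, pow_eq_zero_iff hk, sub_eq_zero])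
    filter_upwards [hgr, hdich, hF.eventually_analyticAt] with p h1 h2 hFp hp1 hFp0
    by_cases hGp : d2 F p = 0
    · obtain ⟨φ, k, u, hφ, hφp, hu, hup, hGz⟩ := h1 hp1 hGp
      have hk : k ≠ 0 := by
        rintro rfl
        have := hGz.self_of_nhds
        rw [hGp, pow_zero, one_mul] at this
        exact hup this.symm
      obtain ⟨v, hv, hvp, hFz⟩ := exists_eq_graph_pow hFp hφ hφp hu hup (by
        have hc : Tendsto (fun a => (a, φ a)) (𝓝 p.1) (𝓝 p) := by
          have : ContinuousAt (fun a => (a, φ a)) p.1 := continuousAt_id.prodMk hφ.continuousAt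
          have := this.tendsto
          rwa [hφp] at this
        filter_upwards [hc.eventually (h2 hp1 hGp hFp0), hc.eventually hGz] with a h3 h4
        exact h3 (by rw [h4]; simp [hk])) hGz
      exact ⟨φ, k + 1, v, hφ, hφp, hv, hvp, hFz⟩
    · have hfst : d1 (fun z : ℂ × ℂ => z.1) p = 1 := by
        simp [d1, fderiv_fst]
      have hfst' : d2 (fun z : ℂ × ℂ => z.1) p = 0 := by
        simp [d2, fderiv_fst]
      obtain ⟨Φ, hpΦ, hΦ, -, hΦs⟩ := exists_local_inverse (f := fun z => z.1) (g := F)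
        analyticAt_fst hFp (by rw [hfst, hfst']; simpa using hGp)
      have hΦp : Φ p = (p.1, 0) := by rw [hΦ, hFp0]
      have hpt : (p.1, (0 : ℂ)) ∈ Φ.target := hΦp ▸ Φ.map_source hpΦ
      have hmk : AnalyticAt ℂ (fun a : ℂ => (a, (0 : ℂ))) p.1 := analyticAt_id.prod analyticAt_const
      have hφ : AnalyticAt ℂ (fun a => (Φ.symm (a, 0)).2) p.1 :=
        AnalyticAt.fun_comp (g := Prod.snd) (f := fun a => Φ.symm (a, 0)) analyticAt_snd
          (AnalyticAt.fun_comp (g := Φ.symm) (f := fun a : ℂ => (a, (0 : ℂ))) (hΦs _ hpt) hmk)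
      have hφp : (Φ.symm (p.1, 0)).2 = p.2 := by rw [← hΦp, Φ.left_inv hpΦ]
      obtain ⟨v, hv, hvp, hFz⟩ := exists_eq_graph_pow (k := 0) hFp hφ hφp (analyticAt_d2 hFp) hGp
        (by
          have : ∀ᶠ a in 𝓝 p.1, (a, (0 : ℂ)) ∈ Φ.target :=
            hmk.continuousAt.eventually (Φ.open_target.mem_nhds hpt)
          filter_upwards [this] with a ha
          have h3 := Φ.right_inv ha
          rw [hΦ, Prod.mk.injEq] at h3
          obtain ⟨h4, h5⟩ := h3
          change (Φ.symm (a, 0)).1 = a at h4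
          convert h5 using 2
          exact Prod.ext h4.symm rfl) (by simp)
      exact ⟨_, 1, v, hφ, hφp, hv, hvp, by simpa using hFz⟩

end

/-! ### Isolation of the singularities of plane analytic curves. -/

section

open Set Metric Filter

/-- An analytic germ of two variables that vanishes on all lines is zero. -/
theorem exists_direction {F : ℂ × ℂ → ℂ} (hF : AnalyticAt ℂ F 0)
    (hne : ¬ ∀ᶠ z in 𝓝 (0 : ℂ × ℂ), F z = 0) :
    ∃ v : ℂ × ℂ, v ≠ 0 ∧ ¬ ∀ᶠ t in 𝓝 (0 : ℂ), F (t • v) = 0 := by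
  by_contra! hcon
  obtain ⟨R, hR, hball⟩ := eventually_nhds_iff_ball.1 hF.eventually_analyticAt
  refine hne ?_
  have key : ∀ x ∈ ball (0 : ℂ × ℂ) R, x ≠ 0 → F x = 0 := by
    intro x hx hx0
    have hxn : 0 < ‖x‖ := norm_pos_iff.2 hx0
    have ha : AnalyticOnNhd ℂ (fun t : ℂ => F (t • x)) (ball 0 (R / ‖x‖)) := by
      intro t ht
      refine AnalyticAt.fun_comp (g := F) (f := fun t : ℂ => t • x) (hball _ ?_)
        (analyticAt_id.smul analyticAt_const)
      rw [mem_ball_zero_iff] at ht ⊢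
      rw [norm_smul]
      exact (lt_div_iff₀ hxn).1 ht
    have h1 := ha.eqOn_zero_of_preconnected_of_eventuallyEq_zero
      (convex_ball (0 : ℂ) (R / ‖x‖)).isPreconnected (mem_ball_self (by positivity)) (hcon x hx0)
    have h2 : (1 : ℂ) ∈ ball (0 : ℂ) (R / ‖x‖) := by
      rw [mem_ball_zero_iff] at hx ⊢
      rw [norm_one, lt_div_iff₀ hxn]; linarith
    simpa using h1 h2
  have h0 : F 0 = 0 := by
    have := (hcon (1, 0) (by simp)).self_of_nhds
    simpa using this
  filter_upwards [ball_mem_nhds _ hR] with x hx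
  by_cases hx0 : x = 0
  · rw [hx0, h0]
  · exact key x hx hx0

/-- The singularities of plane analytic curves are isolated: at all zeros near `o` but `o`
itself, `F` is a unit times a power of a function with nonzero differential. -/
theorem eventually_eq_pow_mul {F : ℂ × ℂ → ℂ} {o : ℂ × ℂ} (hF : AnalyticAt ℂ F o)
    (hne : ¬ ∀ᶠ z in 𝓝 o, F z = 0) :
    ∀ᶠ p in 𝓝[≠] o, F p = 0 → ∃ (ψ u : ℂ × ℂ → ℂ) (k : ℕ), AnalyticAt ℂ ψ p ∧ ψ p = 0 ∧
      (d1 ψ p ≠ 0 ∨ d2 ψ p ≠ 0) ∧ AnalyticAt ℂ u p ∧ u p ≠ 0 ∧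
      ∀ᶠ z in 𝓝 p, F z = ψ z ^ k * u z := by
  have htr : Tendsto (fun z : ℂ × ℂ => o + z) (𝓝 0) (𝓝 o) := Continuous.tendsto' (by fun_prop) _ _ (by simp)
  have htr' : Tendsto (fun z : ℂ × ℂ => z - o) (𝓝 o) (𝓝 0) :=
    Continuous.tendsto' (by fun_prop) _ _ (by simp)
  have hF1 : AnalyticAt ℂ (fun z => F (o + z)) 0 :=
    AnalyticAt.fun_comp (g := F) (f := fun z => o + z) (by simpa using hF)
      (analyticAt_const.add analyticAt_id)
  obtain ⟨v, hv0, hv⟩ := exists_direction hF1 (fun h => hne (by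
    filter_upwards [htr'.eventually h] with z hz
    simpa using hz))
  -- Completing `v` to a basis: the linear change `L` sends the second axis to the line spanned by
  -- `v`, on which `F` is not identically zero.
  obtain ⟨α, β, hαβ⟩ : ∃ α β : ℂ, α * v.2 - v.1 * β ≠ 0 := by
    by_cases h : v.2 = 0
    · refine ⟨0, 1, ?_⟩
      have : v.1 ≠ 0 := fun h1 => hv0 (Prod.ext h1 h)
      simpa using this
    · exact ⟨1, 0, by simpa using h⟩
  let L := linEquiv α v.1 β v.2 hαβ
  let F₀ : ℂ × ℂ → ℂ := fun q => F (o + L q)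
  have hL0 : L 0 = 0 := map_zero L
  have hF0 : AnalyticAt ℂ F₀ 0 :=
    AnalyticAt.fun_comp (g := fun z => F (o + z)) (f := fun q => L q) (by rw [hL0]; exact hF1)
      (L.toContinuousLinearMap.analyticAt 0)
  have hF0t : ∀ t, F₀ (0, t) = F (o + t • v) := by
    intro t
    simp only [F₀, L, linEquiv_apply]
    congr 2
    ext <;> simp [mul_comm]
  have hF0ne : ¬ ∀ᶠ t in 𝓝 (0 : ℂ), F₀ (0, t) = 0 := by
    simpa only [hF0t] using hv
  have hgr : GraphZeros F₀ := by
    by_contra hcon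
    refine hF0ne (eventually_eq_zero_of_iterate_d2 hF0 fun n => ?_)
    by_contra hn
    exact hcon (graphZeros_of_iterate_d2_ne_zero n hF0 hn)
  have ha : AnalyticAt ℂ (fun t => F₀ (0, t)) 0 :=
    AnalyticAt.fun_comp (g := F₀) (f := fun t : ℂ => ((0 : ℂ), t)) hF0
      (analyticAt_const.prod analyticAt_id)
  have hiso : ∀ᶠ q in 𝓝 (0 : ℂ × ℂ), q.2 ≠ 0 → F₀ (0, q.2) ≠ 0 :=
    (continuous_snd.tendsto (0 : ℂ × ℂ)).eventually (eventually_nhdsWithin_iff.1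
      (ha.eventually_eq_zero_or_eventually_ne_zero.resolve_left hF0ne))
  have hLs : Tendsto (fun z => L.symm (z - o)) (𝓝 o) (𝓝 0) := by
    have := (L.symm.continuous.tendsto 0).comp htr'
    rwa [map_zero] at this
  rw [eventually_nhdsWithin_iff]
  filter_upwards [hLs.eventually hgr, hLs.eventually hiso] with p h1 h2 hpo hFp
  set q := L.symm (p - o) with hq
  have hFq : ∀ z, F₀ (L.symm (z - o)) = F z := fun z => by simp [F₀]
  have hq0 : q ≠ 0 := by
    rw [hq, Ne, map_eq_zero_iff _ L.symm.injective, sub_eq_zero]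
    exact hpo
  have hq1 : q.1 ≠ 0 := by
    intro h
    have hq2 : q.2 ≠ 0 := fun h' => hq0 (Prod.ext h h')
    refine h2 hq2 ?_
    have : ((0 : ℂ), q.2) = q := Prod.ext h.symm rfl
    rw [this, hq, hFq, hFp]
  obtain ⟨φ, k, u, hφ, hφq, hu, huq, hFz⟩ := h1 hq1 (by rw [hq, hFq, hFp])
  have hLa : AnalyticAt ℂ (fun z => L.symm (z - o)) p :=
    AnalyticAt.fun_comp (g := L.symm) (f := fun z => z - o)
      (L.symm.toContinuousLinearMap.analyticAt _) (analyticAt_id.sub analyticAt_const)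
  have hψ : AnalyticAt ℂ (fun z => (L.symm (z - o)).2 - φ (L.symm (z - o)).1) p :=
    (AnalyticAt.fun_comp (g := Prod.snd) (f := fun z => L.symm (z - o)) analyticAt_snd hLa).sub
      (AnalyticAt.fun_comp (g := fun q : ℂ × ℂ => φ q.1) (f := fun z => L.symm (z - o))
        (AnalyticAt.fun_comp (g := φ) (f := fun q : ℂ × ℂ => q.1) hφ analyticAt_fst) hLa)
  refine ⟨_, fun z => u (L.symm (z - o)), k, hψ, by rw [← hq, hφq, sub_self], ?_,
    AnalyticAt.fun_comp (g := u) (f := fun z => L.symm (z - o)) hu hLa, huq, ?_⟩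
  -- In the original coordinates `ψ` is `z₂ - φ(z₁)` composed with an affine map, so its derivative
  -- in the direction `L (0, 1)` is `1`.
  · by_contra! hcon
    set ψ := fun z => (L.symm (z - o)).2 - φ (L.symm (z - o)).1
    have hl : HasDerivAt (fun t : ℂ => p + t • L (0, 1)) (L (0, 1)) 0 := by
      simpa using ((hasDerivAt_id (0 : ℂ)).smul_const (L (0, 1))).const_add p
    have hψ' : HasFDerivAt ψ (fderiv ℂ ψ p) (p + (0 : ℂ) • L (0, 1)) := by
      simpa using hψ.differentiableAt.hasFDerivAt
    have h3 := hψ'.comp_hasDerivAt 0 hl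
    have h4 : ψ ∘ (fun t : ℂ => p + t • L (0, 1)) = fun t => t + (q.2 - φ q.1) := by
      ext t
      have : L.symm (p + t • L (0, 1) - o) = q + t • (0, 1) := by
        rw [add_sub_right_comm, map_add, map_smul, L.symm_apply_apply]
      simp only [ψ, Function.comp_apply, this]
      simp; ring
    rw [h4, fderiv_eq_d1_d2, hcon.1, hcon.2] at h3
    have h5 := (hasDerivAt_id (0 : ℂ)).add_const (q.2 - φ q.1)
    have := h3.unique h5
    simp at this
  · filter_upwards [hLa.continuousAt.eventually hFz] with z hz
    rw [← hz, hFq]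

end

/-! ### Holomorphic flows and first integrals. -/

section

open Set Metric Filter Interval

/-- The primitive is `t ∫ g (s, r t) dr` over `[0, 1]`, which is visibly holomorphic in both
variables. For each fixed `s` it is identified with a one-variable primitive on the disc vanishing
at `0`. -/
theorem exists_primitive_snd {g : ℂ × ℂ → ℂ} {ρ τ : ℝ}
    (hg : DifferentiableOn ℂ g (ball 0 ρ ×ˢ ball 0 τ)) :
    ∃ P : ℂ × ℂ → ℂ, DifferentiableOn ℂ P (ball 0 ρ ×ˢ ball 0 τ) ∧
      ∀ s ∈ ball (0 : ℂ) ρ, P (s, 0) = 0 ∧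
        ∀ t ∈ ball (0 : ℂ) τ, HasDerivAt (fun t => P (s, t)) (g (s, t)) t := by
  have hΩ : IsOpen (ball (0 : ℂ) ρ ×ˢ ball (0 : ℂ) τ) := isOpen_ball.prod isOpen_ball
  let M : ℝ → ℂ × ℂ →L[ℂ] ℂ × ℂ := fun r =>
    ContinuousLinearMap.prod (ContinuousLinearMap.fst ℂ ℂ ℂ) 0 +
      (r : ℂ) • ContinuousLinearMap.prod 0 (ContinuousLinearMap.snd ℂ ℂ ℂ)
  have hMval : ∀ r p, M r p = (p.1, (r : ℂ) * p.2) := fun r p => by simp [M]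
  have hM : Continuous M := by fun_prop
  have hscale : ∀ r ∈ Icc (0 : ℝ) 1, ∀ t ∈ ball (0 : ℂ) τ, (r : ℂ) * t ∈ ball (0 : ℂ) τ := by
    intro r hr t ht
    rw [mem_ball_zero_iff] at ht ⊢
    rw [norm_mul, Complex.norm_real, Real.norm_eq_abs, abs_of_nonneg hr.1]
    exact (mul_le_of_le_one_left (norm_nonneg _) hr.2).trans_lt ht
  have hd := differentiableOn_average hΩ
    (fun p hp => analyticAt_of_differentiableOn (hΩ.mem_nhds hp) hg) M hM
    (fun r hr p hp => by rw [hMval]; exact ⟨hp.1, hscale r hr _ hp.2⟩) (fun _ => 1) continuous_const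
  refine ⟨fun p => p.2 * ∫ r in (0 : ℝ)..1, (1 : ℂ) * g (M r p), differentiableOn_snd.mul hd,
    fun s hs => ⟨by simp, fun t ht => ?_⟩⟩
  have hgs : DifferentiableOn ℂ (fun t => g (s, t)) (ball 0 τ) :=
    hg.comp (by fun_prop) fun t ht => ⟨hs, ht⟩
  obtain ⟨Q, hQ⟩ := hgs.isExactOn_ball
  have hPQ : ∀ t ∈ ball (0 : ℂ) τ,
      t * ∫ r in (0 : ℝ)..1, (1 : ℂ) * g (M r (s, t)) = Q t - Q 0 := by
    intro t ht
    have hder : ∀ r ∈ uIcc (0 : ℝ) 1, HasDerivAt (fun r : ℝ => Q ((r : ℂ) * t))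
        (t * (1 * g (M r (s, t)))) r := by
      intro r hr
      rw [uIcc_of_le zero_le_one] at hr
      have h2 : HasDerivAt (fun r : ℝ => (r : ℂ) * t) (1 * t) r :=
        (Complex.ofRealCLM.hasDerivAt (x := r)).mul_const t
      have h3 := HasDerivAt.scomp r (hQ _ (hscale r hr t ht)) h2
      convert! h3 using 1
      simp only [smul_eq_mul, hMval]; ring
    have hcont : ContinuousOn (fun r : ℝ => t * (1 * g (M r (s, t)))) (uIcc 0 1) := by
      rw [uIcc_of_le zero_le_one]
      refine continuousOn_const.mul (continuousOn_const.mul ?_)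
      refine hg.continuousOn.comp (by fun_prop) fun r hr => ?_
      rw [hMval]; exact ⟨hs, hscale r hr _ ht⟩
    have := intervalIntegral.integral_eq_sub_of_hasDerivAt hder hcont.intervalIntegrable
    rw [intervalIntegral.integral_const_mul] at this
    rw [this]; simp
  refine ((hQ t ht).sub_const (Q 0)).congr_of_eventuallyEq ?_
  filter_upwards [isOpen_ball.mem_nhds ht] with t' ht'
  exact hPQ t' ht'

/-- The solutions of the differential equation `x' = F(x, t)` with initial values `x(0) = s` depend
analytically on `(s, t)`. -/
theorem exists_flow {F : ℂ × ℂ → ℂ} (hF : AnalyticAt ℂ F 0) :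
    ∃ Φ : ℂ × ℂ → ℂ, AnalyticAt ℂ Φ 0 ∧ (∀ᶠ s in 𝓝 (0 : ℂ), Φ (s, 0) = s) ∧
      ∀ᶠ p in 𝓝 (0 : ℂ × ℂ), HasDerivAt (fun t => Φ (p.1, t)) (F (Φ p, p.2)) p.2 := by
  have hFb : ∀ᶠ p in 𝓝 (0 : ℂ × ℂ), ‖F p‖ < ‖F 0‖ + 1 :=
    hF.continuousAt.norm.eventually_lt_const (by linarith)
  have hFb' : ∀ᶠ p in 𝓝 (0 : ℂ × ℂ), ‖fderiv ℂ F p‖ < ‖fderiv ℂ F 0‖ + 1 :=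
    hF.fderiv.continuousAt.norm.eventually_lt_const (by linarith)
  obtain ⟨R, hR, hball⟩ := eventually_nhds_iff_ball.1
    ((hF.eventually_analyticAt.and hFb).and hFb')
  set M := ‖F 0‖ + 1 with hM
  set K := ‖fderiv ℂ F 0‖ + 1 with hK
  have hM0 : 0 < M := by positivity
  have hK0 : 0 < K := by positivity
  -- The three bounds on the time `τ` keep `t` in the domain of `F`, keep the iterates within `R /
  -- 2` of their initial value, and make the Picard step a contraction by `1 / 2`.
  obtain ⟨τ, hτ, hτR, hτM, hτK⟩ : ∃ τ > 0, τ ≤ R ∧ M * τ ≤ R / 2 ∧ K * τ ≤ 1 / 2 := by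
    refine ⟨min R (min (R / 2 / M) (1 / 2 / K)), by positivity, min_le_left _ _, ?_, ?_⟩
    · rw [mul_comm, ← le_div_iff₀ hM0]
      exact (min_le_right _ _).trans (min_le_left _ _)
    · rw [mul_comm, ← le_div_iff₀ hK0]
      exact (min_le_right _ _).trans (min_le_right _ _)
  have hmem : ∀ p : ℂ × ℂ, p ∈ ball (0 : ℂ × ℂ) R ↔ ‖p.1‖ < R ∧ ‖p.2‖ < R := by
    intro p
    rw [mem_ball_zero_iff, Prod.norm_def, max_lt_iff]
  have hlip : ∀ p ∈ ball (0 : ℂ × ℂ) R, ∀ q ∈ ball (0 : ℂ × ℂ) R, ‖F p - F q‖ ≤ K * ‖p - q‖ := by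
    intro p hp q hq
    exact (convex_ball (0 : ℂ × ℂ) R).norm_image_sub_le_of_norm_fderiv_le (𝕜 := ℂ)
      (fun x hx => (hball x hx).1.1.differentiableAt) (fun x hx => (hball x hx).2.le) hq hp
  set Ω := ball (0 : ℂ) (R / 2) ×ˢ ball (0 : ℂ) τ with hΩdef
  have hΩ : IsOpen Ω := isOpen_ball.prod isOpen_ball
  let good : (ℂ × ℂ → ℂ) → Prop := fun Φ => DifferentiableOn ℂ Φ Ω ∧
    ∀ s ∈ ball (0 : ℂ) (R / 2), Φ (s, 0) = s ∧ ∀ t ∈ ball (0 : ℂ) τ, ‖Φ (s, t) - s‖ ≤ R / 2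
  have hgoodmem : ∀ Φ : ℂ × ℂ → ℂ, ∀ s ∈ ball (0 : ℂ) (R / 2), ∀ t ∈ ball (0 : ℂ) τ,
      ‖Φ (s, t) - s‖ ≤ R / 2 → (Φ (s, t), t) ∈ ball (0 : ℂ × ℂ) R := by
    intro Φ s hs t ht h
    rw [mem_ball_zero_iff] at hs ht
    rw [hmem]
    refine ⟨?_, ht.trans_le hτR⟩
    calc ‖Φ (s, t)‖ = ‖(Φ (s, t) - s) + s‖ := by rw [sub_add_cancel]
      _ ≤ ‖Φ (s, t) - s‖ + ‖s‖ := norm_add_le _ _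
      _ < R := by linarith
  have hmv : ∀ (h h' : ℂ → ℂ) (C : ℝ), (∀ t ∈ ball (0 : ℂ) τ, HasDerivAt h (h' t) t) →
      (∀ t ∈ ball (0 : ℂ) τ, ‖h' t‖ ≤ C) → ∀ t ∈ ball (0 : ℂ) τ, ‖h t - h 0‖ ≤ C * τ := by
    intro h h' C h1 h2 t ht
    have hC : 0 ≤ C := (norm_nonneg _).trans (h2 t ht)
    have h3 := (convex_ball (0 : ℂ) τ).norm_image_sub_le_of_norm_hasDerivWithin_le
      (fun x hx => (h1 x hx).hasDerivWithinAt) h2 (mem_ball_self hτ) ht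
    rw [sub_zero] at h3
    exact h3.trans (mul_le_mul_of_nonneg_left (mem_ball_zero_iff.1 ht).le hC)
  -- One Picard iteration, performed on functions of `(s, t)` jointly so that holomorphy in the
  -- initial value is kept.
  have hstep : ∀ Φ, good Φ → ∃ Φ', good Φ' ∧ ∀ s ∈ ball (0 : ℂ) (R / 2), ∀ t ∈ ball (0 : ℂ) τ,
      HasDerivAt (fun t => Φ' (s, t)) (F (Φ (s, t), t)) t := by
    intro Φ hΦ
    have hg : DifferentiableOn ℂ (fun p : ℂ × ℂ => F (Φ p, p.2)) Ω := by
      intro p hp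
      have h1 : (Φ p, p.2) ∈ ball (0 : ℂ × ℂ) R := hgoodmem Φ p.1 hp.1 p.2 hp.2 ((hΦ.2 _ hp.1).2 _ hp.2)
      exact DifferentiableAt.comp_differentiableWithinAt (g := F) (f := fun p : ℂ × ℂ => (Φ p, p.2)) p
        (hball _ h1).1.1.differentiableAt ((hΦ.1 p hp).prodMk differentiableWithinAt_snd)
    obtain ⟨P, hPd, hP⟩ := exists_primitive_snd hg
    have hder : ∀ s ∈ ball (0 : ℂ) (R / 2), ∀ t ∈ ball (0 : ℂ) τ,
      HasDerivAt (fun t => s + P (s, t)) (F (Φ (s, t), t)) t := fun s hs t ht =>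
        ((hP s hs).2 t ht).const_add s
    refine ⟨fun p => p.1 + P p, ⟨differentiableOn_fst.add hPd, fun s hs => ⟨?_, fun t ht => ?_⟩⟩, hder⟩
    · simp [(hP s hs).1]
    · have := hmv (fun t => s + P (s, t)) _ M (hder s hs) (fun t ht =>
        (hball _ (hgoodmem Φ s hs t ht ((hΦ.2 _ hs).2 _ ht))).1.2.le) t ht
      rw [(hP s hs).1, add_zero] at this
      exact this.trans hτM
  choose! step hstepg hstepd using hstep
  have hgood0 : good (fun p => p.1) := ⟨differentiableOn_fst, fun s hs => ⟨rfl, fun t ht => by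
    simp; linarith⟩⟩
  let Φs : ℕ → ℂ × ℂ → ℂ := fun n => step^[n] fun p => p.1
  have hsucc : ∀ n, Φs (n + 1) = step (Φs n) := fun n => Function.iterate_succ_apply' _ _ _
  have hgood : ∀ n, good (Φs n) := by
    intro n
    induction n with
    | zero => exact hgood0
    | succ n ih => rw [hsucc]; exact hstepg _ ih
  have hderiv : ∀ n, ∀ s ∈ ball (0 : ℂ) (R / 2), ∀ t ∈ ball (0 : ℂ) τ,
      HasDerivAt (fun t => Φs (n + 1) (s, t)) (F (Φs n (s, t), t)) t := by
    intro n; rw [hsucc]; exact hstepd _ (hgood n)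
  have hdiff : ∀ n, ∀ s ∈ ball (0 : ℂ) (R / 2), ∀ t ∈ ball (0 : ℂ) τ,
      ‖Φs (n + 1) (s, t) - Φs n (s, t)‖ ≤ R / 2 * (1 / 2) ^ n := by
    intro n
    induction n with
    | zero =>
      intro s hs t ht
      have := ((hgood 1).2 s hs).2 t ht
      simpa [Φs] using this
    | succ n ih =>
      intro s hs t ht
      have := hmv (fun t => Φs (n + 2) (s, t) - Φs (n + 1) (s, t)) _ (K * (R / 2 * (1 / 2) ^ n))
        (fun t ht => (hderiv (n + 1) s hs t ht).sub (hderiv n s hs t ht)) (fun t ht => ?_) t ht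
      · simp only [((hgood (n + 2)).2 s hs).1, ((hgood (n + 1)).2 s hs).1, sub_self, sub_zero] at this
        refine this.trans ?_
        calc K * (R / 2 * (1 / 2) ^ n) * τ = (K * τ) * (R / 2 * (1 / 2) ^ n) := by ring
          _ ≤ (1 / 2) * (R / 2 * (1 / 2) ^ n) := by gcongr
          _ = R / 2 * (1 / 2) ^ (n + 1) := by ring
      · refine (hlip _ (hgoodmem _ s hs t ht (((hgood (n + 1)).2 s hs).2 t ht)) _
          (hgoodmem _ s hs t ht (((hgood n).2 s hs).2 t ht))).trans ?_
        refine mul_le_mul_of_nonneg_left ?_ hK0.le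
        have : ‖((Φs (n + 1) (s, t), t) : ℂ × ℂ) - (Φs n (s, t), t)‖ =
            ‖Φs (n + 1) (s, t) - Φs n (s, t)‖ := by
          simp [Prod.norm_def]
        rw [this]; exact ih s hs t ht
  have hdist : ∀ p ∈ Ω, ∀ n, dist (Φs n p) (Φs (n + 1) p) ≤ R / 2 * (1 / 2) ^ n := by
    intro p hp n
    rw [dist_comm, dist_eq_norm]
    exact hdiff n p.1 hp.1 p.2 hp.2
  have hlim : ∀ p ∈ Ω, ∃ y, Tendsto (fun n => Φs n p) atTop (𝓝 y) := fun p hp =>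
    cauchySeq_tendsto_of_complete (cauchySeq_of_le_geometric (1 / 2) (R / 2) (by norm_num) (hdist p hp))
  choose! Φ hΦ using hlim
  have hunif : TendstoUniformlyOn Φs Φ atTop Ω := by
    rw [Metric.tendstoUniformlyOn_iff]
    intro ε hε
    have h1 : Tendsto (fun n : ℕ => R / 2 * (1 / 2 : ℝ) ^ n / (1 - 1 / 2)) atTop (𝓝 0) := by
      have := ((tendsto_pow_atTop_nhds_zero_of_lt_one (r := (1 / 2 : ℝ)) (by norm_num)
        (by norm_num)).const_mul (R / 2)).div_const (1 - 1 / 2)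
      simpa using this
    filter_upwards [h1.eventually_lt_const hε] with n hn p hp
    rw [dist_comm]
    exact (dist_le_of_le_geometric_of_tendsto (1 / 2) (R / 2) (by norm_num) (hdist p hp) (hΦ p hp)
      n).trans_lt hn
  have hcont : ContinuousOn Φ Ω :=
    hunif.continuousOn (Eventually.of_forall fun n => (hgood n).1.continuousOn).frequently
  have hΦ0 : ∀ s ∈ ball (0 : ℂ) (R / 2), Φ (s, 0) = s := by
    intro s hs
    have h1 := hΦ (s, 0) ⟨hs, mem_ball_self hτ⟩
    have h2 : Tendsto (fun n => Φs n (s, 0)) atTop (𝓝 s) := by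
      simp only [((hgood _).2 s hs).1]
      exact tendsto_const_nhds
    exact tendsto_nhds_unique h1 h2
  have hΦb : ∀ s ∈ ball (0 : ℂ) (R / 2), ∀ t ∈ ball (0 : ℂ) τ, ‖Φ (s, t) - s‖ ≤ R / 2 := by
    intro s hs t ht
    exact le_of_tendsto ((hΦ (s, t) ⟨hs, ht⟩).sub_const s).norm
      (Eventually.of_forall fun n => ((hgood n).2 s hs).2 t ht)
  have hslice2 : ∀ s ∈ ball (0 : ℂ) (R / 2),
      TendstoLocallyUniformlyOn (fun n t => Φs n (s, t)) (fun t => Φ (s, t)) atTop (ball 0 τ) := by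
    intro s hs
    exact ((hunif.comp fun t => (s, t)).mono fun t ht => ⟨hs, ht⟩).tendstoLocallyUniformlyOn
  have hslice1 : ∀ t ∈ ball (0 : ℂ) τ,
      TendstoLocallyUniformlyOn (fun n s => Φs n (s, t)) (fun s => Φ (s, t)) atTop
        (ball 0 (R / 2)) := by
    intro t ht
    exact ((hunif.comp fun s => (s, t)).mono fun s hs => ⟨hs, ht⟩).tendstoLocallyUniformlyOn
  have hdn2 : ∀ n, ∀ s ∈ ball (0 : ℂ) (R / 2),
      DifferentiableOn ℂ (fun t => Φs n (s, t)) (ball 0 τ) := fun n s hs =>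
    (hgood n).1.comp (by fun_prop) fun t ht => ⟨hs, ht⟩
  have hdn1 : ∀ n, ∀ t ∈ ball (0 : ℂ) τ,
      DifferentiableOn ℂ (fun s => Φs n (s, t)) (ball 0 (R / 2)) := fun n t ht =>
    (hgood n).1.comp (by fun_prop) fun s hs => ⟨hs, ht⟩
  have hd2 : ∀ s ∈ ball (0 : ℂ) (R / 2), DifferentiableOn ℂ (fun t => Φ (s, t)) (ball 0 τ) :=
    fun s hs => (hslice2 s hs).differentiableOn (Eventually.of_forall fun n => hdn2 n s hs) isOpen_ball
  have hd1 : ∀ t ∈ ball (0 : ℂ) τ, DifferentiableOn ℂ (fun s => Φ (s, t)) (ball 0 (R / 2)) :=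
    fun t ht => (hslice1 t ht).differentiableOn (Eventually.of_forall fun n => hdn1 n t ht) isOpen_ball
  have hode : ∀ s ∈ ball (0 : ℂ) (R / 2), ∀ t ∈ ball (0 : ℂ) τ,
      HasDerivAt (fun t => Φ (s, t)) (F (Φ (s, t), t)) t := by
    intro s hs t ht
    have h1 := ((hslice2 s hs).deriv (Eventually.of_forall fun n => hdn2 n s hs) isOpen_ball).tendsto_at
      ht
    have h2 : Tendsto (fun n => F (Φs n (s, t), t)) atTop (𝓝 (F (Φ (s, t), t))) := by
      have hc := (hball _ (hgoodmem Φ s hs t ht (hΦb s hs t ht))).1.1.continuousAt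
      exact hc.tendsto.comp ((hΦ (s, t) ⟨hs, ht⟩).prodMk_nhds tendsto_const_nhds)
    have h3 := tendsto_nhds_unique (h1.comp (tendsto_add_atTop_nat 1)) (h2.congr fun n =>
      (hderiv n s hs t ht).deriv.symm)
    rw [← h3]
    exact ((hd2 s hs).differentiableAt (isOpen_ball.mem_nhds ht)).hasDerivAt
  refine ⟨Φ, ?_, ?_, ?_⟩
  -- The uniform limit is continuous and holomorphic in each variable, which suffices by Osgood's
  -- theorem.
  · obtain ⟨R', hR', hlt⟩ := exists_between (lt_min (half_pos hR) hτ)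
    have hs1 : closedBall (0 : ℂ) R' ⊆ ball 0 (R / 2) :=
      closedBall_subset_ball (hlt.trans_le (min_le_left _ _))
    have hs2 : closedBall (0 : ℂ) R' ⊆ ball 0 τ :=
      closedBall_subset_ball (hlt.trans_le (min_le_right _ _))
    refine analyticAt_of_separately hR' (hcont.mono (prod_mono hs1 hs2)) (fun t ht => ?_)
      fun s hs => ?_
    · exact (hd1 t (hs2 ht)).mono (ball_subset_closedBall.trans hs1)
    · exact (hd2 s (hs1 hs)).mono (ball_subset_closedBall.trans hs2)
  · filter_upwards [ball_mem_nhds (0 : ℂ) (half_pos hR)] with s hs using hΦ0 s hs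
  · have : Ω ∈ 𝓝 (0 : ℂ × ℂ) := hΩ.mem_nhds ⟨mem_ball_self (half_pos hR), mem_ball_self hτ⟩
    filter_upwards [this] with p hp using hode p.1 hp.1 p.2 hp.2

/-- A holomorphic foliation of a surface, given by `A ds + B dt` with `A ≠ 0`, has a local first
integral with prescribed values on the transversal `{t = 0}`. -/
theorem exists_first_integral {A B : ℂ × ℂ → ℂ} (hA : AnalyticAt ℂ A 0) (hB : AnalyticAt ℂ B 0)
    (hA0 : A 0 ≠ 0) :
    ∃ y : ℂ × ℂ → ℂ, AnalyticAt ℂ y 0 ∧ (∀ᶠ s in 𝓝 (0 : ℂ), y (s, 0) = s) ∧ d1 y 0 = 1 ∧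
      ∀ᶠ p in 𝓝 (0 : ℂ × ℂ), d2 y p * A p = d1 y p * B p := by
  have hd1one : ∀ f : ℂ × ℂ → ℂ, AnalyticAt ℂ f 0 → (∀ᶠ s in 𝓝 (0 : ℂ), f (s, 0) = s) →
      d1 f 0 = 1 := by
    intro f hf h
    have h1 : HasDerivAt (fun s => f (s, 0)) (d1 f (0, 0)) 0 :=
      hasDerivAt_fst (s := 0) (t := 0) hf.differentiableAt
    exact h1.unique ((hasDerivAt_id (0 : ℂ)).congr_of_eventuallyEq h)
  -- The leaves of `A ds + B dt = 0` are the solutions of `s' = -B / A` as graphs over `t`. The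
  -- first integral sends a point to the initial value of the leaf through it.
  obtain ⟨Φ, hΦ, hΦ0, hode⟩ := exists_flow (F := fun p => -B p / A p) (hB.neg.div hA hA0)
  have hsnd : d1 (fun z : ℂ × ℂ => z.2) 0 = 0 := by simp [d1, fderiv_snd]
  have hsnd' : d2 (fun z : ℂ × ℂ => z.2) 0 = 1 := by simp [d2, fderiv_snd]
  obtain ⟨Ψ, h0Ψ, hΨ, -, hΨs⟩ := exists_local_inverse (f := Φ) (g := fun z => z.2) hΦ
    analyticAt_snd (by rw [hsnd, hsnd', hd1one Φ hΦ hΦ0]; simp)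
  have hΨ0 : Ψ 0 = 0 := by
    rw [hΨ]
    exact Prod.ext hΦ0.self_of_nhds rfl
  have h0t : (0 : ℂ × ℂ) ∈ Ψ.target := hΨ0 ▸ Ψ.map_source h0Ψ
  have hy : AnalyticAt ℂ (fun q => (Ψ.symm q).1) 0 :=
    AnalyticAt.fun_comp (g := Prod.fst) (f := Ψ.symm) analyticAt_fst (hΨs 0 h0t)
  have hinit : ∀ᶠ s in 𝓝 (0 : ℂ), (Ψ.symm (s, 0)).1 = s := by
    have hc : Tendsto (fun s : ℂ => (s, (0 : ℂ))) (𝓝 0) (𝓝 (0 : ℂ × ℂ)) :=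
      Continuous.tendsto' (by fun_prop) _ _ rfl
    filter_upwards [hΦ0, hc.eventually (Ψ.open_source.mem_nhds h0Ψ)] with s h1 h2
    have : Ψ (s, 0) = (s, 0) := by rw [hΨ, h1]
    rw [← this, Ψ.left_inv h2]
  refine ⟨_, hy, hinit, hd1one _ hy hinit, ?_⟩
  have hback : Tendsto Ψ.symm (𝓝 0) (𝓝 0) := by
    have := (Ψ.continuousAt_symm h0t).tendsto
    rwa [← hΨ0, Ψ.left_inv h0Ψ, hΨ0] at this
  filter_upwards [hback.eventually (Ψ.open_source.mem_nhds h0Ψ), Ψ.open_target.mem_nhds h0t,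
    hback.eventually hode, hy.eventually_analyticAt, hA.continuousAt.eventually_ne hA0]
    with q h1 h2 h3 h4 h5
  set z := Ψ.symm q with hz
  have hq : Ψ z = q := Ψ.right_inv h2
  have hq' : (Φ z, z.2) = q := by rw [← hΨ, hq]
  have h6 : HasDerivAt (fun t => ((Φ (z.1, t), t) : ℂ × ℂ)) (-B (Φ z, z.2) / A (Φ z, z.2), 1) z.2 :=
    h3.prodMk (hasDerivAt_id _)
  have h7 : HasFDerivAt (fun q => (Ψ.symm q).1) (fderiv ℂ (fun q => (Ψ.symm q).1) q)
      (Φ (z.1, z.2), z.2) := by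
    rw [show ((Φ (z.1, z.2), z.2) : ℂ × ℂ) = q from hq']
    exact h4.differentiableAt.hasFDerivAt
  have h8 := HasFDerivAt.comp_hasDerivAt (f := fun t => ((Φ (z.1, t), t) : ℂ × ℂ)) z.2 h7 h6
  -- The first integral is constant along each leaf; comparing with the chain rule `h8` gives the
  -- differential relation.
  have h9 : HasDerivAt ((fun q => (Ψ.symm q).1) ∘ fun t => ((Φ (z.1, t), t) : ℂ × ℂ)) 0 z.2 := by
    refine (hasDerivAt_const z.2 z.1).congr_of_eventuallyEq ?_
    have hc : ContinuousAt (fun t : ℂ => (z.1, t)) z.2 := by fun_prop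
    filter_upwards [hc.eventually (Ψ.open_source.mem_nhds h1)] with t ht
    have : Ψ (z.1, t) = (Φ (z.1, t), t) := hΨ _
    simp only [Function.comp_apply]
    rw [← this, Ψ.left_inv ht]
  have h10 := h8.unique h9
  rw [fderiv_eq_d1_d2, hq'] at h10
  simp only [mul_one] at h10
  field_simp at h10
  linear_combination h10

end

/-! ### Manifold charts as maps to `ℂ × ℂ`, differentials and dual frames. -/

section

open Set Filter

set_option linter.unusedSectionVars false

theorem contDiffAt_omega_iff_analyticAt {E F : Type*} [NormedAddCommGroup E] [NormedSpace ℂ E]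
    [NormedAddCommGroup F] [NormedSpace ℂ F] [CompleteSpace F] {f : E → F} {x : E} :
    ContDiffAt ℂ ω f x ↔ AnalyticAt ℂ f x := by
  rw [← contDiffWithinAt_univ, contDiffWithinAt_omega_iff_analyticWithinAt, analyticWithinAt_univ]

/-- The model space `ℂ²`, as a product. -/
def pairEquiv : C2 ≃L[ℂ] ℂ × ℂ :=
  (EuclideanSpace.equiv (Fin 2) ℂ).trans (ContinuousLinearEquiv.finTwoArrow ℂ ℂ)

section

variable {X : Type*} [TopologicalSpace X] [ChartedSpace C2 X]

/-- The chart `z`, as a map to `ℂ × ℂ`. -/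
def pairChart (z : OpenPartialHomeomorph X C2) : OpenPartialHomeomorph X (ℂ × ℂ) :=
  z.trans pairEquiv.toHomeomorph.toOpenPartialHomeomorph

@[simp]
theorem pairChart_apply (z : OpenPartialHomeomorph X C2) (y : X) :
    pairChart z y = (z y 0, z y 1) := rfl

@[simp]
theorem pairChart_source (z : OpenPartialHomeomorph X C2) : (pairChart z).source = z.source := by
  simp [pairChart]

theorem mem_pairChart_target {z : OpenPartialHomeomorph X C2} {q : ℂ × ℂ} :
    q ∈ (pairChart z).target ↔ pairEquiv.symm q ∈ z.target := by
  simp [pairChart]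

theorem pairChart_symm_apply (z : OpenPartialHomeomorph X C2) (q : ℂ × ℂ) :
    (pairChart z).symm q = z.symm (pairEquiv.symm q) := rfl

/-- `f` is holomorphic near `p`. -/
def HoloAt (f : X → ℂ) (p : X) : Prop := ContMDiffAt 𝓘(ℂ, C2) 𝓘(ℂ, ℂ) ω f p

variable {z : OpenPartialHomeomorph X C2} {p : X}

variable [IsManifold 𝓘(ℂ, C2) ω X]

theorem HoloAt.analyticAt {f : X → ℂ} (hz : HoloChart z) {q : ℂ × ℂ} (hq : q ∈ (pairChart z).target)
    (hf : HoloAt f ((pairChart z).symm q)) :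
    AnalyticAt ℂ (fun q => f ((pairChart z).symm q)) q := by
  rw [← contDiffAt_omega_iff_analyticAt, ← contMDiffAt_iff_contDiffAt]
  have h1 : ContMDiffAt 𝓘(ℂ, C2) 𝓘(ℂ, C2) ω z.symm (pairEquiv.symm q) :=
    contMDiffAt_symm_of_mem_maximalAtlas hz (mem_pairChart_target.1 hq)
  have h2 : ContMDiffAt 𝓘(ℂ, ℂ × ℂ) 𝓘(ℂ, C2) ω (fun q => pairEquiv.symm q) q :=
    pairEquiv.symm.contDiff.contMDiff.contMDiffAt
  have h3 : ContMDiffAt 𝓘(ℂ, ℂ × ℂ) 𝓘(ℂ, C2) ω (pairChart z).symm q :=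
    (ContMDiffAt.comp (I' := 𝓘(ℂ, C2)) (g := z.symm) (f := pairEquiv.symm) q h1 h2 :)
  exact ContMDiffAt.comp (I' := 𝓘(ℂ, C2)) q hf h3

theorem HoloChart.contMDiffAt_pair (hz : HoloChart z) (hp : p ∈ z.source) :
    ContMDiffAt 𝓘(ℂ, C2) 𝓘(ℂ, ℂ × ℂ) ω (pairChart z) p := by
  have h1 : ContMDiffAt 𝓘(ℂ, C2) 𝓘(ℂ, C2) ω z p := contMDiffAt_of_mem_maximalAtlas hz hp
  have h2 : ContMDiffAt 𝓘(ℂ, C2) 𝓘(ℂ, ℂ × ℂ) ω pairEquiv (z p) :=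
    pairEquiv.contDiff.contMDiff.contMDiffAt
  exact (ContMDiffAt.comp (I' := 𝓘(ℂ, C2)) (g := pairEquiv) (f := z) p h2 h1 :)

theorem HoloAt.comp_pairChart {g : ℂ × ℂ → ℂ} (hz : HoloChart z) (hp : p ∈ z.source)
    (hg : AnalyticAt ℂ g (pairChart z p)) : HoloAt (fun y => g (pairChart z y)) p := by
  rw [← contDiffAt_omega_iff_analyticAt, ← contMDiffAt_iff_contDiffAt] at hg
  exact ContMDiffAt.comp (I' := 𝓘(ℂ, ℂ × ℂ)) p hg (hz.contMDiffAt_pair hp)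

theorem HoloAt.continuousAt {f : X → ℂ} (hf : HoloAt f p) : ContinuousAt f p :=
  ContMDiffAt.continuousAt hf

theorem holoOn_iff {f : X → ℂ} {U : Set X} (hU : IsOpen U) : HoloOn f U ↔ ∀ y ∈ U, HoloAt f y :=
  ⟨fun h _ hy => ContMDiffOn.contMDiffAt h (hU.mem_nhds hy),
    fun h y hy => ContMDiffAt.contMDiffWithinAt (h y hy)⟩

theorem HoloChart.mdifferentiable (hz : HoloChart z) :
    z.MDifferentiable 𝓘(ℂ, C2) 𝓘(ℂ, C2) := by
  have h1 : z ∈ IsManifold.maximalAtlas 𝓘(ℂ, C2) 1 X :=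
    IsManifold.maximalAtlas_subset_of_le (by simp) hz
  have : IsManifold 𝓘(ℂ, C2) 1 X := IsManifold.of_le (n := ω) (by simp)
  exact ⟨fun y hy => (mdifferentiableAt_of_mem_maximalAtlas h1 hy).mdifferentiableWithinAt,
    fun y hy => (mdifferentiableAt_symm_of_mem_maximalAtlas h1 hy).mdifferentiableWithinAt⟩

theorem dd_comp_pairChart {g : ℂ × ℂ → ℂ} (hz : HoloChart z) (hp : p ∈ z.source)
    (hg : DifferentiableAt ℂ g (pairChart z p)) (a : Tan p) :
    dd (fun y => g (pairChart z y)) p a =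
      fderiv ℂ g (pairChart z p) (pairEquiv (mfderiv 𝓘(ℂ, C2) 𝓘(ℂ, C2) z p a)) := by
  have h1 : HasMFDerivAt 𝓘(ℂ, C2) 𝓘(ℂ, C2) z p (mfderiv 𝓘(ℂ, C2) 𝓘(ℂ, C2) z p) :=
    (hz.mdifferentiable.mdifferentiableAt hp).hasMFDerivAt
  have h2 : HasMFDerivAt 𝓘(ℂ, C2) 𝓘(ℂ, ℂ) (fun v => g (pairEquiv v)) (z p)
      ((fderiv ℂ g (pairChart z p)).comp (pairEquiv : C2 →L[ℂ] ℂ × ℂ)) :=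
    (HasFDerivAt.comp (z p) (f := pairEquiv) (g := g) hg.hasFDerivAt
      pairEquiv.hasFDerivAt).hasMFDerivAt
  have h3 := (HasMFDerivAt.comp p h2 h1).mfderiv
  have h4 : dd (fun y => g (pairChart z y)) p = _ := h3
  rw [h4]; rfl

theorem dd_coord_zero (hz : HoloChart z) (hp : p ∈ z.source) (a : Tan p) :
    dd (fun y => z y 0) p a = (pairEquiv (mfderiv 𝓘(ℂ, C2) 𝓘(ℂ, C2) z p a)).1 := by
  have := dd_comp_pairChart (g := Prod.fst) hz hp differentiableAt_fst a
  rw [fderiv_fst] at this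
  exact this

theorem dd_coord_one (hz : HoloChart z) (hp : p ∈ z.source) (a : Tan p) :
    dd (fun y => z y 1) p a = (pairEquiv (mfderiv 𝓘(ℂ, C2) 𝓘(ℂ, C2) z p a)).2 := by
  have := dd_comp_pairChart (g := Prod.snd) hz hp differentiableAt_snd a
  rw [fderiv_snd] at this
  exact this

theorem dd_comp {g : ℂ × ℂ → ℂ} (hz : HoloChart z) (hp : p ∈ z.source)
    (hg : DifferentiableAt ℂ g (pairChart z p)) (a : Tan p) :
    dd (fun y => g (pairChart z y)) p a =
      d1 g (pairChart z p) * dd (fun y => z y 0) p a +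
        d2 g (pairChart z p) * dd (fun y => z y 1) p a := by
  rw [dd_comp_pairChart hz hp hg, fderiv_eq_d1_d2, dd_coord_zero hz hp, dd_coord_one hz hp]

theorem dd_congr {f g : X → ℂ} (h : f =ᶠ[𝓝 p] g) (a : Tan p) : dd f p a = dd g p a := by
  have h1 : mfderiv 𝓘(ℂ, C2) 𝓘(ℂ, ℂ) f p = mfderiv 𝓘(ℂ, C2) 𝓘(ℂ, ℂ) g p := h.mfderiv_eq
  exact congrArg (fun l : C2 →L[ℂ] ℂ => l a) h1

/-- The dual frame of the frame `dz₁, dz₂`. -/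
def frame (z : OpenPartialHomeomorph X C2) (q : ℂ × ℂ) (y : X) : Tan y :=
  mfderiv 𝓘(ℂ, C2) 𝓘(ℂ, C2) z.symm (z y) (pairEquiv.symm q)

theorem mfderiv_frame (hz : HoloChart z) (hp : p ∈ z.source) (q : ℂ × ℂ) :
    mfderiv 𝓘(ℂ, C2) 𝓘(ℂ, C2) z p (frame z q p) = pairEquiv.symm q := by
  obtain ⟨a, ha⟩ := hz.mdifferentiable.mfderiv_surjective hp (pairEquiv.symm q)
  have h := congrArg (fun l : C2 →L[ℂ] C2 => l a) (hz.mdifferentiable.symm_comp_deriv hp)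
  have h' : frame z q p = a := by
    have h2 : frame z q p =
      mfderiv 𝓘(ℂ, C2) 𝓘(ℂ, C2) z.symm (z p) (mfderiv 𝓘(ℂ, C2) 𝓘(ℂ, C2) z p a) := by
      rw [ha]; rfl
    exact h2.trans h
  rw [h', ha]

theorem dd_frame_zero (hz : HoloChart z) (hp : p ∈ z.source) (q : ℂ × ℂ) :
    dd (fun y => z y 0) p (frame z q p) = q.1 := by
  rw [dd_coord_zero hz hp, mfderiv_frame hz hp, ContinuousLinearEquiv.apply_symm_apply]

theorem dd_frame_one (hz : HoloChart z) (hp : p ∈ z.source) (q : ℂ × ℂ) :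
    dd (fun y => z y 1) p (frame z q p) = q.2 := by
  rw [dd_coord_one hz hp, mfderiv_frame hz hp, ContinuousLinearEquiv.apply_symm_apply]

theorem eq_of_dd_eq (hz : HoloChart z) (hp : p ∈ z.source) {a b : Tan p}
    (h0 : dd (fun y => z y 0) p a = dd (fun y => z y 0) p b)
    (h1 : dd (fun y => z y 1) p a = dd (fun y => z y 1) p b) : a = b := by
  rw [dd_coord_zero hz hp, dd_coord_zero hz hp] at h0
  rw [dd_coord_one hz hp, dd_coord_one hz hp] at h1
  apply hz.mdifferentiable.mfderiv_injective hp
  apply pairEquiv.injective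
  exact Prod.ext h0 h1

theorem eq_frame (hz : HoloChart z) (hp : p ∈ z.source) (a : Tan p) :
    a = dd (fun y => z y 0) p a • frame z (1, 0) p + dd (fun y => z y 1) p a • frame z (0, 1) p := by
  apply eq_of_dd_eq hz hp
  · rw [map_add, map_smul, map_smul, dd_frame_zero hz hp, dd_frame_zero hz hp]
    simp
  · rw [map_add, map_smul, map_smul, dd_frame_one hz hp, dd_frame_one hz hp]
    simp

end

end

/-! ### Coordinate changes, and holomorphy of forms in a frame. -/

section

open Set Filter

set_option linter.unusedSectionVars false

section

variable {X : Type*} [TopologicalSpace X] [ChartedSpace C2 X] [IsManifold 𝓘(ℂ, C2) ω X]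
  {z : OpenPartialHomeomorph X C2} {p : X}

theorem HoloAt.eventually {f : X → ℂ} (hf : HoloAt f p) : ∀ᶠ y in 𝓝 p, HoloAt f y :=
  (contMDiffAt_iff_contMDiffAt_nhds (by simp)).1 hf

/-- The inverse function theorem, applied after `z`. The formula for the new coordinates holds at
every point and not only on the source, so it can be substituted inside `dd`. -/
theorem exists_chart (hz : HoloChart z) (hp : p ∈ z.source) {g₀ g₁ : ℂ × ℂ → ℂ}
    (h₀ : AnalyticAt ℂ g₀ (pairChart z p)) (h₁ : AnalyticAt ℂ g₁ (pairChart z p))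
    (hdet : d1 g₀ (pairChart z p) * d2 g₁ (pairChart z p) -
      d2 g₀ (pairChart z p) * d1 g₁ (pairChart z p) ≠ 0) {N : Set X} (hN : N ∈ 𝓝 p) :
    ∃ ζ : OpenPartialHomeomorph X C2, HoloChart ζ ∧ p ∈ ζ.source ∧ ζ.source ⊆ N ∧
      ζ.source ⊆ z.source ∧
      (∀ y, pairChart ζ y = (g₀ (pairChart z y), g₁ (pairChart z y))) := by
  obtain ⟨Φ, hpΦ, hΦ, hΦa, hΦs⟩ := exists_local_inverse h₀ h₁ hdet
  set ζ' : OpenPartialHomeomorph X C2 :=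
    ((pairChart z).trans Φ).trans pairEquiv.symm.toHomeomorph.toOpenPartialHomeomorph with hζ'
  have hsrc : ∀ y, y ∈ ζ'.source ↔ y ∈ z.source ∧ pairChart z y ∈ Φ.source := by
    intro y; simp [hζ']
  have htgt : ∀ v, v ∈ ζ'.target ↔ pairEquiv v ∈ Φ.target ∧
      Φ.symm (pairEquiv v) ∈ (pairChart z).target := by
    intro v; simp [hζ']
  have hval : ∀ y, ζ' y = pairEquiv.symm (Φ (pairChart z y)) := fun y => rfl
  have hsym : ∀ v, ζ'.symm v = (pairChart z).symm (Φ.symm (pairEquiv v)) := fun y => rfl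
  have hζc : HoloChart ζ' := by
    apply OpenPartialHomeomorph.mem_maximalAtlas_of_contMDiffOn
    · intro y hy
      obtain ⟨hy1, hy2⟩ := (hsrc y).1 hy
      have e1 := hz.contMDiffAt_pair hy1
      have e2 : ContMDiffAt 𝓘(ℂ, ℂ × ℂ) 𝓘(ℂ, ℂ × ℂ) ω Φ (pairChart z y) :=
        contMDiffAt_iff_contDiffAt.2 (contDiffAt_omega_iff_analyticAt.2 (hΦa _ hy2))
      have e3 : ContMDiffAt 𝓘(ℂ, ℂ × ℂ) 𝓘(ℂ, C2) ω pairEquiv.symm (Φ (pairChart z y)) :=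
        pairEquiv.symm.contDiff.contMDiff.contMDiffAt
      exact (ContMDiffAt.comp y e3 (ContMDiffAt.comp y e2 e1)).contMDiffWithinAt
    · intro v hv
      obtain ⟨hv1, hv2⟩ := (htgt v).1 hv
      have e1 : ContMDiffAt 𝓘(ℂ, C2) 𝓘(ℂ, ℂ × ℂ) ω pairEquiv v :=
        pairEquiv.contDiff.contMDiff.contMDiffAt
      have e2 : ContMDiffAt 𝓘(ℂ, ℂ × ℂ) 𝓘(ℂ, ℂ × ℂ) ω Φ.symm (pairEquiv v) :=
        contMDiffAt_iff_contDiffAt.2 (contDiffAt_omega_iff_analyticAt.2 (hΦs _ hv1))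
      have e3 : ContMDiffAt 𝓘(ℂ, ℂ × ℂ) 𝓘(ℂ, C2) ω pairEquiv.symm (Φ.symm (pairEquiv v)) :=
        pairEquiv.symm.contDiff.contMDiff.contMDiffAt
      have e4 : ContMDiffAt 𝓘(ℂ, C2) 𝓘(ℂ, C2) ω z.symm
          (pairEquiv.symm (Φ.symm (pairEquiv v))) :=
        contMDiffAt_symm_of_mem_maximalAtlas hz (mem_pairChart_target.1 hv2)
      have e5 := ContMDiffAt.comp (I' := 𝓘(ℂ, C2)) v e4
        (ContMDiffAt.comp v e3 (ContMDiffAt.comp v e2 e1))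
      exact e5.contMDiffWithinAt
  refine ⟨ζ'.restr N, ?_, ?_, ?_, ?_, ?_⟩
  · have := restr_mem_maximalAtlas (contDiffGroupoid ω 𝓘(ℂ, C2)) hζc
      (isOpen_interior (s := N))
    have h2 : ζ'.restr (interior N) = ζ'.restr N := by
      apply OpenPartialHomeomorph.ext
      · simp
      · simp
      · simp
    exact h2 ▸ this
  · simp only [OpenPartialHomeomorph.restr_source, mem_inter_iff]
    exact ⟨(hsrc p).2 ⟨hp, hpΦ⟩, mem_interior_iff_mem_nhds.2 hN⟩
  · exact fun y hy => interior_subset (by simpa using hy.2)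
  · exact fun y hy => ((hsrc y).1 (by simpa using hy.1)).1
  · intro y
    have h1 : ∀ v : C2, (v 0, v 1) = pairEquiv v := fun v => rfl
    rw [pairChart_apply, h1]
    change pairEquiv (ζ' y) = _
    rw [hval, ContinuousLinearEquiv.apply_symm_apply, hΦ]

/-- The frame is the image of a constant vector field on `ℂ²` under the tangent map of `z.symm`. -/
theorem contMDiffAt_frame (hz : HoloChart z) (hp : p ∈ z.source) (q : ℂ × ℂ) :
    ContMDiffAt 𝓘(ℂ, C2) (𝓘(ℂ, C2).prod 𝓘(ℂ, C2)) ω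
      (fun y => Bundle.TotalSpace.mk' C2 (E := fun x : X => Tan x) y (frame z q y)) p := by
  have : IsManifold 𝓘(ℂ, C2) 1 X := IsManifold.of_le (n := ω) (by simp)
  have h1 : ContMDiffOn (𝓘(ℂ, C2).tangent) (𝓘(ℂ, C2).tangent) ω
      (tangentMapWithin 𝓘(ℂ, C2) 𝓘(ℂ, C2) z.symm z.target)
      (Bundle.TotalSpace.proj ⁻¹' z.target) :=
    (contMDiffOn_symm_of_mem_maximalAtlas hz).contMDiffOn_tangentMapWithin (by simp)
      z.open_target.uniqueMDiffOn
  have h2 : ContMDiffAt 𝓘(ℂ, C2) (𝓘(ℂ, C2).tangent) ω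
      (fun y => (⟨z y, pairEquiv.symm q⟩ : TangentBundle 𝓘(ℂ, C2) C2)) p := by
    have h3 : ContMDiff 𝓘(ℂ, C2) (𝓘(ℂ, C2).tangent) ω
        (fun v => (⟨v, pairEquiv.symm q⟩ : TangentBundle 𝓘(ℂ, C2) C2)) :=
      contMDiff_vectorSpace_iff_contDiff.2 contDiff_const
    exact ContMDiffAt.comp (I' := 𝓘(ℂ, C2)) p h3.contMDiffAt
      (contMDiffAt_of_mem_maximalAtlas hz hp)
  have h4 := ContMDiffAt.comp p (h1.contMDiffAt
    ((z.open_target.preimage (FiberBundle.continuous_proj C2 _)).mem_nhds (z.map_source hp))) h2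
  refine h4.congr_of_eventuallyEq ?_
  filter_upwards [z.open_source.mem_nhds hp] with y hy
  have h5 : tangentMapWithin 𝓘(ℂ, C2) 𝓘(ℂ, C2) z.symm z.target
      (⟨z y, pairEquiv.symm q⟩ : TangentBundle 𝓘(ℂ, C2) C2) =
      ⟨z.symm (z y), mfderivWithin 𝓘(ℂ, C2) 𝓘(ℂ, C2) z.symm z.target (z y) (pairEquiv.symm q)⟩ :=
    rfl
  simp only [Function.comp]
  rw [h5, mfderivWithin_of_isOpen z.open_target (z.map_source hy)]
  have h6 : z.symm (z y) = y := z.left_inv hy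
  unfold frame
  -- The two sides live over `z.symm (z y)` and over `y`. Abstracting the derivative allows the
  -- equality of base points to be rewritten.
  generalize mfderiv 𝓘(ℂ, C2) 𝓘(ℂ, C2) z.symm (z y) = l
  revert l
  rw [h6]
  intro l
  rfl

theorem Differential.holoAt_apply (w : Differential X) (hz : HoloChart z) (hp : p ∈ z.source)
    (q r : ℂ × ℂ) : HoloAt (fun y => w.toFun y (frame z q y) (frame z r y)) p := by
  have h1 : ContMDiffAt 𝓘(ℂ, C2) (𝓘(ℂ, C2).prod 𝓘(ℂ, ℂ)) ω
      (fun y => Bundle.TotalSpace.mk' ℂ (E := Bundle.Trivial X ℂ) y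
        (w.toFun y (frame z q y) (frame z r y))) p :=
    ContMDiffAt.clm_bundle_apply₂ (F₁ := C2) (F₂ := C2) (w.holo p)
      (contMDiffAt_frame hz hp q) (contMDiffAt_frame hz hp r)
  rw [Bundle.contMDiffAt_totalSpace] at h1
  exact h1.2

theorem HoloFormOn.holoAt_apply {μ : Form X} {U : Set X} (hU : IsOpen U) (hμ : HoloFormOn μ U)
    (hz : HoloChart z) (hp : p ∈ z.source) (hpU : p ∈ U) (q : ℂ × ℂ) :
    HoloAt (fun y => μ y (frame z q y)) p := by
  have h1 : ContMDiffAt 𝓘(ℂ, C2) (𝓘(ℂ, C2).prod 𝓘(ℂ, ℂ)) ω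
      (fun y => Bundle.TotalSpace.mk' ℂ (E := Bundle.Trivial X ℂ) y
        (μ y (frame z q y))) p :=
    ContMDiffAt.clm_bundle_apply (F₁ := C2) (ContMDiffOn.contMDiffAt hμ (hU.mem_nhds hpU))
      (contMDiffAt_frame hz hp q)
  rw [Bundle.contMDiffAt_totalSpace] at h1
  exact h1.2

theorem contMDiffAt_dd {f : X → ℂ} (hf : HoloAt f p) :
    ContMDiffAt 𝓘(ℂ, C2) (𝓘(ℂ, C2).prod 𝓘(ℂ, C2 →L[ℂ] ℂ)) ω
    (fun x : X => Bundle.TotalSpace.mk' (C2 →L[ℂ] ℂ)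
      (E := fun x : X => Tan x →L[ℂ] ℂ) x (dd f x)) p := by
  have : IsManifold 𝓘(ℂ, C2) 1 X := IsManifold.of_le (n := ω) (by simp)
  have h := ContMDiffAt.mfderiv_const (m := ω) hf (by simp)
  rw [contMDiffAt_hom_bundle]
  refine ⟨contMDiffAt_id, ?_⟩
  convert h using 1
  funext x
  ext v
  simp only [inTangentCoordinates, ContinuousLinearMap.inCoordinates]
  rw [TangentBundle.continuousLinearMapAt_model_space]
  simp
  rfl

theorem holoFormOn_linearCombination {U : Set X} {α β f g : X → ℂ}
    (hα : ∀ y ∈ U, HoloAt α y) (hβ : ∀ y ∈ U, HoloAt β y) (hf : ∀ y ∈ U, HoloAt f y)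
    (hg : ∀ y ∈ U, HoloAt g y) :
    HoloFormOn (fun y => α y • dd f y + β y • dd g y) U := by
  intro y hy
  exact (ContMDiffAt.add_section (ContMDiffAt.smul_section (hα y hy) (contMDiffAt_dd (hf y hy)))
    (ContMDiffAt.smul_section (hβ y hy) (contMDiffAt_dd (hg y hy)))).contMDiffWithinAt

end

end

/-! ### Simultaneous normal coordinates for two foliations tangent along a curve. -/

section

open Set Filter

theorem d1_congr {f g : ℂ × ℂ → ℂ} {p : ℂ × ℂ} (h : f =ᶠ[𝓝 p] g) : d1 f p = d1 g p := by
  rw [d1, d1, h.fderiv_eq]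

theorem d2_congr {f g : ℂ × ℂ → ℂ} {p : ℂ × ℂ} (h : f =ᶠ[𝓝 p] g) : d2 f p = d2 g p := by
  rw [d2, d2, h.fderiv_eq]

theorem fderiv_comp_pair {V f g : ℂ × ℂ → ℂ} {q : ℂ × ℂ} (hV : DifferentiableAt ℂ V (f q, g q))
    (hf : DifferentiableAt ℂ f q) (hg : DifferentiableAt ℂ g q) (v : ℂ × ℂ) :
    fderiv ℂ (fun q => V (f q, g q)) q v =
      d1 V (f q, g q) * fderiv ℂ f q v + d2 V (f q, g q) * fderiv ℂ g q v := by
  have h := HasFDerivAt.comp q (g := V) (f := fun q => (f q, g q)) hV.hasFDerivAt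
    (hf.hasFDerivAt.prodMk hg.hasFDerivAt)
  have h' : fderiv ℂ (fun q => V (f q, g q)) q = _ := h.fderiv
  rw [h', ContinuousLinearMap.comp_apply, fderiv_eq_d1_d2]
  rfl

theorem eventually_eq_zero_of_d2 {x : ℂ × ℂ → ℂ} (hx : AnalyticAt ℂ x 0) (h0 : x 0 = 0)
    (hd : ∀ᶠ t in 𝓝 (0 : ℂ), d2 x (0, t) = 0) : ∀ᶠ t in 𝓝 (0 : ℂ), x (0, t) = 0 := by
  have hc : Tendsto (fun t : ℂ => ((0 : ℂ), t)) (𝓝 0) (𝓝 (0 : ℂ × ℂ)) :=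
    (continuous_const.prodMk continuous_id).tendsto' _ _ rfl
  obtain ⟨r, hr, hball⟩ := Metric.eventually_nhds_iff_ball.1
    (hd.and (hc.eventually hx.eventually_analyticAt))
  filter_upwards [Metric.ball_mem_nhds (0 : ℂ) hr] with t ht
  have hder : ∀ s ∈ Metric.ball (0 : ℂ) r, HasDerivAt (fun s => x (0, s)) 0 s := fun s hs => by
    have := hasDerivAt_snd (hball s hs).2.differentiableAt
    rwa [(hball s hs).1] at this
  have h1 := (convex_ball (0 : ℂ) r).is_const_of_fderivWithin_eq_zero (𝕜 := ℂ)
    (f := fun s => x (0, s))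
    (fun s hs => (hder s hs).differentiableAt.differentiableWithinAt)
    (fun s hs => by
      rw [fderivWithin_of_isOpen Metric.isOpen_ball hs]
      ext
      simpa using (hder s hs).deriv) ht (Metric.mem_ball_self hr)
  exact h1.trans h0

/-- Let `x`, `y` be the first integrals of the two forms that equal `s` on `{t = 0}`. Since `B₁`
vanishes on `{s = 0}`, this axis is a leaf of the first foliation and `x = s · unit`. In the
coordinates `(x, t)`, `y` becomes a function `V` with `V (x, 0) = x` and `∂V/∂t = x ^ (m + 1) ·
unit`. Hence `y = x + x ^ (m + 1) Y` with `Y = t · unit`. The factor `G` compares the given forms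
with `dx` and `dy`. -/
theorem exists_normal_coordinates {A₁ B₁ A₂ B₂ u : ℂ × ℂ → ℂ} {m : ℕ}
    (hA₁ : AnalyticAt ℂ A₁ 0) (hB₁ : AnalyticAt ℂ B₁ 0) (hA₂ : AnalyticAt ℂ A₂ 0)
    (hB₂ : AnalyticAt ℂ B₂ 0) (hu : AnalyticAt ℂ u 0) (hA₁0 : A₁ 0 ≠ 0) (hA₂0 : A₂ 0 ≠ 0)
    (hu0 : u 0 ≠ 0) (hB : ∀ᶠ t in 𝓝 (0 : ℂ), B₁ (0, t) = 0)
    (hw : ∀ᶠ p in 𝓝 (0 : ℂ × ℂ), A₁ p * B₂ p - A₂ p * B₁ p = p.1 ^ (m + 1) * u p) :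
    ∃ x Y G e : ℂ × ℂ → ℂ, AnalyticAt ℂ x 0 ∧ AnalyticAt ℂ Y 0 ∧ AnalyticAt ℂ G 0 ∧
      AnalyticAt ℂ e 0 ∧ Y 0 = 0 ∧ d1 x 0 * d2 Y 0 - d2 x 0 * d1 Y 0 ≠ 0 ∧
      e 0 ≠ 0 ∧ (∀ᶠ p in 𝓝 (0 : ℂ × ℂ), x p = p.1 * e p) ∧
      ∀ᶠ p in 𝓝 (0 : ℂ × ℂ), ∀ σ τ : ℂ, (A₁ p * σ + B₁ p * τ) * (A₂ p * σ + B₂ p * τ) =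
        G p * ((d1 x p * σ + d2 x p * τ) *
          (d1 (fun p => x p * (1 + x p ^ m * Y p)) p * σ +
            d2 (fun p => x p * (1 + x p ^ m * Y p)) p * τ)) := by
  obtain ⟨x, hx, hxs, hx1, hxe⟩ := exists_first_integral hA₁ hB₁ hA₁0
  obtain ⟨y, hy, hys, hy1, hye⟩ := exists_first_integral hA₂ hB₂ hA₂0
  have hx0 : x 0 = 0 := hxs.self_of_nhds
  have hc : Tendsto (fun t : ℂ => ((0 : ℂ), t)) (𝓝 0) (𝓝 (0 : ℂ × ℂ)) :=
    (continuous_const.prodMk continuous_id).tendsto' _ _ rfl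
  have hxt : ∀ᶠ t in 𝓝 (0 : ℂ), x (0, t) = 0 := by
    refine eventually_eq_zero_of_d2 hx hx0 ?_
    filter_upwards [hB, hc.eventually hxe, hc.eventually (hA₁.continuousAt.eventually_ne hA₁0)]
      with t h1 h2 h3
    rw [h1, mul_zero] at h2
    exact (mul_eq_zero.1 h2).resolve_right h3
  obtain ⟨e, he, he0, hxe'⟩ := exists_eq_mul_of_eq_zero (f := x) (b := 0) hx hxt
  change AnalyticAt ℂ e 0 at he
  replace he0 : e 0 = 1 := he0.trans hx1
  have hdet : d1 x 0 * d2 Prod.snd 0 - d2 x 0 * d1 Prod.snd 0 ≠ 0 := by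
    simp [d1, d2, fderiv_snd] at hx1 ⊢
    simp [hx1]
  obtain ⟨Φ, h0Φ, hΦ, hΦa, hΦs⟩ := exists_local_inverse hx analyticAt_snd hdet
  have hΦ0 : Φ 0 = 0 := by rw [hΦ, hx0]; rfl
  have h0t : (0 : ℂ × ℂ) ∈ Φ.target := hΦ0 ▸ Φ.map_source h0Φ
  have hs0 : Φ.symm 0 = 0 := by rw [← hΦ0, Φ.left_inv h0Φ, hΦ0]
  have hsA : AnalyticAt ℂ Φ.symm 0 := hΦs 0 h0t
  have hsT : Tendsto Φ.symm (𝓝 0) (𝓝 0) := by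
    have := hsA.continuousAt.tendsto; rwa [hs0] at this
  have hV : AnalyticAt ℂ (fun q => y (Φ.symm q)) 0 :=
    AnalyticAt.comp (by rw [hs0]; exact hy) hsA
  set V : ℂ × ℂ → ℂ := fun q => y (Φ.symm q) with hVdef
  -- This is the unit in `∂V/∂t`. It comes from computing `dx ∧ dy` twice: as `d1 x · ∂V/∂t`, and as
  -- `d1 x · d1 y / (A₁ A₂)` times the given wedge, whose `p.1` is then replaced by `x / e`.
  set r : ℂ × ℂ → ℂ := fun q => d1 y q * u q / (A₁ q * A₂ q * e q ^ (m + 1)) with hr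
  have hrA : AnalyticAt ℂ r 0 := by
    refine AnalyticAt.div ((analyticAt_d1 hy).mul hu) ((hA₁.mul hA₂).mul (he.pow _)) ?_
    simp [hA₁0, hA₂0, he0]
  have hr0 : r 0 ≠ 0 := by simp [hr, hA₁0, hA₂0, he0, hy1, hu0]
  have hrA' : AnalyticAt ℂ (fun q => r (Φ.symm q)) 0 :=
    AnalyticAt.comp (g := r) (by rw [hs0]; exact hrA) hsA
  have hyV : ∀ q ∈ Φ.source, y q = V (x q, q.2) := fun q hq => by
    rw [hVdef]
    change y q = y (Φ.symm (x q, q.2))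
    rw [← hΦ q, Φ.left_inv hq]
  have hΦT : Tendsto Φ (𝓝 0) (𝓝 0) := by
    have := (hΦa 0 h0Φ).continuousAt.tendsto; rwa [hΦ0] at this
  have hx1e : ∀ᶠ q in 𝓝 (0 : ℂ × ℂ), d1 x q ≠ 0 :=
    (analyticAt_d1 hx).continuousAt.eventually_ne (by rw [hx1]; exact one_ne_zero)
  have hy1e : ∀ᶠ q in 𝓝 (0 : ℂ × ℂ), d1 y q ≠ 0 :=
    (analyticAt_d1 hy).continuousAt.eventually_ne (by rw [hy1]; exact one_ne_zero)
  have hkey : ∀ᶠ q in 𝓝 (0 : ℂ × ℂ), d2 V (Φ q) = (Φ q).1 ^ (m + 1) * r q := by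
    filter_upwards [Φ.open_source.mem_nhds h0Φ, hx.eventually_analyticAt,
      hΦT.eventually hV.eventually_analyticAt, hxe, hye, hxe', hw, hx1e,
      hA₁.continuousAt.eventually_ne hA₁0, hA₂.continuousAt.eventually_ne hA₂0,
      he.continuousAt.eventually_ne (y := 0) (by rw [he0]; exact one_ne_zero)]
      with q hq hxq hVq e1 e2 e3 e4 n1 n2 n3 n4
    rw [hΦ q] at hVq ⊢
    have hyq : y =ᶠ[𝓝 q] fun q => V (x q, q.2) :=
      eventually_of_mem (Φ.open_source.mem_nhds hq) hyV
    have c1 : d1 y q = d1 V (x q, q.2) * d1 x q := by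
      rw [d1_congr hyq, d1, fderiv_comp_pair hVq.differentiableAt hxq.differentiableAt
        differentiableAt_snd, fderiv_snd]
      simp [d1]
    have c2 : d2 y q = d1 V (x q, q.2) * d2 x q + d2 V (x q, q.2) := by
      rw [d2_congr hyq, d2, fderiv_comp_pair hVq.differentiableAt hxq.differentiableAt
        differentiableAt_snd, fderiv_snd]
      simp [d2]
    have c3 : d1 x q * (A₁ q * A₂ q * d2 V (x q, q.2)) =
        d1 x q * (d1 y q * (q.1 ^ (m + 1) * u q)) := by
      linear_combination (-(A₁ q * A₂ q * d1 x q)) * c2 + (A₁ q * A₂ q * d2 x q) * c1 +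
        A₁ q * d1 x q * e2 - A₂ q * d1 y q * e1 + d1 x q * d1 y q * e4
    have c4 := mul_left_cancel₀ n1 c3
    have c5 : x q ^ (m + 1) * r q = q.1 ^ (m + 1) * (d1 y q * u q) / (A₁ q * A₂ q) := by
      rw [e3, hr, mul_pow]
      field_simp
    change d2 V (x q, q.2) = x q ^ (m + 1) * r q
    rw [c5, eq_div_iff (mul_ne_zero n2 n3)]
    linear_combination c4
  have hder : ∀ᶠ p in 𝓝 ((0 : ℂ), (0 : ℂ)),
      HasDerivAt (fun t => V (p.1, t) - p.1) (p.1 ^ (m + 1) * r (Φ.symm p)) p.2 := by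
    filter_upwards [hV.eventually_analyticAt, hsT.eventually hkey, Φ.open_target.mem_nhds h0t]
      with p hp h1 h2
    rw [Φ.right_inv h2] at h1
    have := (hasDerivAt_snd (s := p.1) (t := p.2) (f := V) hp.differentiableAt).sub_const p.1
    rwa [h1] at this
  have hbot : ∀ᶠ s in 𝓝 (0 : ℂ), V (s, 0) - s = 0 := by
    have hc' : Tendsto (fun s : ℂ => (s, (0 : ℂ))) (𝓝 0) (𝓝 (0 : ℂ × ℂ)) :=
      (continuous_id.prodMk continuous_const).tendsto' _ _ rfl
    filter_upwards [hxs, hys, hc'.eventually_mem (Φ.open_source.mem_nhds h0Φ)] with s h1 h2 h3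
    have := hyV _ h3
    simp only [h1, h2] at this
    rw [← this, sub_self]
  -- Integration from the transversal, where `V (s, 0) = s`: the difference is `s ^ (m + 1) * t * g`
  -- with `g` a unit.
  obtain ⟨g, hg, hg0, hge⟩ := exists_eq_pow_mul_snd (f := fun p => V p - p.1) (a := 0)
    (n := m + 1) hrA' hbot hder
  have hgΦ : AnalyticAt ℂ (fun q => g (Φ q)) 0 :=
    AnalyticAt.comp (by rw [hΦ0]; exact hg) (hΦa 0 h0Φ)
  replace hg0 : g 0 ≠ 0 := by
    have : g 0 = r (Φ.symm 0) := hg0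
    rw [this, hs0]; exact hr0
  have hYd : ∀ v : ℂ × ℂ, fderiv ℂ (fun q : ℂ × ℂ => q.2 * g (Φ q)) 0 v = v.2 * g 0 := fun v => by
    rw [fderiv_fun_mul differentiableAt_snd hgΦ.differentiableAt]
    simp [fderiv_snd, hΦ0, mul_comm]
  refine ⟨x, fun q => q.2 * g (Φ q), fun q => A₁ q * A₂ q / (d1 x q * d1 y q), e, hx,
    analyticAt_snd.mul hgΦ, (hA₁.mul hA₂).div ((analyticAt_d1 hx).mul (analyticAt_d1 hy))
      (by simp [hx1, hy1]), he, by simp, ?_, by simp [he0], hxe', ?_⟩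
  · rw [hx1, d2, hYd, d1, hYd]
    simpa using hg0
  · have hyx : ∀ᶠ q in 𝓝 (0 : ℂ × ℂ), y q = x q * (1 + x q ^ m * (q.2 * g (Φ q))) := by
      filter_upwards [hΦT.eventually hge, Φ.open_source.mem_nhds h0Φ] with q h1 h2
      rw [hyV q h2]
      rw [hΦ] at h1 ⊢
      simp only at h1
      rw [sub_eq_iff_eq_add.1 h1]
      ring
    filter_upwards [hyx.eventually_nhds, hxe, hye, hx1e, hy1e] with q h1 h2 h3 h4 h5 σ τ
    rw [← d1_congr h1, ← d2_congr h1]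
    field_simp
    linear_combination (-(d1 x q * (A₁ q * σ + B₁ q * τ) * τ)) * h3 -
      τ * A₂ q * (d1 y q * σ + d2 y q * τ) * h2

end

/-! ### Discriminants in coordinates, and strict normal forms. -/

section

open Set Filter

theorem d1_eq_of_hasDerivAt {g : ℂ × ℂ → ℂ} {s t c : ℂ} (hg : DifferentiableAt ℂ g (s, t))
    (h : HasDerivAt (fun s => g (s, t)) c s) : d1 g (s, t) = c :=
  (hasDerivAt_fst hg).unique h

theorem d2_eq_of_hasDerivAt {g : ℂ × ℂ → ℂ} {s t c : ℂ} (hg : DifferentiableAt ℂ g (s, t))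
    (h : HasDerivAt (fun t => g (s, t)) c t) : d2 g (s, t) = c :=
  (hasDerivAt_snd hg).unique h

section

variable {X : Type*} [TopologicalSpace X] [ChartedSpace C2 X] [IsManifold 𝓘(ℂ, C2) ω X]
  {z : OpenPartialHomeomorph X C2} {p : X} {w : Differential X}

theorem Differential.apply_add (w : Differential X) (y : X) (a b : Tan y) :
    w.toFun y (a + b) (a + b) = w.toFun y a a + 2 * w.toFun y a b + w.toFun y b b := by
  simp only [map_add, add_apply]
  rw [w.symm y b a]
  ring

/-- Polarisation recovers the bilinear form from the quadratic one, and degeneracy is then the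
vanishing of a 2 × 2 determinant. -/
theorem mem_discSupport_iff_of_quadratic (hz : HoloChart z) (hp : p ∈ z.source) {a b c : ℂ}
    (h : ∀ v : Tan p, w.toFun p v v = a * dd (fun y => z y 0) p v ^ 2 +
      2 * b * (dd (fun y => z y 0) p v * dd (fun y => z y 1) p v) +
      c * dd (fun y => z y 1) p v ^ 2) :
    p ∈ discSupport w ↔ a * c - b ^ 2 = 0 := by
  have hbil : ∀ u v : Tan p, w.toFun p u v =
      a * (dd (fun y => z y 0) p u * dd (fun y => z y 0) p v) +
      b * (dd (fun y => z y 0) p u * dd (fun y => z y 1) p v +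
        dd (fun y => z y 1) p u * dd (fun y => z y 0) p v) +
      c * (dd (fun y => z y 1) p u * dd (fun y => z y 1) p v) := fun u v => by
    have h1 := w.apply_add p u v
    rw [h, h u, h v, map_add, map_add] at h1
    linear_combination (-1 / 2) * h1
  constructor
  · rintro ⟨u, hu, hk⟩
    have k0 := hk (frame z (1, 0) p)
    have k1 := hk (frame z (0, 1) p)
    simp only [hbil, dd_frame_zero hz hp, dd_frame_one hz hp] at k0 k1
    by_contra hne
    apply hu
    apply eq_of_dd_eq hz hp
    · rw [map_zero]
      refine (mul_eq_zero.1 (?_ : (a * c - b ^ 2) * _ = 0)).resolve_left hne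
      linear_combination c * k0 - b * k1
    · rw [map_zero]
      refine (mul_eq_zero.1 (?_ : (a * c - b ^ 2) * _ = 0)).resolve_left hne
      linear_combination a * k1 - b * k0
  · intro hd
    by_cases hab : a = 0 ∧ b = 0
    · refine ⟨frame z (1, 0) p, fun h0 => ?_, fun v => ?_⟩
      · have := dd_frame_zero hz hp (1, 0)
        rw [h0, map_zero] at this
        simp at this
      · rw [hbil, dd_frame_zero hz hp, dd_frame_one hz hp, hab.1, hab.2]
        ring
    -- The vector with components `(-b, a)` is killed by the first row of the matrix, and by the
    -- second because the determinant is zero.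
    · refine ⟨frame z (-b, a) p, fun h0 => hab ?_, fun v => ?_⟩
      · have h1 := dd_frame_zero hz hp (-b, a)
        have h2 := dd_frame_one hz hp (-b, a)
        rw [h0, map_zero] at h1 h2
        exact ⟨h2.symm, neg_eq_zero.1 h1.symm⟩
      · rw [hbil, dd_frame_zero hz hp, dd_frame_one hz hp]
        linear_combination dd (fun y => z y 1) p v * hd

/-- The determinant of a product of two linear forms is minus a quarter of the square of their
wedge. -/
theorem mem_discSupport_iff_of_product (hz : HoloChart z) (hp : p ∈ z.source)
    {c A₁ B₁ A₂ B₂ : ℂ}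
    (h : ∀ v : Tan p, w.toFun p v v =
      c * ((A₁ * dd (fun y => z y 0) p v + B₁ * dd (fun y => z y 1) p v) *
        (A₂ * dd (fun y => z y 0) p v + B₂ * dd (fun y => z y 1) p v))) :
    p ∈ discSupport w ↔ c * (A₁ * B₂ - A₂ * B₁) = 0 := by
  rw [mem_discSupport_iff_of_quadratic hz hp (a := c * (A₁ * A₂))
    (b := c * (A₁ * B₂ + A₂ * B₁) / 2) (c := c * (B₁ * B₂)) (fun v => by rw [h]; ring)]
  have : c * (A₁ * A₂) * (c * (B₁ * B₂)) - (c * (A₁ * B₂ + A₂ * B₁) / 2) ^ 2 =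
    -(c * (A₁ * B₂ - A₂ * B₁)) ^ 2 / 4 := by ring
  rw [this]
  simp

theorem dd_mul_one_add (hz : HoloChart z) (hp : p ∈ z.source) (m : ℕ) (v : Tan p) :
    dd (fun y => z y 0 * (1 + z y 0 ^ m * z y 1)) p v =
      (1 + (m + 1) * z p 0 ^ m * z p 1) * dd (fun y => z y 0) p v +
        z p 0 ^ (m + 1) * dd (fun y => z y 1) p v := by
  have hg : Differentiable ℂ (fun q : ℂ × ℂ => q.1 * (1 + q.1 ^ m * q.2)) := by fun_prop
  have h := dd_comp hz hp (hg (pairChart z p)) v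
  have e1 : d1 (fun q : ℂ × ℂ => q.1 * (1 + q.1 ^ m * q.2)) (z p 0, z p 1) =
      1 + (m + 1) * z p 0 ^ m * z p 1 := by
    refine d1_eq_of_hasDerivAt (hg _) ?_
    have := ((hasDerivAt_id (z p 0)).add ((hasDerivAt_pow (m + 1) (z p 0)).mul_const (z p 1)))
    refine (this.congr_deriv ?_).congr_of_eventuallyEq (Eventually.of_forall fun s => ?_)
    · simp
    · simp only [Pi.add_apply, id]; ring
  have e2 : d2 (fun q : ℂ × ℂ => q.1 * (1 + q.1 ^ m * q.2)) (z p 0, z p 1) =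
      z p 0 ^ (m + 1) := by
    refine d2_eq_of_hasDerivAt (hg _) ?_
    have := ((hasDerivAt_id (z p 1)).const_mul (z p 0 ^ (m + 1))).const_add (z p 0)
    refine (this.congr_deriv ?_).congr_of_eventuallyEq (Eventually.of_forall fun s => ?_)
    · simp
    · simp only [id]; ring
  rw [pairChart_apply, e1, e2] at h
  exact h

/-- A normal form chart at `p` on which the discriminant is `{z₁ = 0}` and the second linear form
does not vanish. -/
def StrictNormalFormAt (w : Differential X) (m : ℕ) (p : X) : Prop :=
  ∃ (z : OpenPartialHomeomorph X C2) (f : C2 → ℂ), HoloChart z ∧ p ∈ z.source ∧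
    DifferentiableOn ℂ f z.target ∧
    (∀ y ∈ z.source, EqProdAt w y (f (z y)) (dd (fun p => z p 0) y)
      (dd (fun p => z p 0 * (1 + z p 0 ^ m * z p 1)) y)) ∧ z p 0 = 0 ∧
    (∀ y ∈ z.source, y ∈ discSupport w ↔ z y 0 = 0) ∧
    ∀ y ∈ z.source, 1 + (m + 1) * z y 0 ^ m * z y 1 ≠ 0

theorem StrictNormalFormAt.normalFormAt {m : ℕ} (h : StrictNormalFormAt w m p) :
    NormalFormAt w m p := by
  obtain ⟨z, f, h1, h2, h3, h4, -⟩ := h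
  exact ⟨z, f, h1, h2, h3, h4⟩

theorem StrictNormalFormAt.eventually {m : ℕ} (h : StrictNormalFormAt w m p) :
    ∀ᶠ y in 𝓝 p, y ∈ discSupport w → StrictNormalFormAt w m y := by
  obtain ⟨z, f, h1, h2, h3, h4, h5, h6, h7⟩ := h
  filter_upwards [z.open_source.mem_nhds h2] with y hy hyD
  exact ⟨z, f, h1, hy, h3, h4, (h6 y hy).1 hyD, h6, h7⟩

theorem differentiableOn_symm (hz : HoloChart z) {F : X → ℂ} (hF : ∀ y ∈ z.source, HoloAt F y) :
    DifferentiableOn ℂ (fun v => F (z.symm v)) z.target := by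
  intro v hv
  have h1 : AnalyticAt ℂ (fun q => F ((pairChart z).symm q)) (pairEquiv v) := by
    refine HoloAt.analyticAt hz ?_ ?_
    · rwa [mem_pairChart_target, ContinuousLinearEquiv.symm_apply_apply]
    · rw [pairChart_symm_apply, ContinuousLinearEquiv.symm_apply_apply]
      exact hF _ (z.map_target hv)
  have h2 := DifferentiableAt.comp v h1.differentiableAt pairEquiv.differentiableAt
  have h3 : ∀ v, F (z.symm v) = F ((pairChart z).symm (pairEquiv v)) := fun v => by
    rw [pairChart_symm_apply, ContinuousLinearEquiv.symm_apply_apply]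
  exact h2.differentiableWithinAt.congr_of_eventuallyEq (Eventually.of_forall h3) (h3 v)

/-- Transports `exists_normal_coordinates` to the manifold, with `f = h G`. Because `x` is `z₁`
times a unit, the new first coordinate has the same zero set as the old one, namely the
discriminant. -/
theorem exists_strictNormalFormAt (hz : HoloChart z) (hp : p ∈ z.source)
    (hp0 : pairChart z p = 0) {h A₁ B₁ A₂ B₂ u : ℂ × ℂ → ℂ} {m : ℕ} (hh : AnalyticAt ℂ h 0)
    (hA₁ : AnalyticAt ℂ A₁ 0) (hB₁ : AnalyticAt ℂ B₁ 0) (hA₂ : AnalyticAt ℂ A₂ 0)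
    (hB₂ : AnalyticAt ℂ B₂ 0) (hu : AnalyticAt ℂ u 0) (hA₁0 : A₁ 0 ≠ 0) (hA₂0 : A₂ 0 ≠ 0)
    (hu0 : u 0 ≠ 0) (hB : ∀ᶠ t in 𝓝 (0 : ℂ), B₁ (0, t) = 0)
    (hwedge : ∀ᶠ p in 𝓝 (0 : ℂ × ℂ), A₁ p * B₂ p - A₂ p * B₁ p = p.1 ^ (m + 1) * u p)
    (hD : ∀ᶠ y in 𝓝 p, y ∈ discSupport w ↔ z y 0 = 0)
    (hw : ∀ᶠ y in 𝓝 p, ∀ v : Tan y, w.toFun y v v = h (pairChart z y) *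
      ((A₁ (pairChart z y) * dd (fun y => z y 0) y v +
          B₁ (pairChart z y) * dd (fun y => z y 1) y v) *
        (A₂ (pairChart z y) * dd (fun y => z y 0) y v +
          B₂ (pairChart z y) * dd (fun y => z y 1) y v))) :
    StrictNormalFormAt w m p := by
  obtain ⟨x, Y, G, e, hx, hY, hG, he, hY0, hJ, he0, hxe, hprod⟩ :=
    exists_normal_coordinates hA₁ hB₁ hA₂ hB₂ hu hA₁0 hA₂0 hu0 hB hwedge
  have hx0 : x 0 = 0 := by simpa using hxe.self_of_nhds
  have hT : Tendsto (pairChart z) (𝓝 p) (𝓝 0) := by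
    have := (hz.contMDiffAt_pair hp).continuousAt.tendsto; rwa [hp0] at this
  have hne : ∀ᶠ q in 𝓝 (0 : ℂ × ℂ), 1 + (m + 1) * x q ^ m * Y q ≠ 0 := by
    have : AnalyticAt ℂ (fun q => 1 + (m + 1) * x q ^ m * Y q) 0 :=
      analyticAt_const.add ((analyticAt_const.mul (hx.pow m)).mul hY)
    exact this.continuousAt.eventually_ne (by simp [hY0])
  set N : Set X := {y | y ∈ z.source ∧ AnalyticAt ℂ x (pairChart z y) ∧
    AnalyticAt ℂ Y (pairChart z y) ∧ AnalyticAt ℂ h (pairChart z y) ∧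
    AnalyticAt ℂ G (pairChart z y) ∧ e (pairChart z y) ≠ 0 ∧
    x (pairChart z y) = (pairChart z y).1 * e (pairChart z y) ∧
    1 + (m + 1) * x (pairChart z y) ^ m * Y (pairChart z y) ≠ 0 ∧
    (y ∈ discSupport w ↔ z y 0 = 0) ∧
    (∀ v : Tan y, w.toFun y v v = h (pairChart z y) * (G (pairChart z y) *
      ((d1 x (pairChart z y) * dd (fun y => z y 0) y v +
        d2 x (pairChart z y) * dd (fun y => z y 1) y v) *
       (d1 (fun p => x p * (1 + x p ^ m * Y p)) (pairChart z y) * dd (fun y => z y 0) y v +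
        d2 (fun p => x p * (1 + x p ^ m * Y p)) (pairChart z y) * dd (fun y => z y 1) y v))))} with hNdef
  have hN : N ∈ 𝓝 p := by
    filter_upwards [z.open_source.mem_nhds hp, hT.eventually hx.eventually_analyticAt,
      hT.eventually hY.eventually_analyticAt, hT.eventually hh.eventually_analyticAt,
      hT.eventually hG.eventually_analyticAt,
      hT.eventually (he.continuousAt.eventually_ne he0), hT.eventually hxe, hT.eventually hne, hD,
      hw, hT.eventually hprod] with y h1 h2 h3 h4 h5 h6 h7 h8 h9 h10 h11
    exact ⟨h1, h2, h3, h4, h5, h6, h7, h8, h9, fun v => by rw [h10 v, h11]⟩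
  obtain ⟨ζ, hζ, hpζ, hζN, hζz, hval⟩ := exists_chart hz hp (g₀ := x) (g₁ := Y)
    (by rwa [hp0]) (by rwa [hp0]) (by rwa [hp0]) hN
  have hv0 : ∀ y, ζ y 0 = x (pairChart z y) := fun y => congrArg Prod.fst (hval y)
  have hv1 : ∀ y, ζ y 1 = Y (pairChart z y) := fun y => congrArg Prod.snd (hval y)
  have hF : ∀ y ∈ ζ.source, HoloAt (fun y => h (pairChart z y) * G (pairChart z y)) y := by
    intro y hy
    obtain ⟨h1, -, -, h4, h5, -⟩ := hζN hy
    exact HoloAt.comp_pairChart (g := fun q => h q * G q) hz h1 (h4.mul h5)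
  refine ⟨ζ, fun v => h (pairChart z (ζ.symm v)) * G (pairChart z (ζ.symm v)), hζ, hpζ,
    differentiableOn_symm hζ hF, ?_, ?_, ?_, ?_⟩
  · intro y hy v
    obtain ⟨h1, h2, h3, -, -, -, -, -, -, h10⟩ := hζN hy
    simp only [ζ.left_inv hy]
    rw [h10 v]
    have e1 := dd_comp hz h1 h2.differentiableAt v
    have e2 := dd_comp (g := fun p => x p * (1 + x p ^ m * Y p)) hz h1
      (h2.mul (analyticAt_const.add ((h2.pow m).mul h3))).differentiableAt v
    simp only [hv0, hv1]
    rw [e1, e2]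
    ring
  · rw [hv0, hp0, hx0]
  · intro y hy
    obtain ⟨-, -, -, -, -, h6, h7, -, h9, -⟩ := hζN hy
    rw [hv0, h7, h9, mul_eq_zero, or_iff_left h6, pairChart_apply]
  · intro y hy
    obtain ⟨-, -, -, -, -, -, -, h8, -⟩ := hζN hy
    rw [hv0, hv1]
    exact h8

end

end

/-! ### Uniqueness of the exponent. -/

section

open Set Filter

/-- The functions `t ^ M` and `φ ^ M'` bound each other near `0`. As `M ≠ 0`, both tend to zero, so
`φ 0 = 0`; the zero is then simple and the orders of vanishing are `M` and `M'`. The relation is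
only assumed off `0`, since it comes from points outside the discriminant. -/
theorem exponent_eq_of_comparison {φ c c' : ℂ → ℂ} {d : ℂ} {M M' : ℕ} (hM : M ≠ 0)
    (hφ : HasDerivAt φ d 0) (hd : φ 0 = 0 → d ≠ 0) (hc : ContinuousAt c 0)
    (hc' : ContinuousAt c' 0)
    (h : ∀ᶠ t in 𝓝[≠] (0 : ℂ), t ^ M = c t * φ t ^ M' ∧ φ t ^ M' = c' t * t ^ M) : M = M' := by
  have hid : ∀ k : ℕ, k ≠ 0 → Tendsto (fun t : ℂ => t ^ k) (𝓝[≠] 0) (𝓝 0) := fun k hk => by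
    have : Tendsto (fun t : ℂ => t ^ k) (𝓝 0) (𝓝 (0 ^ k)) := (continuous_pow k).tendsto 0
    rw [zero_pow hk] at this
    exact this.mono_left nhdsWithin_le_nhds
  have hcT : Tendsto c (𝓝[≠] 0) (𝓝 (c 0)) := hc.tendsto.mono_left nhdsWithin_le_nhds
  have hcT' : Tendsto c' (𝓝[≠] 0) (𝓝 (c' 0)) := hc'.tendsto.mono_left nhdsWithin_le_nhds
  have hφT : Tendsto φ (𝓝[≠] 0) (𝓝 (φ 0)) :=
    hφ.continuousAt.tendsto.mono_left nhdsWithin_le_nhds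
  by_cases h0 : φ 0 = 0
  · have hs : Tendsto (fun t => φ t / t) (𝓝[≠] 0) (𝓝 d) := by
      refine (hasDerivAt_iff_tendsto_slope.1 hφ).congr fun t => ?_
      rw [slope_def_field, h0]; simp
    rcases lt_trichotomy M M' with hlt | heq | hgt
    · exfalso
      obtain ⟨k, rfl⟩ := Nat.exists_eq_add_of_lt hlt
      have h1 : Tendsto (fun t : ℂ => c t * (φ t / t) ^ (M + k + 1) * t ^ (k + 1)) (𝓝[≠] 0)
          (𝓝 (c 0 * d ^ (M + k + 1) * 0)) := (hcT.mul (hs.pow _)).mul (hid _ (by omega))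
      have h2 : Tendsto (fun t : ℂ => c t * (φ t / t) ^ (M + k + 1) * t ^ (k + 1)) (𝓝[≠] 0)
          (𝓝 1) := by
        refine tendsto_const_nhds.congr' ?_
        filter_upwards [h, self_mem_nhdsWithin] with t ht ht0
        have ht0' : t ≠ 0 := ht0
        have hpow : t ^ (M + k + 1) = t ^ M * t ^ (k + 1) := by ring
        rw [div_pow, ← mul_div_assoc, ← ht.1, hpow]
        field_simp
      have := tendsto_nhds_unique h1 h2
      simp at this
    · exact heq
    · exfalso
      obtain ⟨k, rfl⟩ := Nat.exists_eq_add_of_lt hgt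
      have h1 : Tendsto (fun t : ℂ => c' t * t ^ (k + 1)) (𝓝[≠] 0) (𝓝 (c' 0 * 0)) :=
        hcT'.mul (hid _ (by omega))
      have h2 : Tendsto (fun t : ℂ => c' t * t ^ (k + 1)) (𝓝[≠] 0) (𝓝 (d ^ M')) := by
        refine (hs.pow M').congr' ?_
        filter_upwards [h, self_mem_nhdsWithin] with t ht ht0
        have ht0' : t ≠ 0 := ht0
        rw [div_pow, ht.2]
        field_simp
        ring
      have := tendsto_nhds_unique h1 h2
      rw [mul_zero] at this
      exact pow_ne_zero M' (hd h0) this.symm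
  · exfalso
    have h1 : Tendsto (fun t : ℂ => c' t * t ^ M) (𝓝[≠] 0) (𝓝 (c' 0 * 0)) := hcT'.mul (hid M hM)
    have h2 : Tendsto (fun t : ℂ => c' t * t ^ M) (𝓝[≠] 0) (𝓝 (φ 0 ^ M')) :=
      (hφT.pow M').congr' (h.mono fun t ht => ht.2)
    have := tendsto_nhds_unique h1 h2
    rw [mul_zero] at this
    exact pow_ne_zero M' h0 this.symm

section

variable {X : Type*} [TopologicalSpace X] [ChartedSpace C2 X] [IsManifold 𝓘(ℂ, C2) ω X]
  {z z' : OpenPartialHomeomorph X C2} {p : X} {w : Differential X}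

theorem HoloChart.holoAt_zero (hz : HoloChart z) (hp : p ∈ z.source) :
    HoloAt (fun y => z y 0) p :=
  HoloAt.comp_pairChart (g := Prod.fst) hz hp analyticAt_fst

theorem HoloChart.holoAt_one (hz : HoloChart z) (hp : p ∈ z.source) :
    HoloAt (fun y => z y 1) p :=
  HoloAt.comp_pairChart (g := Prod.snd) hz hp analyticAt_snd

theorem HoloAt.dd_frame {F : X → ℂ} (hF : HoloAt F p) (hz : HoloChart z)
    (hp : p ∈ z.source) (q : ℂ × ℂ) : HoloAt (fun y => dd F y (frame z q y)) p := by
  obtain ⟨U, hU, hUo, hpU⟩ := eventually_nhds_iff.1 hF.eventually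
  have h : HoloFormOn (dd F) U := fun y hy => (contMDiffAt_dd (hU y hy)).contMDiffWithinAt
  exact HoloFormOn.holoAt_apply hUo h hz hp hpU q

theorem normalForm_apply (hz : HoloChart z) {f : C2 → ℂ} {m : ℕ} {y : X} (hy : y ∈ z.source)
    (h : EqProdAt w y (f (z y)) (dd (fun p => z p 0) y)
      (dd (fun p => z p 0 * (1 + z p 0 ^ m * z p 1)) y)) (v : Tan y) :
    w.toFun y v v = f (z y) * (dd (fun p => z p 0) y v *
      ((1 + (m + 1) * z y 0 ^ m * z y 1) * dd (fun p => z p 0) y v +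
        z y 0 ^ (m + 1) * dd (fun p => z p 1) y v)) := by
  rw [h v, dd_mul_one_add hz hy]

theorem normalForm_mem_discSupport_iff (hz : HoloChart z) {f : C2 → ℂ} {m : ℕ} {y : X}
    (hy : y ∈ z.source)
    (h : EqProdAt w y (f (z y)) (dd (fun p => z p 0) y)
      (dd (fun p => z p 0 * (1 + z p 0 ^ m * z p 1)) y)) :
    y ∈ discSupport w ↔ f (z y) * z y 0 ^ (m + 1) = 0 := by
  rw [mem_discSupport_iff_of_product hz hy (c := f (z y)) (A₁ := 1) (B₁ := 0)
    (A₂ := 1 + (m + 1) * z y 0 ^ m * z y 1) (B₂ := z y 0 ^ (m + 1)) (fun v => by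
      rw [normalForm_apply hz hy h v]; ring)]
  simp

/-- Evaluating `w` on the vectors of the frame of `z'` expresses `f'` times a coefficient of the
second linear form through `f`. The hypothesis `hne` says that one of the two coefficients is
nonzero at `p`, so it can be divided out. No division by `f` takes place, so the relation also holds
on the discriminant. -/
theorem exists_ratio (hz : HoloChart z) (hz' : HoloChart z') (hp : p ∈ z.source)
    (hp' : p ∈ z'.source) {f f' : C2 → ℂ} {m m' : ℕ}
    (h : ∀ y ∈ z.source, EqProdAt w y (f (z y)) (dd (fun p => z p 0) y)
      (dd (fun p => z p 0 * (1 + z p 0 ^ m * z p 1)) y))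
    (h' : ∀ y ∈ z'.source, EqProdAt w y (f' (z' y)) (dd (fun p => z' p 0) y)
      (dd (fun p => z' p 0 * (1 + z' p 0 ^ m' * z' p 1)) y))
    (hne : 1 + (m' + 1) * z' p 0 ^ m' * z' p 1 ≠ 0 ∨ z' p 0 ≠ 0) :
    ∃ k : X → ℂ, ContinuousAt k p ∧ ∀ᶠ y in 𝓝 p, f' (z' y) = k y * f (z y) := by
  set K : ℂ × ℂ → X → ℂ := fun q y => dd (fun p => z p 0) y (frame z' q y) *
      ((1 + (m + 1) * z y 0 ^ m * z y 1) * dd (fun p => z p 0) y (frame z' q y) +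
        z y 0 ^ (m + 1) * dd (fun p => z p 1) y (frame z' q y)) with hK
  have c0 := (hz.holoAt_zero hp).continuousAt
  have c1 := (hz.holoAt_one hp).continuousAt
  have c0' := (hz'.holoAt_zero hp').continuousAt
  have c1' := (hz'.holoAt_one hp').continuousAt
  have hKc : ∀ q, ContinuousAt (K q) p := fun q => by
    have d0 := ((hz.holoAt_zero hp).dd_frame hz' hp' q).continuousAt
    have d1 := ((hz.holoAt_one hp).dd_frame hz' hp' q).continuousAt
    exact d0.mul (((continuousAt_const.add ((continuousAt_const.mul (c0.pow m)).mul c1)).mul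
      d0).add ((c0.pow _).mul d1))
  have hA'c : ContinuousAt (fun y => 1 + (m' + 1) * z' y 0 ^ m' * z' y 1) p :=
    continuousAt_const.add ((continuousAt_const.mul (c0'.pow m')).mul c1')
  have hrel : ∀ y ∈ z.source, y ∈ z'.source → ∀ q : ℂ × ℂ, f (z y) * K q y =
      f' (z' y) * (q.1 * ((1 + (m' + 1) * z' y 0 ^ m' * z' y 1) * q.1 +
        z' y 0 ^ (m' + 1) * q.2)) := fun y hy hy' q => by
    have e1 := normalForm_apply hz hy (h y hy) (frame z' q y)
    have e2 := normalForm_apply hz' hy' (h' y hy') (frame z' q y)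
    rw [dd_frame_zero hz' hy', dd_frame_one hz' hy'] at e2
    rw [← e2, e1]
  rcases hne with hne | hne
  · refine ⟨fun y => K (1, 0) y / (1 + (m' + 1) * z' y 0 ^ m' * z' y 1),
      (hKc _).div hA'c hne, ?_⟩
    filter_upwards [z.open_source.mem_nhds hp, z'.open_source.mem_nhds hp',
      hA'c.eventually_ne hne] with y hy hy' hn
    have := hrel y hy hy' (1, 0)
    rw [div_mul_eq_mul_div, eq_div_iff hn]
    linear_combination -this
  · refine ⟨fun y => (K (1, 1) y - K (1, 0) y) / z' y 0 ^ (m' + 1),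
      ((hKc _).sub (hKc _)).div (c0'.pow _) (pow_ne_zero _ hne), ?_⟩
    filter_upwards [z.open_source.mem_nhds hp, z'.open_source.mem_nhds hp',
      c0'.eventually_ne hne] with y hy hy' hn
    have e1 := hrel y hy hy' (1, 0)
    have e2 := hrel y hy hy' (1, 1)
    rw [div_mul_eq_mul_div, eq_div_iff (pow_ne_zero _ hn)]
    linear_combination e1 - e2

/-- The discriminants of `w` in the two frames differ by the square of the Jacobian `J`.
Substituting `f' = k f` and cancelling `f`, which has no zeros off the discriminant, leaves only the
powers of the coordinates. -/
theorem exists_comparison (hz : HoloChart z) (hz' : HoloChart z') (hp : p ∈ z.source)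
    (hp' : p ∈ z'.source) {f f' : C2 → ℂ} {m m' : ℕ}
    (h : ∀ y ∈ z.source, EqProdAt w y (f (z y)) (dd (fun p => z p 0) y)
      (dd (fun p => z p 0 * (1 + z p 0 ^ m * z p 1)) y))
    (h' : ∀ y ∈ z'.source, EqProdAt w y (f' (z' y)) (dd (fun p => z' p 0) y)
      (dd (fun p => z' p 0 * (1 + z' p 0 ^ m' * z' p 1)) y))
    (hne : 1 + (m' + 1) * z' p 0 ^ m' * z' p 1 ≠ 0 ∨ z' p 0 ≠ 0) :
    ∃ c : X → ℂ, ContinuousAt c p ∧ ∀ᶠ y in 𝓝 p, y ∉ discSupport w →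
      z y 0 ^ (2 * (m + 1)) = c y * z' y 0 ^ (2 * (m' + 1)) := by
  obtain ⟨k, hk, hkf⟩ := exists_ratio hz hz' hp hp' h h' hne
  set J : X → ℂ := fun y =>
    dd (fun p => z' p 0) y (frame z (1, 0) y) * dd (fun p => z' p 1) y (frame z (0, 1) y) -
    dd (fun p => z' p 0) y (frame z (0, 1) y) * dd (fun p => z' p 1) y (frame z (1, 0) y) with hJ
  have hJc : ContinuousAt J p := by
    have d0 := fun q => ((hz'.holoAt_zero hp').dd_frame hz hp q).continuousAt
    have d1 := fun q => ((hz'.holoAt_one hp').dd_frame hz hp q).continuousAt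
    exact ((d0 _).mul (d1 _)).sub ((d0 _).mul (d1 _))
  refine ⟨fun y => (J y * k y) ^ 2, (hJc.mul hk).pow 2, ?_⟩
  filter_upwards [z.open_source.mem_nhds hp, z'.open_source.mem_nhds hp', hkf]
    with y hy hy' hkf hyD
  have hf0 : f (z y) ≠ 0 := fun h0 => hyD <| by
    rw [normalForm_mem_discSupport_iff hz hy (h y hy), h0, zero_mul]
  have key : ∀ a b : ℂ, f (z y) * (a * ((1 + (m + 1) * z y 0 ^ m * z y 1) * a +
      z y 0 ^ (m + 1) * b)) = f' (z' y) *
      ((a * dd (fun p => z' p 0) y (frame z (1, 0) y) +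
        b * dd (fun p => z' p 0) y (frame z (0, 1) y)) *
      ((1 + (m' + 1) * z' y 0 ^ m' * z' y 1) * (a * dd (fun p => z' p 0) y (frame z (1, 0) y) +
        b * dd (fun p => z' p 0) y (frame z (0, 1) y)) +
      z' y 0 ^ (m' + 1) * (a * dd (fun p => z' p 1) y (frame z (1, 0) y) +
        b * dd (fun p => z' p 1) y (frame z (0, 1) y)))) := fun a b => by
    set v : Tan y := a • frame z (1, 0) y + b • frame z (0, 1) y with hv
    have e1 := normalForm_apply hz hy (h y hy) v
    have e2 := normalForm_apply hz' hy' (h' y hy') v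
    have v0 : dd (fun p => z p 0) y v = a := by
      rw [hv, map_add, map_smul, map_smul, dd_frame_zero hz hy, dd_frame_zero hz hy]; simp
    have v1 : dd (fun p => z p 1) y v = b := by
      rw [hv, map_add, map_smul, map_smul, dd_frame_one hz hy, dd_frame_one hz hy]; simp
    have v0' : dd (fun p => z' p 0) y v = a * dd (fun p => z' p 0) y (frame z (1, 0) y) +
        b * dd (fun p => z' p 0) y (frame z (0, 1) y) := by
      rw [hv, map_add, map_smul, map_smul, smul_eq_mul, smul_eq_mul]
    have v1' : dd (fun p => z' p 1) y v = a * dd (fun p => z' p 1) y (frame z (1, 0) y) +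
        b * dd (fun p => z' p 1) y (frame z (0, 1) y) := by
      rw [hv, map_add, map_smul, map_smul, smul_eq_mul, smul_eq_mul]
    rw [v0, v1] at e1
    rw [v0', v1'] at e2
    exact e1.symm.trans e2
  have k10 := key 1 0
  have k01 := key 0 1
  have k11 := key 1 1
  have hdisc : (f (z y) * z y 0 ^ (m + 1)) ^ 2 =
      J y ^ 2 * (f' (z' y) * z' y 0 ^ (m' + 1)) ^ 2 := by
    simp only [hJ]
    generalize dd (fun p => z' p 0) y (frame z (1, 0) y) = a₁ at *
    generalize dd (fun p => z' p 0) y (frame z (0, 1) y) = a₂ at *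
    generalize dd (fun p => z' p 1) y (frame z (1, 0) y) = b₁ at *
    generalize dd (fun p => z' p 1) y (frame z (0, 1) y) = b₂ at *
    generalize 1 + (m' + 1) * z' y 0 ^ m' * z' y 1 = A' at *
    generalize z' y 0 ^ (m' + 1) = B' at *
    generalize 1 + (m + 1) * z y 0 ^ m * z y 1 = A at *
    generalize z y 0 ^ (m + 1) = B at *
    -- The values at `(1, 0)`, `(0, 1)` and `(1, 1)` give the three coefficients of the quadratic
    -- form in the frame of `z`. The square of the mixed one minus four times the product of the
    -- others is the discriminant.
    linear_combination (f (z y) * B + f' (z' y) * (a₁ * (A' * a₂ + B' * b₂) +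
      a₂ * (A' * a₁ + B' * b₁))) * (k11 - k10 - k01) -
      4 * (f' (z' y) * a₁ * (A' * a₁ + B' * b₁)) * k01
  rw [hkf] at hdisc
  refine mul_left_cancel₀ (pow_ne_zero 2 hf0) ?_
  rw [pow_mul', pow_mul']
  linear_combination hdisc

/-- The comparison is read on the disc `t ↦ (t, b)` through `p`, transverse to the discriminant `{z₁
= 0}`. There `z₁ = t`, and the first coordinate of `z'` is either nonzero or has a simple zero at `t
= 0`. -/
theorem StrictNormalFormAt.exponent_eq {m m' : ℕ} (hs : StrictNormalFormAt w m p)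
    (hz' : HoloChart z') (hp' : p ∈ z'.source) {f' : C2 → ℂ}
    (h' : ∀ y ∈ z'.source, EqProdAt w y (f' (z' y)) (dd (fun p => z' p 0) y)
      (dd (fun p => z' p 0 * (1 + z' p 0 ^ m' * z' p 1)) y))
    (hne : 1 + (m' + 1) * z' p 0 ^ m' * z' p 1 ≠ 0 ∨ z' p 0 ≠ 0) : m' = m := by
  obtain ⟨z, f, hz, hp, -, h, hp0, hD, hA⟩ := hs
  obtain ⟨c, hc, hcf⟩ := exists_comparison hz hz' hp hp' h h' hne
  obtain ⟨c', hc', hcf'⟩ := exists_comparison hz' hz hp' hp h' h (Or.inl (hA p hp))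
  set b : ℂ := z p 1 with hb
  have hpb : pairChart z p = (0, b) := by rw [pairChart_apply, hp0]
  have hpt : ((0 : ℂ), b) ∈ (pairChart z).target :=
    hpb ▸ (pairChart z).map_source (by rwa [pairChart_source])
  have hsym : (pairChart z).symm (0, b) = p := by
    rw [← hpb, (pairChart z).left_inv (by rwa [pairChart_source])]
  set F : ℂ × ℂ → ℂ := fun q => z' ((pairChart z).symm q) 0 with hF
  have hFa : AnalyticAt ℂ F (0, b) :=
    HoloAt.analyticAt (f := fun y => z' y 0) hz hpt (by rw [hsym]; exact hz'.holoAt_zero hp')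
  have hT : Tendsto (pairChart z).symm (𝓝 (0, b)) (𝓝 p) := by
    have := ((pairChart z).continuousAt_symm hpt).tendsto; rwa [hsym] at this
  have hF1 : F (0, b) = 0 → d1 F (0, b) ≠ 0 := by
    intro h0 hd
    -- The differential of a coordinate function is nonzero.
    have hd2 : d2 F (0, b) ≠ 0 := by
      intro hd2
      have e1 := dd_comp (g := F) hz hp (by rw [hpb]; exact hFa.differentiableAt)
        (frame z' (1, 0) p)
      have e2 : dd (fun y => F (pairChart z y)) p (frame z' (1, 0) p) =
          dd (fun y => z' y 0) p (frame z' (1, 0) p) := by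
        apply dd_congr
        filter_upwards [z.open_source.mem_nhds hp] with y hy
        change z' ((pairChart z).symm (pairChart z y)) 0 = z' y 0
        rw [(pairChart z).left_inv (by rwa [pairChart_source])]
      rw [e2, dd_frame_zero hz' hp', hpb, hd, hd2] at e1
      simp at e1
    -- If `d1 F` vanished, then `(z₁, F)` would be a local chart, in which `{F = 0}` contains points
    -- with `z₁ ≠ 0`. But the normal form of `z'` puts `{F = 0}` inside the discriminant `{z₁ = 0}`.
    obtain ⟨Φ, hΦ0, hΦ, -, hΦs⟩ := exists_local_inverse (f := Prod.fst) (g := F)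
      (p := ((0 : ℂ), b)) analyticAt_fst hFa (by simpa [d1, d2, fderiv_fst] using hd2)
    have hΦv : Φ (0, b) = (0, 0) := by rw [hΦ, h0]
    have ht : ((0 : ℂ), (0 : ℂ)) ∈ Φ.target := hΦv ▸ Φ.map_source hΦ0
    have hinv : Φ.symm (0, 0) = (0, b) := by rw [← hΦv, Φ.left_inv hΦ0]
    have hsT : Tendsto Φ.symm (𝓝 (0, 0)) (𝓝 (0, b)) := by
      have := (hΦs _ ht).continuousAt.tendsto; rwa [hinv] at this
    have hline : Tendsto (fun s : ℂ => (s, (0 : ℂ))) (𝓝[≠] 0) (𝓝 (0, 0)) :=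
      ((continuous_id.prodMk continuous_const).tendsto' (0 : ℂ) ((0 : ℂ), (0 : ℂ)) rfl).mono_left
        nhdsWithin_le_nhds
    have hev : ∀ᶠ q in 𝓝 ((0 : ℂ), b), F q = 0 → q.1 = 0 := by
      filter_upwards [hT.eventually_mem (z'.open_source.mem_nhds hp'),
        hT.eventually_mem (z.open_source.mem_nhds hp), (pairChart z).open_target.mem_nhds hpt]
        with q h1 h2 h3 hq
      have hmem : (pairChart z).symm q ∈ discSupport w := by
        rw [normalForm_mem_discSupport_iff hz' h1 (h' _ h1)]
        have : z' ((pairChart z).symm q) 0 = 0 := hq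
        rw [this]; simp
      have h4 := (hD _ h2).1 hmem
      have h5 := (pairChart z).right_inv h3
      rw [← h5]
      exact h4
    obtain ⟨s, ⟨hs1, hs2⟩, hs0⟩ := ((hline.eventually ((hsT.eventually hev).and
      (Φ.open_target.mem_nhds ht))).and self_mem_nhdsWithin).exists
    have h6 := Φ.right_inv hs2
    rw [hΦ] at h6
    have h7 := hs1 (congrArg Prod.snd h6)
    exact hs0 ((congrArg Prod.fst h6).symm.trans h7)
  have hpath : Tendsto (fun t : ℂ => (pairChart z).symm (t, b)) (𝓝 0) (𝓝 p) :=
    hT.comp ((continuous_id.prodMk continuous_const).tendsto' (0 : ℂ) ((0 : ℂ), b) rfl)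
  have hcp : ∀ k : X → ℂ, ContinuousAt k p →
      ContinuousAt (fun t : ℂ => k ((pairChart z).symm (t, b))) 0 := fun k hk => by
    have : Tendsto (fun t : ℂ => k ((pairChart z).symm (t, b))) (𝓝 0) (𝓝 (k p)) :=
      hk.tendsto.comp hpath
    rw [ContinuousAt, hsym]
    exact this
  have hM := exponent_eq_of_comparison (M := 2 * (m + 1)) (M' := 2 * (m' + 1)) (by omega)
    (hasDerivAt_fst hFa.differentiableAt) hF1 (hcp c hc) (hcp c' hc') (by
      have hline : Tendsto (fun t : ℂ => (t, b)) (𝓝 0) (𝓝 (0, b)) :=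
        (continuous_id.prodMk continuous_const).tendsto' (0 : ℂ) ((0 : ℂ), b) rfl
      filter_upwards [nhdsWithin_le_nhds (hpath.eventually hcf),
        nhdsWithin_le_nhds (hpath.eventually hcf'),
        nhdsWithin_le_nhds (hpath.eventually_mem (z.open_source.mem_nhds hp)),
        nhdsWithin_le_nhds (hline.eventually_mem ((pairChart z).open_target.mem_nhds hpt)),
        self_mem_nhdsWithin] with t h1 h2 h3 h4 h5
      have h6 : z ((pairChart z).symm (t, b)) 0 = t :=
        congrArg Prod.fst ((pairChart z).right_inv h4)
      have h7 : (pairChart z).symm (t, b) ∉ discSupport w := by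
        rw [hD _ h3, h6]; exact h5
      have h8 := h1 h7
      have h9 := h2 h7
      rw [h6] at h8 h9
      exact ⟨h8, h9⟩)
  omega

theorem StrictNormalFormAt.unique {m m' : ℕ} (hs : StrictNormalFormAt w m p)
    (hs' : StrictNormalFormAt w m' p) : m' = m := by
  obtain ⟨z', f', hz', hp', -, h', -, -, hA'⟩ := hs'
  exact hs.exponent_eq hz' hp' h' (Or.inl (hA' p hp'))

end

end

/-! ### Germs that are powers of the first coordinate up to units. -/

section

open Set Filter

theorem frequently_fst_ne_zero (p : ℂ × ℂ) : ∃ᶠ q in 𝓝 p, q.1 ≠ 0 := by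
  have h : Tendsto (fun s : ℂ => (s, p.2)) (𝓝[≠] p.1) (𝓝 p) :=
    ((continuous_id.prodMk continuous_const).tendsto' p.1 p rfl).mono_left nhdsWithin_le_nhds
  by_cases hp : p.1 = 0
  · refine h.frequently (Eventually.frequently ?_)
    filter_upwards [self_mem_nhdsWithin] with s hs
    rw [hp] at hs
    exact hs
  · exact (continuous_fst.continuousAt.eventually_ne hp).frequently

/-- Cancellation is possible because the points with nonzero first coordinate are dense and both
functions are continuous. -/
theorem eventually_eq_of_pow_mul_eq {f g : ℂ × ℂ → ℂ} {o : ℂ × ℂ} (k : ℕ)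
    (hf : AnalyticAt ℂ f o) (hg : AnalyticAt ℂ g o)
    (h : ∀ᶠ p in 𝓝 o, p.1 ^ k * f p = p.1 ^ k * g p) :
    ∀ᶠ p in 𝓝 o, f p = g p := by
  filter_upwards [h.eventually_nhds, hf.eventually_analyticAt, hg.eventually_analyticAt]
    with p hp hfp hgp
  by_contra hne
  have h1 : ∀ᶠ q in 𝓝 p, f q - g q ≠ 0 :=
    (hfp.sub hgp).continuousAt.eventually_ne (sub_ne_zero.2 hne)
  obtain ⟨q, hq, h2, h3⟩ := ((frequently_fst_ne_zero p).and_eventually (h1.and hp)).exists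
  exact h2 (sub_eq_zero.2 (mul_left_cancel₀ (pow_ne_zero k hq) h3))

/-- `f` is a power of the first coordinate times a unit, near `0`. -/
def IsPowUnit (f : ℂ × ℂ → ℂ) : Prop :=
  ∃ (k : ℕ) (u : ℂ × ℂ → ℂ), AnalyticAt ℂ u 0 ∧ u 0 ≠ 0 ∧
    ∀ᶠ p in 𝓝 (0 : ℂ × ℂ), f p = p.1 ^ k * u p

/-- The first coordinate is a prime germ: if `f g` vanishes on the axis then, by the identity
theorem in one variable, so does one of the factors, and a power of the coordinate can be cancelled
from both sides. -/
theorem isPowUnit_of_mul_eq (k : ℕ) : ∀ {f g u : ℂ × ℂ → ℂ}, AnalyticAt ℂ f 0 →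
    AnalyticAt ℂ g 0 → AnalyticAt ℂ u 0 → u 0 ≠ 0 →
    (∀ᶠ p in 𝓝 (0 : ℂ × ℂ), f p * g p = p.1 ^ k * u p) → IsPowUnit f := by
  induction k with
  | zero =>
    intro f g u hf hg hu hu0 h
    refine ⟨0, f, hf, fun h0 => hu0 ?_, Eventually.of_forall fun p => by simp⟩
    have := h.self_of_nhds
    rw [h0] at this
    simpa using this.symm
  | succ k ih =>
    intro f g u hf hg hu hu0 h
    have hc : Tendsto (fun t : ℂ => ((0 : ℂ), t)) (𝓝 0) (𝓝 (0 : ℂ × ℂ)) :=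
      (continuous_const.prodMk continuous_id).tendsto' _ _ rfl
    have hline : ∀ {v : ℂ × ℂ → ℂ}, AnalyticAt ℂ v 0 → AnalyticAt ℂ (fun t : ℂ => v (0, t)) 0 :=
      fun {v} hv => AnalyticAt.comp (g := v) (f := fun t : ℂ => ((0 : ℂ), t)) hv
        (analyticAt_const.prod analyticAt_id)
    have h0 : ∀ᶠ t in 𝓝 (0 : ℂ), f (0, t) * g (0, t) = 0 := by
      filter_upwards [hc.eventually h] with t ht
      simpa using ht
    have hcase : (∀ᶠ t in 𝓝 (0 : ℂ), f (0, t) = 0) ∨ ∀ᶠ t in 𝓝 (0 : ℂ), g (0, t) = 0 := by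
      rcases (hline hf).eventually_eq_zero_or_eventually_ne_zero with h1 | h1
      · exact Or.inl h1
      · rcases (hline hg).eventually_eq_zero_or_eventually_ne_zero with h2 | h2
        · exact Or.inr h2
        · exfalso
          obtain ⟨t, h3, h4, h5⟩ := (h1.and (h2.and (nhdsWithin_le_nhds h0))).exists
          exact (mul_ne_zero h3 h4) h5
    rcases hcase with h1 | h1
    · obtain ⟨f₁, hf₁, -, hff⟩ := exists_eq_mul_of_eq_zero (f := f) (b := 0) hf h1
      have h2 : ∀ᶠ p in 𝓝 (0 : ℂ × ℂ), f₁ p * g p = p.1 ^ k * u p := by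
        refine eventually_eq_of_pow_mul_eq 1 (AnalyticAt.mul hf₁ hg)
          ((analyticAt_fst.pow k).mul hu) ?_
        filter_upwards [h, hff] with p h3 h4
        rw [h4] at h3
        linear_combination h3
      obtain ⟨i, v, hv, hv0, hfv⟩ := ih hf₁ hg hu hu0 h2
      refine ⟨i + 1, v, hv, hv0, ?_⟩
      filter_upwards [hff, hfv] with p h3 h4
      rw [h3, h4]; ring
    · obtain ⟨g₁, hg₁, -, hgg⟩ := exists_eq_mul_of_eq_zero (f := g) (b := 0) hg h1
      refine ih hf hg₁ hu hu0 ?_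
      refine eventually_eq_of_pow_mul_eq 1 (hf.mul hg₁) ((analyticAt_fst.pow k).mul hu) ?_
      filter_upwards [h, hgg] with p h3 h4
      rw [h4] at h3
      linear_combination h3

theorem IsPowUnit.of_mul {f g F : ℂ × ℂ → ℂ} (hF : IsPowUnit F) (hf : AnalyticAt ℂ f 0)
    (hg : AnalyticAt ℂ g 0) (h : ∀ᶠ p in 𝓝 (0 : ℂ × ℂ), f p * g p = F p) : IsPowUnit f := by
  obtain ⟨k, u, hu, hu0, hFu⟩ := hF
  refine isPowUnit_of_mul_eq k hf hg hu hu0 ?_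
  filter_upwards [h, hFu] with p h1 h2
  rw [h1, h2]

theorem exponent_le_of_pow_mul_eq {u v : ℂ × ℂ → ℂ} {a b : ℕ} (hu : AnalyticAt ℂ u 0)
    (hv : AnalyticAt ℂ v 0) (hu0 : u 0 ≠ 0)
    (h : ∀ᶠ p in 𝓝 (0 : ℂ × ℂ), p.1 ^ a * u p = p.1 ^ b * v p) : b ≤ a := by
  by_contra! hlt
  obtain ⟨k, rfl⟩ := Nat.exists_eq_add_of_lt hlt
  have h1 := eventually_eq_of_pow_mul_eq (g := fun p => p.1 ^ (k + 1) * v p) a hu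
    ((analyticAt_fst.pow _).mul hv) (h.mono fun p hp => by rw [hp]; ring)
  exact hu0 (by simpa using h1.self_of_nhds)

/-- A common power of the first coordinate can be split off a pair of functions. -/
theorem exists_common_power {α β : ℂ × ℂ → ℂ} (hα : (∀ᶠ p in 𝓝 0, α p = 0) ∨ IsPowUnit α)
    (hβ : (∀ᶠ p in 𝓝 0, β p = 0) ∨ IsPowUnit β)
    (hne : ¬ ((∀ᶠ p in 𝓝 0, α p = 0) ∧ ∀ᶠ p in 𝓝 0, β p = 0)) :
    ∃ (k : ℕ) (α' β' : ℂ × ℂ → ℂ), AnalyticAt ℂ α' 0 ∧ AnalyticAt ℂ β' 0 ∧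
      (α' 0 ≠ 0 ∨ β' 0 ≠ 0) ∧ (∀ᶠ p in 𝓝 0, α p = p.1 ^ k * α' p) ∧
      ∀ᶠ p in 𝓝 0, β p = p.1 ^ k * β' p := by
  have hzero : ∀ {γ : ℂ × ℂ → ℂ} (k : ℕ), (∀ᶠ p in 𝓝 0, γ p = 0) →
      ∀ᶠ p in 𝓝 (0 : ℂ × ℂ), γ p = p.1 ^ k * (fun _ => (0 : ℂ)) p := fun k h => by simpa using h
  have hup : ∀ {γ v : ℂ × ℂ → ℂ} (k l : ℕ), (∀ᶠ p in 𝓝 0, γ p = p.1 ^ (k + l) * v p) →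
      ∀ᶠ p in 𝓝 (0 : ℂ × ℂ), γ p = p.1 ^ k * (p.1 ^ l * v p) := fun k l h =>
    h.mono fun p hp => by rw [hp]; ring
  rcases hα with hα | ⟨k, u, hu, hu0, hα⟩
  · rcases hβ with hβ | ⟨l, v, hv, hv0, hβ⟩
    · exact absurd ⟨hα, hβ⟩ hne
    · exact ⟨l, _, v, analyticAt_const, hv, Or.inr hv0, hzero l hα, hβ⟩
  · rcases hβ with hβ | ⟨l, v, hv, hv0, hβ⟩
    · exact ⟨k, u, _, hu, analyticAt_const, Or.inl hu0, hα, hzero k hβ⟩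
    · rcases le_total k l with hkl | hkl
      · obtain ⟨i, rfl⟩ := Nat.exists_eq_add_of_le hkl
        exact ⟨k, u, _, hu, (analyticAt_fst.pow i).mul hv, Or.inl hu0, hα, hup k i hβ⟩
      · obtain ⟨i, rfl⟩ := Nat.exists_eq_add_of_le hkl
        exact ⟨l, _, v, (analyticAt_fst.pow i).mul hu, hv, Or.inr hv0, hup l i hα, hβ⟩

theorem exists_common_nonzero {a b c d : ℂ} (h₁ : a ≠ 0 ∨ b ≠ 0) (h₂ : c ≠ 0 ∨ d ≠ 0) :
    ∃ s t : ℂ, (a * s + b * t) * (c * s + d * t) ≠ 0 := by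
  by_cases ha : a = 0
  · have hb := h₁.resolve_left (not_not.2 ha)
    by_cases hd : d = 0
    · exact ⟨1, 1, by simp [ha, hd, hb, h₂.resolve_right (not_not.2 hd)]⟩
    · exact ⟨0, 1, by simp [hb, hd]⟩
  · by_cases hc : c = 0
    · have hd := h₂.resolve_left (not_not.2 hc)
      by_cases hb : b = 0
      · exact ⟨1, 1, by simp [hc, hb, ha, hd]⟩
      · exact ⟨0, 1, by simp [hb, hd]⟩
    · exact ⟨1, 0, by simp [ha, hc]⟩

/-- If `Q · w = (α₁ σ + β₁ τ)(α₂ σ + β₂ τ)` where all the functions involved are powers of the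
first coordinate up to units, then `w = h (α₁' σ + β₁' τ)(α₂' σ + β₂' τ)` with nowhere vanishing
linear forms. -/
theorem exists_reduced_product {Q α₁ β₁ α₂ β₂ : ℂ × ℂ → ℂ} {w : ℂ → ℂ → ℂ × ℂ → ℂ}
    (hw : ∀ σ τ, AnalyticAt ℂ (w σ τ) 0) (hQ : IsPowUnit Q)
    (hα₁ : (∀ᶠ p in 𝓝 0, α₁ p = 0) ∨ IsPowUnit α₁)
    (hβ₁ : (∀ᶠ p in 𝓝 0, β₁ p = 0) ∨ IsPowUnit β₁)
    (hα₂ : (∀ᶠ p in 𝓝 0, α₂ p = 0) ∨ IsPowUnit α₂)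
    (hβ₂ : (∀ᶠ p in 𝓝 0, β₂ p = 0) ∨ IsPowUnit β₂)
    (hW : IsPowUnit (fun p => α₁ p * β₂ p - α₂ p * β₁ p))
    (h : ∀ σ τ, ∀ᶠ p in 𝓝 0, Q p * w σ τ p = (α₁ p * σ + β₁ p * τ) * (α₂ p * σ + β₂ p * τ)) :
    ∃ (h A₁ B₁ A₂ B₂ W : ℂ × ℂ → ℂ) (l n : ℕ) (e : ℂ × ℂ → ℂ), AnalyticAt ℂ h 0 ∧
      AnalyticAt ℂ A₁ 0 ∧
      AnalyticAt ℂ B₁ 0 ∧ AnalyticAt ℂ A₂ 0 ∧ AnalyticAt ℂ B₂ 0 ∧ AnalyticAt ℂ W 0 ∧ W 0 ≠ 0 ∧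
      AnalyticAt ℂ e 0 ∧ e 0 ≠ 0 ∧
      (A₁ 0 ≠ 0 ∨ B₁ 0 ≠ 0) ∧ (A₂ 0 ≠ 0 ∨ B₂ 0 ≠ 0) ∧
      (∀ᶠ p in 𝓝 0, h p = p.1 ^ l * e p) ∧
      (∀ᶠ p in 𝓝 0, A₁ p * B₂ p - A₂ p * B₁ p = p.1 ^ n * W p) ∧
      ∀ σ τ, ∀ᶠ p in 𝓝 0, w σ τ p = h p * ((A₁ p * σ + B₁ p * τ) * (A₂ p * σ + B₂ p * τ)) := by
  obtain ⟨d, W, hWa, hW0, hWe⟩ := hW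
  have hnz : ∀ᶠ p in 𝓝 (0 : ℂ × ℂ), W p ≠ 0 := hWa.continuousAt.eventually_ne hW0
  have hWne : ¬ ∀ᶠ p in 𝓝 (0 : ℂ × ℂ), α₁ p * β₂ p - α₂ p * β₁ p = 0 := fun h0 => by
    obtain ⟨p, hp, h1, h2, h3⟩ :=
      ((frequently_fst_ne_zero 0).and_eventually (hnz.and (h0.and hWe))).exists
    simp only [h2] at h3
    exact (mul_ne_zero (pow_ne_zero d hp) h1) h3.symm
  obtain ⟨k₁, A₁, B₁, hA₁, hB₁, hn₁, e₁, e₁'⟩ := exists_common_power hα₁ hβ₁ (fun hh => hWne (by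
    filter_upwards [hh.1, hh.2] with p h1 h2; rw [h1, h2]; ring))
  obtain ⟨k₂, A₂, B₂, hA₂, hB₂, hn₂, e₂, e₂'⟩ := exists_common_power hα₂ hβ₂ (fun hh => hWne (by
    filter_upwards [hh.1, hh.2] with p h1 h2; rw [h1, h2]; ring))
  obtain ⟨j, u, hu, hu0, hQe⟩ := hQ
  have hrel : ∀ σ τ, ∀ᶠ p in 𝓝 (0 : ℂ × ℂ), p.1 ^ j * (u p * w σ τ p) =
      p.1 ^ (k₁ + k₂) * ((A₁ p * σ + B₁ p * τ) * (A₂ p * σ + B₂ p * τ)) := fun σ τ => by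
    filter_upwards [h σ τ, e₁, e₁', e₂, e₂', hQe] with p h1 h2 h3 h4 h5 h6
    rw [h2, h3, h4, h5, h6] at h1
    linear_combination h1
  have hprod : ∀ σ τ : ℂ,
      AnalyticAt ℂ (fun p => (A₁ p * σ + B₁ p * τ) * (A₂ p * σ + B₂ p * τ)) 0 := fun σ τ =>
    ((hA₁.mul analyticAt_const).add (hB₁.mul analyticAt_const)).mul
      ((hA₂.mul analyticAt_const).add (hB₂.mul analyticAt_const))
  obtain ⟨s, t, hst⟩ := exists_common_nonzero hn₁ hn₂
  -- On the constant vector `(s, t)` both reduced forms are nonzero at `0`, so the right side of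
  -- `hrel` has exact order `k₁ + k₂`, and the left side is divisible by the power `j`. Hence `h`
  -- below has no pole.
  have hjk : j ≤ k₁ + k₂ := exponent_le_of_pow_mul_eq (hprod s t) (hu.mul (hw s t)) hst
    ((hrel s t).mono fun p hp => hp.symm)
  obtain ⟨l, hl⟩ := Nat.exists_eq_add_of_le hjk
  -- The wedge of the reduced forms divides the original wedge, the cofactor being `p.1 ^ (k₁ +
  -- k₂)`.
  obtain ⟨n, W', hW', hW'0, hWe'⟩ := isPowUnit_of_mul_eq d
    (f := fun p => A₁ p * B₂ p - A₂ p * B₁ p) (g := fun p => p.1 ^ (k₁ + k₂))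
    ((hA₁.mul hB₂).sub (hA₂.mul hB₁)) (analyticAt_fst.pow _) hWa hW0 (by
      filter_upwards [hWe, e₁, e₁', e₂, e₂'] with p h1 h2 h3 h4 h5
      rw [← h1, h2, h3, h4, h5]; ring)
  refine ⟨fun p => p.1 ^ l * (u p)⁻¹, A₁, B₁, A₂, B₂, W', l, n, fun p => (u p)⁻¹,
    (analyticAt_fst.pow l).mul (hu.inv hu0), hA₁, hB₁, hA₂, hB₂, hW', hW'0, hu.inv hu0,
    inv_ne_zero hu0, hn₁, hn₂, Eventually.of_forall fun p => rfl, hWe', fun σ τ => ?_⟩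
  have h1 := eventually_eq_of_pow_mul_eq
    (g := fun p => p.1 ^ l * ((A₁ p * σ + B₁ p * τ) * (A₂ p * σ + B₂ p * τ))) j
    (hu.mul (hw σ τ)) ((analyticAt_fst.pow l).mul (hprod σ τ))
    ((hrel σ τ).mono fun p hp => by
      change p.1 ^ j * (u p * w σ τ p) = _
      rw [hp, hl]; ring)
  filter_upwards [h1, hu.continuousAt.eventually_ne hu0] with p hp hup
  change u p * w σ τ p = _ at hp
  rw [eq_comm, ← mul_right_inj' hup, hp]
  field_simp

/-- The ring of germs is a domain: near a point where `f` is nonzero, `g` vanishes, hence on a whole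
ball by the identity theorem. -/
theorem not_eventually_mul_eq_zero {f g : ℂ × ℂ → ℂ} {o : ℂ × ℂ} (hf : AnalyticAt ℂ f o)
    (hg : AnalyticAt ℂ g o) (hf0 : ¬ ∀ᶠ p in 𝓝 o, f p = 0) (hg0 : ¬ ∀ᶠ p in 𝓝 o, g p = 0) :
    ¬ ∀ᶠ p in 𝓝 o, f p * g p = 0 := by
  intro h
  obtain ⟨r, hr, hball⟩ := Metric.eventually_nhds_iff_ball.1
    (h.and (hf.eventually_analyticAt.and hg.eventually_analyticAt))
  have hpre : IsPreconnected (Metric.ball o r) := (convex_ball o r).isPreconnected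
  have hfa : AnalyticOnNhd ℂ f (Metric.ball o r) := fun p hp => (hball p hp).2.1
  obtain ⟨p, hp, hpf⟩ : ∃ p ∈ Metric.ball o r, f p ≠ 0 := by
    by_contra! hall
    exact hf0 (eventually_of_mem (Metric.ball_mem_nhds o hr) hall)
  have hga : AnalyticOnNhd ℂ g (Metric.ball o r) := fun p hp => (hball p hp).2.2
  have hgp : g =ᶠ[𝓝 p] 0 := by
    filter_upwards [(hfa p hp).continuousAt.eventually_ne hpf, Metric.isOpen_ball.mem_nhds hp]
      with q h1 h2
    exact (mul_eq_zero.1 (hball q h2).1).resolve_left h1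
  exact hg0 (eventually_of_mem (Metric.ball_mem_nhds o hr)
    (hga.eqOn_zero_of_preconnected_of_eventuallyEq_zero hpre hp hgp))

end

/-! ### Split differentials, the discriminant set and its components. -/

section

open Set Filter

set_option linter.unusedSectionVars false

section

variable {X : Type*} [TopologicalSpace X] [ChartedSpace C2 X] [IsManifold 𝓘(ℂ, C2) ω X]
  {z : OpenPartialHomeomorph X C2} {p : X} {w : Differential X}

theorem holoChart_chartAt (x : X) : HoloChart (chartAt C2 x) :=
  IsManifold.chart_mem_maximalAtlas x

theorem form_eq_frame (hz : HoloChart z) (hp : p ∈ z.source) (α : Tan p →L[ℂ] ℂ) (v : Tan p) :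
    α v = α (frame z (1, 0) p) * dd (fun y => z y 0) p v +
      α (frame z (0, 1) p) * dd (fun y => z y 1) p v := by
  conv_lhs => rw [eq_frame hz hp v, map_add, map_smul, map_smul, smul_eq_mul, smul_eq_mul]
  ring

theorem differential_eq_frame (hz : HoloChart z) (hp : p ∈ z.source) (v : Tan p) :
    w.toFun p v v =
      w.toFun p (frame z (1, 0) p) (frame z (1, 0) p) * dd (fun y => z y 0) p v ^ 2 +
      2 * w.toFun p (frame z (1, 0) p) (frame z (0, 1) p) *
        (dd (fun y => z y 0) p v * dd (fun y => z y 1) p v) +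
      w.toFun p (frame z (0, 1) p) (frame z (0, 1) p) * dd (fun y => z y 1) p v ^ 2 := by
  conv_lhs => rw [eq_frame hz hp v, w.apply_add]
  simp only [map_smul, _root_.smul_apply, smul_eq_mul]
  ring

theorem frame_dd (hz : HoloChart z) (hp : p ∈ z.source) (v : Tan p) :
    frame z (dd (fun y => z y 0) p v, dd (fun y => z y 1) p v) p = v := by
  apply eq_of_dd_eq hz hp
  · rw [dd_frame_zero hz hp]
  · rw [dd_frame_one hz hp]

theorem isClosed_discSupport (w : Differential X) : IsClosed (discSupport w) := by
  rw [← isOpen_compl_iff, isOpen_iff_mem_nhds]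
  intro x hx
  set z := chartAt C2 x
  have hz : HoloChart z := holoChart_chartAt x
  have hxz : x ∈ z.source := mem_chart_source C2 x
  have hD : ∀ y ∈ z.source, y ∈ discSupport w ↔
      w.toFun y (frame z (1, 0) y) (frame z (1, 0) y) *
      w.toFun y (frame z (0, 1) y) (frame z (0, 1) y) -
      w.toFun y (frame z (1, 0) y) (frame z (0, 1) y) ^ 2 = 0 := fun y hy =>
    mem_discSupport_iff_of_quadratic hz hy (differential_eq_frame hz hy)
  have hc := fun q r => (w.holoAt_apply hz hxz q r).continuousAt
  have hcont := ((hc (1, 0) (1, 0)).mul (hc (0, 1) (0, 1))).sub ((hc (1, 0) (0, 1)).pow 2)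
  filter_upwards [hcont.eventually_ne (fun h0 => hx ((hD x hxz).2 h0)),
    z.open_source.mem_nhds hxz] with y h1 h2
  exact fun hy => h1 ((hD y h2).1 hy)

theorem TwoLinesAt.notMem_discSupport (h : TwoLinesAt w p) : p ∉ discSupport w := by
  obtain ⟨α, β, hli, hw⟩ := h
  have hz := holoChart_chartAt (X := X) p
  have hp := mem_chart_source C2 p
  have hα := form_eq_frame hz hp α
  have hβ := form_eq_frame hz hp β
  rw [mem_discSupport_iff_of_product hz hp (c := 1) (fun v => by rw [hw v, hα v, hβ v]), one_mul]
  intro hdet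
  rw [LinearIndependent.pair_iff] at hli
  have h1 := hli (β (frame (chartAt C2 p) (0, 1) p)) (-α (frame (chartAt C2 p) (0, 1) p)) (by
    ext v
    simp only [_root_.add_apply, _root_.smul_apply, smul_eq_mul,
      _root_.zero_apply]
    rw [hα v, hβ v]
    linear_combination dd (fun y => (chartAt C2 p) y 0) p v * hdet)
  have h2 := hli (β (frame (chartAt C2 p) (1, 0) p)) (-α (frame (chartAt C2 p) (1, 0) p)) (by
    ext v
    simp only [_root_.add_apply, _root_.smul_apply, smul_eq_mul,
      _root_.zero_apply]
    rw [hα v, hβ v]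
    linear_combination -dd (fun y => (chartAt C2 p) y 1) p v * hdet)
  have h3 := hli 1 0 (by
    ext v
    simp only [_root_.add_apply, _root_.smul_apply, smul_eq_mul,
      _root_.zero_apply]
    rw [hα v, neg_eq_zero.1 h1.2, neg_eq_zero.1 h2.2]
    ring)
  exact one_ne_zero h3.1

/-- Near every point, a multiple of a split differential is a product of holomorphic 1-forms. -/
theorem Split.exists_product (h : Split w) (x : X) :
    ∃ (U : Set X) (q : X → ℂ) (μ₁ μ₂ : Form X), IsOpen U ∧ x ∈ U ∧ HoloOn q U ∧
      HoloFormOn μ₁ U ∧ HoloFormOn μ₂ U ∧ (∃ᶠ y in 𝓝 x, q y ≠ 0) ∧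
      ∀ y ∈ U, ∀ v : Tan y, q y * w.toFun y v v = μ₁ y v * μ₂ y v := by
  rcases h with ⟨ψ₁, ψ₂, h₁, h₂, G, hGo, hGd, hG⟩ | ⟨U, g, μ₁, μ₂, hU, -, -, hμ, -, hw⟩
  · obtain ⟨U₁, q₁, μ₁, hU₁, hx₁, hq₁, hμ₁, hd₁, he₁⟩ := h₁ x
    obtain ⟨U₂, q₂, μ₂, hU₂, hx₂, hq₂, hμ₂, hd₂, he₂⟩ := h₂ x
    set z := chartAt C2 x
    have hz : HoloChart z := holoChart_chartAt x
    have hxz : x ∈ z.source := mem_chart_source C2 x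
    have hUo : IsOpen (U₁ ∩ U₂ ∩ z.source) := (hU₁.inter hU₂).inter z.open_source
    -- Points off both polar sets and in `G` are dense. One condition is met at a time; the earlier
    -- ones are open and survive the next small move.
    have hfreq : ∀ y ∈ U₁ ∩ U₂ ∩ z.source,
        ∃ᶠ y' in 𝓝 y, y' ∈ U₁ ∩ U₂ ∩ z.source ∧ q₁ y' ≠ 0 ∧ q₂ y' ≠ 0 ∧ y' ∈ G := by
      intro y hy
      have f1 := (mem_closure_iff_frequently.1 (hd₁ hy.1.1)).and_eventually (hUo.mem_nhds hy)
      rw [← frequently_frequently_nhds]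
      refine f1.mono fun y₁ ⟨⟨_, hn₁⟩, hy₁⟩ => ?_
      have c1 := ((holoOn_iff hU₁).1 hq₁ y₁ hy₁.1.1).continuousAt.eventually_ne hn₁
      have f2 := (mem_closure_iff_frequently.1 (hd₂ hy₁.1.2)).and_eventually
        ((hUo.eventually_mem hy₁).and c1)
      rw [← frequently_frequently_nhds]
      refine f2.mono fun y₂ ⟨⟨_, hn₂⟩, hy₂, hn₁'⟩ => ?_
      have c1' := ((holoOn_iff hU₁).1 hq₁ y₂ hy₂.1.1).continuousAt.eventually_ne hn₁'
      have c2 := ((holoOn_iff hU₂).1 hq₂ y₂ hy₂.1.2).continuousAt.eventually_ne hn₂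
      have f3 := (mem_closure_iff_frequently.1 (hGd y₂)).and_eventually
        ((hUo.eventually_mem hy₂).and (c1'.and c2))
      exact f3.mono fun y₃ ⟨h1, h2, h3, h4⟩ => ⟨h2, h3, h4, h1⟩
    refine ⟨U₁ ∩ U₂ ∩ z.source, fun y => q₁ y * q₂ y, μ₁, μ₂, hUo, ⟨⟨hx₁, hx₂⟩, hxz⟩, ?_,
      hμ₁.mono fun y hy => hy.1.1, hμ₂.mono fun y hy => hy.1.2,
      (hfreq x ⟨⟨hx₁, hx₂⟩, hxz⟩).mono fun y hy => mul_ne_zero hy.2.1 hy.2.2.1, ?_⟩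
    · exact ContMDiffOn.mul (hq₁.mono fun y hy => hy.1.1) (hq₂.mono fun y hy => hy.1.2)
    · intro y hy v
      rw [← frame_dd hz hy.2 v]
      generalize (dd (fun y => z y 0) y v, dd (fun y => z y 1) y v) = s
      -- With the vector written in constant frame coordinates `s`, both sides are continuous
      -- functions of the point, and they agree on the dense set of `hfreq`.
      by_contra hne
      have c0 := (w.holoAt_apply hz hy.2 s s).continuousAt
      have c1 := ((holoOn_iff hU₁).1 hq₁ y hy.1.1).continuousAt
      have c2 := ((holoOn_iff hU₂).1 hq₂ y hy.1.2).continuousAt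
      have c3 := (HoloFormOn.holoAt_apply hU₁ hμ₁ hz hy.2 hy.1.1 s).continuousAt
      have c4 := (HoloFormOn.holoAt_apply hU₂ hμ₂ hz hy.2 hy.1.2 s).continuousAt
      have hev := (((c1.mul c2).mul c0).sub (c3.mul c4)).eventually_ne (sub_ne_zero.2 hne)
      obtain ⟨y', ⟨h1, h2, h3, h4⟩, h5⟩ := ((hfreq y hy).and_eventually hev).exists
      refine h5 (sub_eq_zero.2 ?_)
      change q₁ y' * q₂ y' * w.toFun y' _ _ = μ₁ y' _ * μ₂ y' _
      rw [← he₁ y' h1.1.1 h2, ← he₂ y' h1.1.2 h3, hG y' h4]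
      simp only [_root_.smul_apply, smul_eq_mul]
      ring
  · refine ⟨U x, fun _ => 1, μ₁ x, μ₂ x, (hU x).1, (hU x).2, contMDiffOn_const, (hμ x).1,
      (hμ x).2, (Eventually.of_forall fun _ => one_ne_zero).frequently, fun y hy v => ?_⟩
    rw [one_mul, hw x y hy v, one_mul]

theorem HoloChart.restr (hz : HoloChart z) {s : Set X} (hs : IsOpen s) : HoloChart (z.restr s) :=
  restr_mem_maximalAtlas (contDiffGroupoid ω 𝓘(ℂ, C2)) hz hs

/-- Near a point of the closure of a component `C` of the regular locus of `D` where `D` is smooth,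
the closure of `C` agrees with `D`. -/
theorem closure_component_eventually_eq {D : Set X} (hD : IsClosed D) {x : X}
    (hz : HoloChart z) (hp : p ∈ z.source) (hp0 : z p 0 = 0)
    (hev : ∀ᶠ y in 𝓝 p, y ∈ D ↔ z y 0 = 0)
    (hpC : p ∈ closure (connectedComponentIn (regularPoints D) x)) :
    p ∈ connectedComponentIn (regularPoints D) x ∧
      ∃ ζ : OpenPartialHomeomorph X C2, (∀ y, ζ y = z y) ∧ ζ.source ⊆ z.source ∧
        Straightens ζ D p ∧
        Straightens ζ (closure (connectedComponentIn (regularPoints D) x)) p := by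
  set C := connectedComponentIn (regularPoints D) x with hC
  have hCD : C ⊆ D := fun y hy => (connectedComponentIn_subset _ _ hy).1
  have hLD : closure C ⊆ D := closure_minimal hCD hD
  obtain ⟨V, hV, hVo, hpV⟩ := eventually_nhds_iff.1 hev
  have hpP : p ∈ (pairChart z).source := by rwa [pairChart_source]
  have hopen : IsOpen ((pairChart z).source ∩ V) := (pairChart z).open_source.inter hVo
  have himg : (pairChart z) '' ((pairChart z).source ∩ V) ∈ 𝓝 (pairChart z p) :=
    ((pairChart z).isOpen_image_of_subset_source hopen inter_subset_left).mem_nhds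
      ⟨p, ⟨hpP, hpV⟩, rfl⟩
  -- Over a ball in the chart, the curve is a convex slice and therefore connected; this is what
  -- makes a single component visible near `p`.
  obtain ⟨r, hr, hball⟩ := Metric.mem_nhds_iff.1 himg
  set N := (pairChart z).source ∩ (pairChart z) ⁻¹' (Metric.ball (pairChart z p) r) with hN
  have hNo : IsOpen N := (pairChart z).isOpen_inter_preimage Metric.isOpen_ball
  have hNV : N ⊆ V := by
    rintro y ⟨hy1, hy2⟩
    obtain ⟨y', ⟨h1, h2⟩, h3⟩ := hball hy2
    rwa [← (pairChart z).injOn h1 hy1 h3]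
  have hsrc : (z.restr N).source = N := by
    rw [z.restr_source' N hNo, inter_eq_right]
    exact fun y hy => by simpa using hy.1
  have hζ : HoloChart (z.restr N) := hz.restr hNo
  have hpN : p ∈ N := ⟨hpP, Metric.mem_ball_self hr⟩
  have hval : ∀ y, z.restr N y = z y := fun y => rfl
  have hND : ∀ y ∈ N, y ∈ D ↔ z y 0 = 0 := fun y hy => hV y (hNV hy)
  have hreg : ∀ y ∈ N, y ∈ D → y ∈ regularPoints D := fun y hy hyD =>
    ⟨hyD, z.restr N, hζ, by rwa [hsrc], fun y' hy' => hND y' (hsrc ▸ hy')⟩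
  have hslice : IsPreconnected (N ∩ D) := by
    have h1 : N ∩ D = (pairChart z).symm ''
        (Metric.ball (pairChart z p) r ∩ {q | q.1 = 0}) := by
      ext y
      constructor
      · rintro ⟨hy, hyD⟩
        exact ⟨pairChart z y, ⟨hy.2, (hND y hy).1 hyD⟩, (pairChart z).left_inv hy.1⟩
      · rintro ⟨q, ⟨hq1, hq2⟩, rfl⟩
        obtain ⟨y', ⟨h1, h2⟩, h3⟩ := hball hq1
        rw [← h3] at hq1 hq2 ⊢
        rw [(pairChart z).left_inv h1]
        exact ⟨⟨h1, hq1⟩, (hND y' ⟨h1, hq1⟩).2 hq2⟩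
    rw [h1]
    refine IsPreconnected.image ?_ _ ?_
    · refine Convex.isPreconnected ((convex_ball _ _).inter ?_)
      intro a ha b hb s t _ _ _
      simp only [mem_ofPred_eq] at ha hb ⊢
      simp [ha, hb]
    · refine (pairChart z).continuousOn_symm.mono fun q hq => ?_
      obtain ⟨y', ⟨h1, h2⟩, h3⟩ := hball hq.1
      exact h3 ▸ (pairChart z).map_source h1
  obtain ⟨y₁, hy₁N, hy₁C⟩ := mem_closure_iff.1 hpC N hNo hpN
  -- The slice consists of regular points, is connected and meets `C`, so it lies in `C`.
  have hsub : N ∩ D ⊆ C := by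
    rw [hC, connectedComponentIn_eq hy₁C]
    exact hslice.subset_connectedComponentIn ⟨hy₁N, hCD hy₁C⟩ fun y hy => hreg y hy.1 hy.2
  refine ⟨hsub ⟨hpN, (hND p hpN).2 hp0⟩, z.restr N, hval,
    fun y hy => by rw [hsrc] at hy; simpa using hy.1,
    ⟨hζ, by rwa [hsrc], fun y hy => hND y (hsrc ▸ hy)⟩, hζ, by rwa [hsrc], fun y hy => ?_⟩
  rw [hsrc] at hy
  rw [hval, ← hND y hy]
  exact ⟨fun h => hLD h, fun h => subset_closure (hsub ⟨hy, h⟩)⟩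

end

end

/-! ### Product decompositions in an adapted chart. -/

section

open Set Filter

set_option linter.unusedSectionVars false

/-- Coefficients that vanish identically are replaced by `1`, so that the product of all factors
remains a nonzero germ. -/
theorem exists_nonzero_replacement {f : ℂ × ℂ → ℂ} {o : ℂ × ℂ} (hf : AnalyticAt ℂ f o) :
    ∃ g : ℂ × ℂ → ℂ, AnalyticAt ℂ g o ∧ (¬ ∀ᶠ p in 𝓝 o, g p = 0) ∧
      ((∀ᶠ p in 𝓝 o, f p = 0) ∨ g = f) := by
  by_cases h : ∀ᶠ p in 𝓝 o, f p = 0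
  · exact ⟨fun _ => 1, analyticAt_const, fun h1 => one_ne_zero h1.self_of_nhds, Or.inl h⟩
  · exact ⟨f, hf, h, Or.inr rfl⟩

theorem eventually_or_nhds {f g : ℂ × ℂ → ℂ} {o : ℂ × ℂ} (h : (∀ᶠ p in 𝓝 o, f p = 0) ∨ g = f) :
    ∀ᶠ o' in 𝓝 o, (∀ᶠ p in 𝓝 o', f p = 0) ∨ g = f := by
  rcases h with h | h
  · exact h.eventually_nhds.mono fun _ => Or.inl
  · exact Eventually.of_forall fun _ => Or.inr h

/-- Supplies a second coordinate, an affine one, which completes `ψ` to a chart centred on the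
second axis. -/
theorem exists_complement {ψ : ℂ × ℂ → ℂ} {o : ℂ × ℂ} (h : d1 ψ o ≠ 0 ∨ d2 ψ o ≠ 0) :
    ∃ g : ℂ × ℂ → ℂ, AnalyticAt ℂ g o ∧ g o = 0 ∧ d1 ψ o * d2 g o - d2 ψ o * d1 g o ≠ 0 := by
  rcases h with h | h
  · refine ⟨fun p => p.2 - o.2, analyticAt_snd.sub analyticAt_const, sub_self _, ?_⟩
    have : ∀ v, fderiv ℂ (fun p : ℂ × ℂ => p.2 - o.2) o v = v.2 := fun v => by
      rw [fderiv_sub_const, fderiv_snd]; rfl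
    rw [d2, d1, d2, d1, this, this]
    simpa [d1] using h
  · refine ⟨fun p => p.1 - o.1, analyticAt_fst.sub analyticAt_const, sub_self _, ?_⟩
    have : ∀ v, fderiv ℂ (fun p : ℂ × ℂ => p.1 - o.1) o v = v.1 := fun v => by
      rw [fderiv_sub_const, fderiv_fst]; rfl
    rw [d2, d1, d2, d1, this, this]
    simpa [d2] using h

theorem quadratic_eq_of_three {a b c A₁ B₁ A₂ B₂ h : ℂ} (h₁ : a = h * (A₁ * A₂))
    (h₂ : c = h * (B₁ * B₂)) (h₃ : a + 2 * b + c = h * ((A₁ + B₁) * (A₂ + B₂))) (s t : ℂ) :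
    a * s ^ 2 + 2 * b * (s * t) + c * t ^ 2 =
      h * ((A₁ * s + B₁ * t) * (A₂ * s + B₂ * t)) := by
  have : 2 * b = h * (A₁ * B₂ + A₂ * B₁) := by linear_combination h₃ - h₁ - h₂
  rw [this, h₁, h₂]; ring

section

variable {X : Type*} [TopologicalSpace X] [ChartedSpace C2 X] [IsManifold 𝓘(ℂ, C2) ω X]
  {z ζ : OpenPartialHomeomorph X C2} {p : X} {w : Differential X}

theorem tendsto_pairChart (z : OpenPartialHomeomorph X C2) (hp : p ∈ z.source) :
    Tendsto (pairChart z) (𝓝 p) (𝓝 (pairChart z p)) :=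
  (pairChart z).continuousAt (by rwa [pairChart_source])

theorem tendsto_pairChart_symm (z : OpenPartialHomeomorph X C2) (hp : p ∈ z.source) :
    Tendsto (pairChart z).symm (𝓝 (pairChart z p)) (𝓝 p) := by
  have hp' : p ∈ (pairChart z).source := by rwa [pairChart_source]
  have := ((pairChart z).continuousAt_symm ((pairChart z).map_source hp')).tendsto
  rwa [(pairChart z).left_inv hp'] at this

theorem pairChart_left_inv (z : OpenPartialHomeomorph X C2) (hp : p ∈ z.source) :
    (pairChart z).symm (pairChart z p) = p :=
  (pairChart z).left_inv (by rwa [pairChart_source])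

theorem pairChart_mem_target (z : OpenPartialHomeomorph X C2) (hp : p ∈ z.source) :
    pairChart z p ∈ (pairChart z).target :=
  (pairChart z).map_source (by rwa [pairChart_source])

theorem HoloAt.analyticAt_pair {f : X → ℂ} (hz : HoloChart z) (hp : p ∈ z.source)
    (hf : HoloAt f p) : AnalyticAt ℂ (fun q => f ((pairChart z).symm q)) (pairChart z p) :=
  HoloAt.analyticAt hz (pairChart_mem_target z hp) (by rwa [pairChart_left_inv z hp])

/-- Near `p`, the differential is a product `h μ₁ μ₂` with nowhere vanishing holomorphic 1-forms
such that `μ₁ ∧ μ₂` is a power of the first coordinate of a chart up to a unit, and the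
discriminant is the zero set of that coordinate. -/
def ProductNear (w : Differential X) (p : X) : Prop :=
  ∃ (ζ : OpenPartialHomeomorph X C2) (h A₁ B₁ A₂ B₂ W : ℂ × ℂ → ℂ) (n : ℕ), HoloChart ζ ∧
    p ∈ ζ.source ∧ pairChart ζ p = 0 ∧ AnalyticAt ℂ h 0 ∧ AnalyticAt ℂ A₁ 0 ∧
    AnalyticAt ℂ B₁ 0 ∧ AnalyticAt ℂ A₂ 0 ∧ AnalyticAt ℂ B₂ 0 ∧ AnalyticAt ℂ W 0 ∧ W 0 ≠ 0 ∧
    (A₁ 0 ≠ 0 ∨ B₁ 0 ≠ 0) ∧ (A₂ 0 ≠ 0 ∨ B₂ 0 ≠ 0) ∧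
    (∀ᶠ r in 𝓝 (0 : ℂ × ℂ), A₁ r * B₂ r - A₂ r * B₁ r = r.1 ^ n * W r) ∧
    (∀ᶠ y in 𝓝 p, y ∈ discSupport w ↔ ζ y 0 = 0) ∧
    ∀ᶠ y in 𝓝 p, ∀ v : Tan y, w.toFun y v v = h (pairChart ζ y) *
      ((A₁ (pairChart ζ y) * dd (fun y => ζ y 0) y v +
          B₁ (pairChart ζ y) * dd (fun y => ζ y 1) y v) *
        (A₂ (pairChart ζ y) * dd (fun y => ζ y 0) y v +
          B₂ (pairChart ζ y) * dd (fun y => ζ y 1) y v))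

/-- This is the Jacobian of the change of charts; a linear relation between its columns would be one
between the frame vectors. -/
theorem frame_det_ne_zero (hz : HoloChart z) (hζ : HoloChart ζ) (hp : p ∈ z.source)
    (hp' : p ∈ ζ.source) :
    dd (fun y => z y 0) p (frame ζ (1, 0) p) * dd (fun y => z y 1) p (frame ζ (0, 1) p) -
      dd (fun y => z y 0) p (frame ζ (0, 1) p) * dd (fun y => z y 1) p (frame ζ (1, 0) p) ≠ 0 := by
  intro hdet
  set a := dd (fun y => z y 0) p (frame ζ (1, 0) p) with ha
  set b := dd (fun y => z y 0) p (frame ζ (0, 1) p) with hb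
  set c := dd (fun y => z y 1) p (frame ζ (1, 0) p) with hc
  set d := dd (fun y => z y 1) p (frame ζ (0, 1) p) with hd
  have key : ∀ s t : ℂ, s * a + t * b = 0 → s * c + t * d = 0 → s = 0 ∧ t = 0 := by
    intro s t h0 h1
    have hv : s • frame ζ (1, 0) p + t • frame ζ (0, 1) p = 0 := by
      apply eq_of_dd_eq hz hp
      · rw [map_add, map_smul, map_smul, map_zero, smul_eq_mul, smul_eq_mul]; exact h0
      · rw [map_add, map_smul, map_smul, map_zero, smul_eq_mul, smul_eq_mul]; exact h1
    constructor
    · have := congrArg (dd (fun y => ζ y 0) p) hv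
      rw [map_add, map_smul, map_smul, map_zero, dd_frame_zero hζ hp', dd_frame_zero hζ hp'] at this
      simpa using this
    · have := congrArg (dd (fun y => ζ y 1) p) hv
      rw [map_add, map_smul, map_smul, map_zero, dd_frame_one hζ hp', dd_frame_one hζ hp'] at this
      simpa using this
  have h1 := key d (-c) (by linear_combination hdet) (by ring)
  have h2 := key (-b) a (by ring) (by linear_combination hdet)
  have h3 := key 1 0 (by rw [h2.2]; ring) (by rw [neg_eq_zero.1 h1.2]; ring)
  exact one_ne_zero h3.1

/-- Changing the frame in which a product decomposition is written. -/
theorem productNear_of_frame (hz : HoloChart z) (hζ : HoloChart ζ) (hp : p ∈ z.source)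
    (hp' : p ∈ ζ.source) (hp0 : pairChart ζ p = 0) (hpD : p ∈ discSupport w)
    {h A₁ B₁ A₂ B₂ W e : ℂ × ℂ → ℂ} {l n : ℕ} (hh : AnalyticAt ℂ h 0)
    (hA₁ : AnalyticAt ℂ A₁ 0) (hB₁ : AnalyticAt ℂ B₁ 0) (hA₂ : AnalyticAt ℂ A₂ 0)
    (hB₂ : AnalyticAt ℂ B₂ 0) (hW : AnalyticAt ℂ W 0) (hW0 : W 0 ≠ 0) (he : AnalyticAt ℂ e 0)
    (he0 : e 0 ≠ 0) (hn₁ : A₁ 0 ≠ 0 ∨ B₁ 0 ≠ 0) (hn₂ : A₂ 0 ≠ 0 ∨ B₂ 0 ≠ 0)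
    (hhe : ∀ᶠ r in 𝓝 (0 : ℂ × ℂ), h r = r.1 ^ l * e r)
    (hwedge : ∀ᶠ r in 𝓝 (0 : ℂ × ℂ), A₁ r * B₂ r - A₂ r * B₁ r = r.1 ^ n * W r)
    (hw : ∀ᶠ y in 𝓝 p, ∀ v : Tan y, w.toFun y v v = h (pairChart ζ y) *
      ((A₁ (pairChart ζ y) * dd (fun y => z y 0) y v +
          B₁ (pairChart ζ y) * dd (fun y => z y 1) y v) *
        (A₂ (pairChart ζ y) * dd (fun y => z y 0) y v +
          B₂ (pairChart ζ y) * dd (fun y => z y 1) y v))) :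
    ProductNear w p := by
  have hP : ∀ (f : X → ℂ) (q : ℂ × ℂ), HoloAt f p →
      AnalyticAt ℂ (fun r => dd f ((pairChart ζ).symm r) (frame ζ q ((pairChart ζ).symm r))) 0 :=
    fun f q hf => by
      have := HoloAt.analyticAt_pair hζ hp' (hf.dd_frame hζ hp' q)
      rwa [hp0] at this
  set P : ℂ × ℂ → ℂ × ℂ → ℂ := fun q r =>
    dd (fun y => z y 0) ((pairChart ζ).symm r) (frame ζ q ((pairChart ζ).symm r)) with hPdef
  set R : ℂ × ℂ → ℂ × ℂ → ℂ := fun q r =>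
    dd (fun y => z y 1) ((pairChart ζ).symm r) (frame ζ q ((pairChart ζ).symm r)) with hRdef
  have hPa : ∀ q, AnalyticAt ℂ (P q) 0 := fun q => hP _ q (hz.holoAt_zero hp)
  have hRa : ∀ q, AnalyticAt ℂ (R q) 0 := fun q => hP _ q (hz.holoAt_one hp)
  have hPv : ∀ q, ∀ y ∈ ζ.source, P q (pairChart ζ y) =
      dd (fun y => z y 0) y (frame ζ q y) := fun q y hy =>
    congrArg (fun y' => dd (fun y => z y 0) y' (frame ζ q y')) (pairChart_left_inv ζ hy)
  have hRv : ∀ q, ∀ y ∈ ζ.source, R q (pairChart ζ y) =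
      dd (fun y => z y 1) y (frame ζ q y) := fun q y hy =>
    congrArg (fun y' => dd (fun y => z y 1) y' (frame ζ q y')) (pairChart_left_inv ζ hy)
  have hJ : P (1, 0) 0 * R (0, 1) 0 - P (0, 1) 0 * R (1, 0) 0 ≠ 0 := by
    rw [← hp0, hPv _ p hp', hPv _ p hp', hRv _ p hp', hRv _ p hp']
    exact frame_det_ne_zero hz hζ hp hp'
  have hT : Tendsto (pairChart ζ) (𝓝 p) (𝓝 0) := hp0 ▸ tendsto_pairChart ζ hp'
  have hnz : ∀ {a b : ℂ}, a ≠ 0 ∨ b ≠ 0 → a * P (1, 0) 0 + b * R (1, 0) 0 ≠ 0 ∨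
      a * P (0, 1) 0 + b * R (0, 1) 0 ≠ 0 := by
    intro a b hab
    by_contra! hcon
    obtain ⟨h1, h2⟩ := hcon
    rcases hab with h3 | h3
    · refine mul_ne_zero h3 hJ ?_
      linear_combination R (0, 1) 0 * h1 - R (1, 0) 0 * h2
    · refine mul_ne_zero h3 hJ ?_
      linear_combination P (1, 0) 0 * h2 - P (0, 1) 0 * h1
  have hwζ : ∀ᶠ y in 𝓝 p, ∀ v : Tan y, w.toFun y v v = h (pairChart ζ y) *
      (((A₁ (pairChart ζ y) * P (1, 0) (pairChart ζ y) + B₁ (pairChart ζ y) *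
          R (1, 0) (pairChart ζ y)) * dd (fun y => ζ y 0) y v +
        (A₁ (pairChart ζ y) * P (0, 1) (pairChart ζ y) + B₁ (pairChart ζ y) *
          R (0, 1) (pairChart ζ y)) * dd (fun y => ζ y 1) y v) *
        ((A₂ (pairChart ζ y) * P (1, 0) (pairChart ζ y) + B₂ (pairChart ζ y) *
          R (1, 0) (pairChart ζ y)) * dd (fun y => ζ y 0) y v +
        (A₂ (pairChart ζ y) * P (0, 1) (pairChart ζ y) + B₂ (pairChart ζ y) *
          R (0, 1) (pairChart ζ y)) * dd (fun y => ζ y 1) y v)) := by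
    filter_upwards [hw, ζ.open_source.mem_nhds hp'] with y h1 h2 v
    rw [h1 v, form_eq_frame hζ h2 (dd (fun y => z y 0) y) v,
      form_eq_frame hζ h2 (dd (fun y => z y 1) y) v]
    rw [hPv _ y h2, hPv _ y h2, hRv _ y h2, hRv _ y h2]
    ring
  have hJa : AnalyticAt ℂ (fun r => P (1, 0) r * R (0, 1) r - P (0, 1) r * R (1, 0) r) 0 :=
    ((hPa _).mul (hRa _)).sub ((hPa _).mul (hRa _))
  -- The coefficient `h` contributes `l`, the wedge contributes `n`, and the remaining factors,
  -- including the Jacobian, are units.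
  have hDiff : ∀ᶠ y in 𝓝 p, y ∈ discSupport w ↔ ζ y 0 ^ (l + n) = 0 := by
    filter_upwards [hwζ, ζ.open_source.mem_nhds hp', hT.eventually hhe, hT.eventually hwedge,
      hT.eventually (he.continuousAt.eventually_ne he0),
      hT.eventually (hW.continuousAt.eventually_ne hW0),
      hT.eventually (hJa.continuousAt.eventually_ne hJ)] with y h1 h2 h3 h4 h5 h6 h7
    rw [mem_discSupport_iff_of_product hζ h2 h1]
    have h8 : ∀ a b : ℂ, a = ζ y 0 ^ (l + n) * b → b ≠ 0 → (a = 0 ↔ ζ y 0 ^ (l + n) = 0) := by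
      intro a b h9 h10
      rw [h9, mul_eq_zero, or_iff_left h10]
    refine h8 _ _ ?_ (mul_ne_zero h5 (mul_ne_zero h6 h7))
    rw [h3]
    simp only [pairChart_apply] at h4 ⊢
    linear_combination (ζ y 0 ^ l * e (ζ y 0, ζ y 1) * (P (1, 0) (ζ y 0, ζ y 1) *
      R (0, 1) (ζ y 0, ζ y 1) - P (0, 1) (ζ y 0, ζ y 1) * R (1, 0) (ζ y 0, ζ y 1))) * h4
  -- With exponent zero the discriminant would be empty near `p`. Only for a positive exponent is
  -- the power zero exactly when the coordinate is.
  have hln : l + n ≠ 0 := by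
    intro h0
    have := hDiff.self_of_nhds.1 hpD
    rw [h0, pow_zero] at this
    exact one_ne_zero this
  refine ⟨ζ, h, fun r => A₁ r * P (1, 0) r + B₁ r * R (1, 0) r,
    fun r => A₁ r * P (0, 1) r + B₁ r * R (0, 1) r,
    fun r => A₂ r * P (1, 0) r + B₂ r * R (1, 0) r,
    fun r => A₂ r * P (0, 1) r + B₂ r * R (0, 1) r,
    fun r => W r * (P (1, 0) r * R (0, 1) r - P (0, 1) r * R (1, 0) r), n, hζ, hp', hp0, hh,
    (hA₁.mul (hPa _)).add (hB₁.mul (hRa _)), (hA₁.mul (hPa _)).add (hB₁.mul (hRa _)),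
    (hA₂.mul (hPa _)).add (hB₂.mul (hRa _)), (hA₂.mul (hPa _)).add (hB₂.mul (hRa _)),
    hW.mul hJa, mul_ne_zero hW0 hJ, hnz hn₁, hnz hn₂, ?_, ?_, hwζ⟩
  · filter_upwards [hwedge] with r hr
    linear_combination (P (1, 0) r * R (0, 1) r - P (0, 1) r * R (1, 0) r) * hr
  · filter_upwards [hDiff] with y hy
    rw [hy, pow_eq_zero_iff hln]

end

end

/-! ### Decompositions off a discrete set, and common leaves. -/

section

open Set Filter

section

variable {X : Type*} [TopologicalSpace X] [ChartedSpace C2 X] [IsManifold 𝓘(ℂ, C2) ω X]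
  {z ζ : OpenPartialHomeomorph X C2} {p : X} {w : Differential X}

/-- A product of `q`, the wedge and the nonzero coefficients of the two forms is a power of one
function `ψ` up to a unit at all its zeros near `x` but `x`. With `ψ` as first coordinate, all these
factors become powers of it up to units simultaneously, which is the input of
`exists_reduced_product`. -/
theorem eventually_productNear (hsplit : Split w) (hrank : RankTwo w) (x : X) :
    ∀ᶠ p in 𝓝[≠] x, p ∈ discSupport w → ProductNear w p := by
  obtain ⟨U, q, μ₁, μ₂, hU, hxU, hq, hμ₁, hμ₂, hqf, hprod⟩ := hsplit.exists_product x
  set z := chartAt C2 x with hzdef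
  have hz : HoloChart z := holoChart_chartAt x
  have hxz : x ∈ z.source := mem_chart_source C2 x
  have hqH := (holoOn_iff hU).1 hq
  have hμH₁ : ∀ s, ∀ y ∈ U, y ∈ z.source → HoloAt (fun y => μ₁ y (frame z s y)) y :=
    fun s y hyU hyz => HoloFormOn.holoAt_apply hU hμ₁ hz hyz hyU s
  have hμH₂ : ∀ s, ∀ y ∈ U, y ∈ z.source → HoloAt (fun y => μ₂ y (frame z s y)) y :=
    fun s y hyU hyz => HoloFormOn.holoAt_apply hU hμ₂ hz hyz hyU s
  have hwH : ∀ s, ∀ y ∈ z.source, HoloAt (fun y => w.toFun y (frame z s y) (frame z s y)) y :=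
    fun s y hyz => w.holoAt_apply hz hyz s s
  set Q : ℂ × ℂ → ℂ := fun r => q ((pairChart z).symm r) with hQdef
  set M₁ : ℂ × ℂ → ℂ × ℂ → ℂ := fun s r =>
    μ₁ ((pairChart z).symm r) (frame z s ((pairChart z).symm r)) with hM₁
  set M₂ : ℂ × ℂ → ℂ × ℂ → ℂ := fun s r =>
    μ₂ ((pairChart z).symm r) (frame z s ((pairChart z).symm r)) with hM₂
  set N : ℂ × ℂ → ℂ × ℂ → ℂ := fun s r => w.toFun ((pairChart z).symm r)
    (frame z s ((pairChart z).symm r)) (frame z s ((pairChart z).symm r)) with hN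
  have hQv : ∀ y ∈ z.source, Q (pairChart z y) = q y := fun y hy =>
    congrArg q (pairChart_left_inv z hy)
  have hM₁v : ∀ s, ∀ y ∈ z.source, M₁ s (pairChart z y) = μ₁ y (frame z s y) := fun s y hy =>
    congrArg (fun y => μ₁ y (frame z s y)) (pairChart_left_inv z hy)
  have hM₂v : ∀ s, ∀ y ∈ z.source, M₂ s (pairChart z y) = μ₂ y (frame z s y) := fun s y hy =>
    congrArg (fun y => μ₂ y (frame z s y)) (pairChart_left_inv z hy)
  have hNv : ∀ s, ∀ y ∈ z.source, N s (pairChart z y) =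
      w.toFun y (frame z s y) (frame z s y) := fun s y hy =>
    congrArg (fun y => w.toFun y (frame z s y) (frame z s y)) (pairChart_left_inv z hy)
  have hQa : ∀ y ∈ U, y ∈ z.source → AnalyticAt ℂ Q (pairChart z y) := fun y hyU hyz =>
    HoloAt.analyticAt_pair hz hyz (hqH y hyU)
  have hM₁a : ∀ s, ∀ y ∈ U, y ∈ z.source → AnalyticAt ℂ (M₁ s) (pairChart z y) :=
    fun s y hyU hyz => HoloAt.analyticAt_pair hz hyz (hμH₁ s y hyU hyz)
  have hM₂a : ∀ s, ∀ y ∈ U, y ∈ z.source → AnalyticAt ℂ (M₂ s) (pairChart z y) :=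
    fun s y hyU hyz => HoloAt.analyticAt_pair hz hyz (hμH₂ s y hyU hyz)
  have hNa : ∀ s, ∀ y ∈ z.source, AnalyticAt ℂ (N s) (pairChart z y) :=
    fun s y hyz => HoloAt.analyticAt_pair hz hyz (hwH s y hyz)
  set V : ℂ × ℂ → ℂ := fun r => M₁ (1, 0) r * M₂ (0, 1) r - M₂ (1, 0) r * M₁ (0, 1) r with hV
  have hVa : ∀ y ∈ U, y ∈ z.source → AnalyticAt ℂ V (pairChart z y) := fun y hyU hyz =>
    ((hM₁a _ y hyU hyz).mul (hM₂a _ y hyU hyz)).sub ((hM₂a _ y hyU hyz).mul (hM₁a _ y hyU hyz))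
  have hUz : U ∩ z.source ∈ 𝓝 x := (hU.inter z.open_source).mem_nhds ⟨hxU, hxz⟩
  -- the product relation, in the frame of `z`
  have hrel : ∀ y ∈ U, y ∈ z.source → ∀ v : Tan y, q y * w.toFun y v v =
      (M₁ (1, 0) (pairChart z y) * dd (fun y => z y 0) y v +
        M₁ (0, 1) (pairChart z y) * dd (fun y => z y 1) y v) *
      (M₂ (1, 0) (pairChart z y) * dd (fun y => z y 0) y v +
        M₂ (0, 1) (pairChart z y) * dd (fun y => z y 1) y v) := fun y hyU hyz v => by
    rw [hprod y hyU v, form_eq_frame hz hyz (μ₁ y) v, form_eq_frame hz hyz (μ₂ y) v,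
      hM₁v _ y hyz, hM₁v _ y hyz, hM₂v _ y hyz, hM₂v _ y hyz]
  have hVD : ∀ y ∈ U, y ∈ z.source → y ∈ discSupport w → V (pairChart z y) = 0 := by
    intro y hyU hyz hyD
    rw [mem_discSupport_iff_of_quadratic hz hyz (differential_eq_frame hz hyz)] at hyD
    have e1 := hrel y hyU hyz (frame z (1, 0) y)
    have e2 := hrel y hyU hyz (frame z (0, 1) y)
    have e3 := hrel y hyU hyz (frame z (1, 1) y)
    rw [differential_eq_frame hz hyz (frame z (1, 1) y)] at e3
    simp only [dd_frame_zero hz hyz, dd_frame_one hz hyz] at e1 e2 e3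
    -- The wedge satisfies `V ^ 2 = -4 q ^ 2 (a c - b ^ 2)`, because `q w` is the product of the two
    -- forms.
    have h2 : V (pairChart z y) ^ 2 = 0 := by
      simp only [hV]
      generalize w.toFun y (frame z (1, 0) y) (frame z (1, 0) y) = a at *
      generalize w.toFun y (frame z (1, 0) y) (frame z (0, 1) y) = b at *
      generalize w.toFun y (frame z (0, 1) y) (frame z (0, 1) y) = c at *
      generalize M₁ (1, 0) (pairChart z y) = α₁ at *
      generalize M₁ (0, 1) (pairChart z y) = β₁ at *
      generalize M₂ (1, 0) (pairChart z y) = α₂ at *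
      generalize M₂ (0, 1) (pairChart z y) = β₂ at *
      have e4 : 2 * q y * b = α₁ * β₂ + α₂ * β₁ := by linear_combination e3 - e1 - e2
      linear_combination (-4 * q y ^ 2) * hyD - (2 * q y * b + α₁ * β₂ + α₂ * β₁) * e4 +
        4 * q y * c * e1 + 4 * α₁ * α₂ * e2
    exact pow_eq_zero_iff (two_ne_zero) |>.1 h2
  have hx0 := pairChart_left_inv z hxz
  have hT := tendsto_pairChart z hxz
  -- the factors are not identically zero
  have hQ0 : ¬ ∀ᶠ r in 𝓝 (pairChart z x), Q r = 0 := fun h0 => by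
    obtain ⟨y, h1, h2, h3⟩ :=
      (hqf.and_eventually ((hT.eventually h0).and (z.open_source.mem_nhds hxz))).exists
    rw [hQv y h3] at h2
    exact h1 h2
  have hV0 : ¬ ∀ᶠ r in 𝓝 (pairChart z x), V r = 0 := fun h0 => by
    obtain ⟨y, h1, h2, h3⟩ :=
      (hqf.and_eventually ((hT.eventually h0).eventually_nhds.and
        ((hU.inter z.open_source).eventually_mem ⟨hxU, hxz⟩))).exists
    have h4 := (hqH y h3.1).continuousAt.eventually_ne h1
    obtain ⟨y', hy', h5, h6, h7⟩ := ((mem_closure_iff_frequently.1 (hrank y)).and_eventually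
      (h4.and (h2.and ((hU.inter z.open_source).eventually_mem h3)))).exists
    refine (show TwoLinesAt w y' from hy').notMem_discSupport ?_
    rw [mem_discSupport_iff_of_product hz h7.2 (c := (q y')⁻¹) (fun v => by
      rw [← hrel y' h7.1 h7.2 v, inv_mul_cancel_left₀ h5])]
    exact mul_eq_zero_of_right _ h6
  obtain ⟨f₁, hf₁a, hf₁0, hf₁⟩ := exists_nonzero_replacement (hM₁a (1, 0) x hxU hxz)
  obtain ⟨f₂, hf₂a, hf₂0, hf₂⟩ := exists_nonzero_replacement (hM₁a (0, 1) x hxU hxz)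
  obtain ⟨f₃, hf₃a, hf₃0, hf₃⟩ := exists_nonzero_replacement (hM₂a (1, 0) x hxU hxz)
  obtain ⟨f₄, hf₄a, hf₄0, hf₄⟩ := exists_nonzero_replacement (hM₂a (0, 1) x hxU hxz)
  have hQx := hQa x hxU hxz
  have hVx := hVa x hxU hxz
  -- The wedge `V` is included so that `F` vanishes on the discriminant; the other factors are
  -- included so that each of them divides `F`.
  set F : ℂ × ℂ → ℂ := fun r => Q r * (V r * ((f₁ r * f₂ r) * (f₃ r * f₄ r))) with hFdef
  have hFa : AnalyticAt ℂ F (pairChart z x) :=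
    hQx.mul (hVx.mul ((hf₁a.mul hf₂a).mul (hf₃a.mul hf₄a)))
  have hF0 : ¬ ∀ᶠ r in 𝓝 (pairChart z x), F r = 0 :=
    not_eventually_mul_eq_zero hQx (hVx.mul ((hf₁a.mul hf₂a).mul (hf₃a.mul hf₄a))) hQ0
      (not_eventually_mul_eq_zero hVx ((hf₁a.mul hf₂a).mul (hf₃a.mul hf₄a)) hV0
        (not_eventually_mul_eq_zero (hf₁a.mul hf₂a) (hf₃a.mul hf₄a)
          (not_eventually_mul_eq_zero hf₁a hf₂a hf₁0 hf₂0)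
          (not_eventually_mul_eq_zero hf₃a hf₄a hf₃0 hf₄0)))
  have hTne : Tendsto (pairChart z) (𝓝[≠] x) (𝓝[≠] (pairChart z x)) := by
    refine tendsto_nhdsWithin_iff.2 ⟨hT.mono_left nhdsWithin_le_nhds, ?_⟩
    filter_upwards [nhdsWithin_le_nhds (z.open_source.mem_nhds hxz), self_mem_nhdsWithin]
      with y hy hne h0
    exact hne ((pairChart z).injOn (by rwa [pairChart_source]) (by rwa [pairChart_source]) h0)
  filter_upwards [hTne.eventually (eventually_eq_pow_mul hFa hF0), nhdsWithin_le_nhds hUz,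
    nhdsWithin_le_nhds (hT.eventually hf₁a.eventually_analyticAt),
    nhdsWithin_le_nhds (hT.eventually hf₂a.eventually_analyticAt),
    nhdsWithin_le_nhds (hT.eventually hf₃a.eventually_analyticAt),
    nhdsWithin_le_nhds (hT.eventually hf₄a.eventually_analyticAt),
    nhdsWithin_le_nhds (hT.eventually (eventually_or_nhds hf₁)),
    nhdsWithin_le_nhds (hT.eventually (eventually_or_nhds hf₂)),
    nhdsWithin_le_nhds (hT.eventually (eventually_or_nhds hf₃)),
    nhdsWithin_le_nhds (hT.eventually (eventually_or_nhds hf₄))]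
    with p hp hpUz a₁ a₂ a₃ a₄ c₁ c₂ c₃ c₄ hpD
  obtain ⟨hpU, hpz⟩ := hpUz
  obtain ⟨ψ, u, k, hψ, hψ0, hψd, hu, hu0, hFψ⟩ := hp (by
    simp only [hFdef, hVD p hpU hpz hpD, zero_mul, mul_zero])
  obtain ⟨g, hg, hg0, hdet⟩ := exists_complement hψd
  obtain ⟨ζ, hζ, hpζ, -, hζz, hval⟩ := exists_chart hz hpz hψ hg hdet (N := univ) univ_mem
  have hp0 : pairChart ζ p = 0 := by rw [hval, hψ0, hg0]; rfl
  have hsymT : Tendsto (pairChart ζ).symm (𝓝 0) (𝓝 p) := hp0 ▸ tendsto_pairChart_symm ζ hpζ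
  have hs0 : (pairChart ζ).symm 0 = p := by rw [← hp0, pairChart_left_inv ζ hpζ]
  have htgt : (0 : ℂ × ℂ) ∈ (pairChart ζ).target := hp0 ▸ pairChart_mem_target ζ hpζ
  -- the transition map
  set T : ℂ × ℂ → ℂ × ℂ := fun r => pairChart z ((pairChart ζ).symm r) with hTdef
  have hTa : AnalyticAt ℂ T 0 := by
    have h0 := HoloAt.analyticAt_pair hζ hpζ (hz.holoAt_zero hpz)
    have h1 := HoloAt.analyticAt_pair hζ hpζ (hz.holoAt_one hpz)
    rw [hp0] at h0 h1
    exact h0.prod h1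
  have hT0 : T 0 = pairChart z p := by rw [hTdef]; simp only [hs0]
  have hTt : Tendsto T (𝓝 0) (𝓝 (pairChart z p)) := hT0 ▸ hTa.continuousAt.tendsto
  have hcomp : ∀ {f : ℂ × ℂ → ℂ}, AnalyticAt ℂ f (pairChart z p) →
      AnalyticAt ℂ (fun r => f (T r)) 0 := fun {f} hf =>
    AnalyticAt.comp (g := f) (by rwa [hT0]) hTa
  have hFU : IsPowUnit (fun r => F (T r)) := by
    refine ⟨k, fun r => u (T r), hcomp hu, by simpa only [hT0] using hu0, ?_⟩
    filter_upwards [hTt.eventually hFψ, (pairChart ζ).open_target.mem_nhds htgt] with r h1 h2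
    rw [h1]
    congr 2
    have h3 := congrArg Prod.fst ((pairChart ζ).right_inv h2)
    rw [hval] at h3
    exact h3
  have hfac : ∀ {f f' : ℂ × ℂ → ℂ}, AnalyticAt ℂ f (pairChart z p) →
      AnalyticAt ℂ f' (pairChart z p) → (∀ r, f r * f' r = F r) →
      IsPowUnit (fun r => f (T r)) := fun hf hf' h =>
    hFU.of_mul (hcomp hf) (hcomp hf') (Eventually.of_forall fun r => h (T r))
  have hQp := hQa p hpU hpz
  have hVp := hVa p hpU hpz
  have hcase : ∀ {f f' : ℂ × ℂ → ℂ}, (∀ᶠ r in 𝓝 (pairChart z p), f r = 0) ∨ f' = f →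
      IsPowUnit (fun r => f' (T r)) →
      (∀ᶠ r in 𝓝 0, f (T r) = 0) ∨ IsPowUnit (fun r => f (T r)) := by
    rintro f f' (h | rfl) h'
    · exact Or.inl (hTt.eventually h)
    · exact Or.inr h'
  obtain ⟨h, A₁, B₁, A₂, B₂, W, l, n, e, hh, hA₁, hB₁, hA₂, hB₂, hW, hW0, he, he0, hn₁, hn₂, hhe,
      hwedge, hred⟩ := exists_reduced_product (Q := fun r => Q (T r))
    (α₁ := fun r => M₁ (1, 0) (T r)) (β₁ := fun r => M₁ (0, 1) (T r))
    (α₂ := fun r => M₂ (1, 0) (T r)) (β₂ := fun r => M₂ (0, 1) (T r))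
    (w := fun σ τ r => N (σ, τ) (T r)) (fun σ τ => hcomp (hNa _ p hpz))
    (hfac hQp (hVp.mul ((a₁.mul a₂).mul (a₃.mul a₄))) fun r => rfl)
    (hcase c₁ (hfac a₁ (hQp.mul (hVp.mul (a₂.mul (a₃.mul a₄)))) fun r => by
      simp only [hFdef, Pi.mul_apply]; ring))
    (hcase c₂ (hfac a₂ (hQp.mul (hVp.mul (a₁.mul (a₃.mul a₄)))) fun r => by
      simp only [hFdef, Pi.mul_apply]; ring))
    (hcase c₃ (hfac a₃ (hQp.mul (hVp.mul (a₁.mul (a₂.mul a₄)))) fun r => by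
      simp only [hFdef, Pi.mul_apply]; ring))
    (hcase c₄ (hfac a₄ (hQp.mul (hVp.mul (a₁.mul (a₂.mul a₃)))) fun r => by
      simp only [hFdef, Pi.mul_apply]; ring))
    (hfac hVp (hQp.mul ((a₁.mul a₂).mul (a₃.mul a₄))) fun r => by
      simp only [hFdef, Pi.mul_apply]; ring)
    (fun σ τ => by
      filter_upwards [hsymT.eventually_mem ((hU.inter z.open_source).mem_nhds ⟨hpU, hpz⟩)]
        with r hr
      have h1 := hrel _ hr.1 hr.2 (frame z (σ, τ) _)
      rw [dd_frame_zero hz hr.2, dd_frame_one hz hr.2, ← hQv _ hr.2, ← hNv _ _ hr.2] at h1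
      exact h1)
  refine productNear_of_frame hz hζ hpz hpζ hp0 hpD hh hA₁ hB₁ hA₂ hB₂ hW hW0 he he0 hn₁ hn₂ hhe
    hwedge ?_
  have hTζ : Tendsto (pairChart ζ) (𝓝 p) (𝓝 0) := hp0 ▸ tendsto_pairChart ζ hpζ
  filter_upwards [hTζ.eventually (hred 1 0), hTζ.eventually (hred 0 1), hTζ.eventually (hred 1 1),
    ζ.open_source.mem_nhds hpζ, z.open_source.mem_nhds hpz] with y h1 h2 h3 h4 h5 v
  have hTy : T (pairChart ζ y) = pairChart z y := by
    simp only [hTdef, pairChart_left_inv ζ h4]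
  rw [hTy, hNv _ y h5] at h1 h2 h3
  rw [differential_eq_frame hz h5, dd_frame_zero hz h5, dd_frame_one hz h5] at h3
  rw [differential_eq_frame hz h5]
  refine quadratic_eq_of_three ?_ ?_ ?_ _ _
  · rw [h1]; ring
  · rw [h2]; ring
  · linear_combination h3

/-- Tangency to `{z₁ = 0}` says that both forms vanish on `∂/∂z₂` along this curve, that is, `B₁`
and `B₂` vanish there. Hence `A₁` and `A₂` are nonzero at `p` and the wedge vanishes at `p`. -/
theorem ProductNear.exists_strictNormalFormAt (h : ProductNear w p) {x₀ : X}
    (hL : CommonLeaf w (closure (connectedComponentIn (regularPoints (discSupport w)) x₀)))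
    (hp : p ∈ closure (connectedComponentIn (regularPoints (discSupport w)) x₀)) :
    p ∈ connectedComponentIn (regularPoints (discSupport w)) x₀ ∧
      ∃ m, StrictNormalFormAt w m p := by
  obtain ⟨z, h, A₁, B₁, A₂, B₂, W, n, hz, hpz, hp0, hh, hA₁, hB₁, hA₂, hB₂, hW, hW0, hn₁, hn₂,
    hwedge, hD, hw⟩ := h
  have hz0 : z p 0 = 0 := congrArg Prod.fst hp0
  obtain ⟨hpC, ζ, hval, hsub, hζD, hζ, hpζ, hζL⟩ :=
    closure_component_eventually_eq (isClosed_discSupport w) hz hpz hz0 hD hp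
  refine ⟨hpC, ?_⟩
  have hT : Tendsto (pairChart z) (𝓝 p) (𝓝 0) := hp0 ▸ tendsto_pairChart z hpz
  have hne : ∀ {a b : ℂ × ℂ → ℂ}, AnalyticAt ℂ a 0 → AnalyticAt ℂ b 0 → a 0 ≠ 0 ∨ b 0 ≠ 0 →
      ∀ᶠ r in 𝓝 (0 : ℂ × ℂ), a r ≠ 0 ∨ b r ≠ 0 := by
    rintro a b ha hb (h0 | h0)
    · exact (ha.continuousAt.eventually_ne h0).mono fun _ => Or.inl
    · exact (hb.continuousAt.eventually_ne h0).mono fun _ => Or.inr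
  obtain ⟨U, hU, hUo, hpU⟩ := eventually_nhds_iff.1 (hw.and ((ζ.open_source.eventually_mem hpζ).and
    (((hT.eventually hh.eventually_analyticAt).and
      ((hT.eventually hA₁.eventually_analyticAt).and (hT.eventually hB₁.eventually_analyticAt))).and
    (((hT.eventually hA₂.eventually_analyticAt).and (hT.eventually hB₂.eventually_analyticAt)).and
      ((hT.eventually (hne hA₁ hB₁ hn₁)).and (hT.eventually (hne hA₂ hB₂ hn₂)))))))
  have hform : ∀ {a b : ℂ × ℂ → ℂ}, (∀ y ∈ U, AnalyticAt ℂ a (pairChart z y)) →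
      (∀ y ∈ U, AnalyticAt ℂ b (pairChart z y)) →
      HoloFormOn (fun y => a (pairChart z y) • dd (fun y => z y 0) y +
        b (pairChart z y) • dd (fun y => z y 1) y) U := fun {a b} ha hb =>
    holoFormOn_linearCombination (α := fun y => a (pairChart z y))
      (β := fun y => b (pairChart z y))
      (fun y hy => HoloAt.comp_pairChart hz (hsub (hU y hy).2.1) (ha y hy))
      (fun y hy => HoloAt.comp_pairChart hz (hsub (hU y hy).2.1) (hb y hy))
      (fun y hy => hz.holoAt_zero (hsub (hU y hy).2.1))
      (fun y hy => hz.holoAt_one (hsub (hU y hy).2.1))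
  have hformne : ∀ {a b : ℂ} {y : X}, y ∈ U → a ≠ 0 ∨ b ≠ 0 →
      a • dd (fun y => z y 0) y + b • dd (fun y => z y 1) y ≠ 0 := by
    intro a b y hy hab h0
    have hyz := hsub (hU y hy).2.1
    have h1 := congrArg (fun l : Tan y →L[ℂ] ℂ => l (frame z (1, 0) y)) h0
    have h2 := congrArg (fun l : Tan y →L[ℂ] ℂ => l (frame z (0, 1) y)) h0
    simp only [_root_.add_apply, _root_.smul_apply, smul_eq_mul, dd_frame_zero hz hyz,
      dd_frame_one hz hyz, _root_.zero_apply, mul_one, mul_zero, add_zero, zero_add] at h1 h2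
    exact hab.elim (fun h => h h1) fun h => h h2
  obtain ⟨hl₁, hl₂⟩ := hL.2 U (fun y => h (pairChart z y)) _ _ hUo
    ((holoOn_iff hUo).2 fun y hy =>
      HoloAt.comp_pairChart hz (hsub (hU y hy).2.1) (hU y hy).2.2.1.1)
    (hform (a := A₁) (b := B₁) (fun y hy => (hU y hy).2.2.1.2.1) fun y hy => (hU y hy).2.2.1.2.2)
    (hform (a := A₂) (b := B₂) (fun y hy => (hU y hy).2.2.2.1.1) fun y hy => (hU y hy).2.2.2.1.2)
    (fun y hy => ⟨hformne hy (hU y hy).2.2.2.2.1, hformne hy (hU y hy).2.2.2.2.2⟩)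
    (fun y hy v => by
      rw [(hU y hy).1 v]
      simp only [_root_.add_apply, _root_.smul_apply, smul_eq_mul])
  have hleaf : ∀ {a b : ℂ × ℂ → ℂ}, LeafOn
      (closure (connectedComponentIn (regularPoints (discSupport w)) x₀)) U
      (fun y => a (pairChart z y) • dd (fun y => z y 0) y +
        b (pairChart z y) • dd (fun y => z y 1) y) →
      ∀ᶠ t in 𝓝 (0 : ℂ), b (0, t) = 0 := by
    intro a b hl
    have hc : Tendsto (fun t : ℂ => ((0 : ℂ), t)) (𝓝 0) (𝓝 (0 : ℂ × ℂ)) :=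
      (continuous_const.prodMk continuous_id).tendsto' _ _ rfl
    have hsymT : Tendsto (pairChart z).symm (𝓝 0) (𝓝 p) := hp0 ▸ tendsto_pairChart_symm z hpz
    have htgt : (0 : ℂ × ℂ) ∈ (pairChart z).target := hp0 ▸ pairChart_mem_target z hpz
    filter_upwards [hc.eventually (hsymT.eventually_mem (hUo.mem_nhds hpU)),
      hc.eventually_mem ((pairChart z).open_target.mem_nhds htgt)] with t h1 h2
    set y := (pairChart z).symm (0, t) with hy
    have hzy : pairChart z y = (0, t) := (pairChart z).right_inv h2
    have hyz := hsub (hU y h1).2.1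
    have hz0y : z y 0 = 0 := congrArg Prod.fst hzy
    have h3 := hl y h1 ((hζL y (hU y h1).2.1).2 (by rw [hval]; exact hz0y)) ζ
      ⟨hζ, (hU y h1).2.1, hζL⟩ (frame z (0, 1) y) (by
        simp only [hval]
        rw [dd_frame_zero hz hyz])
    simp only [_root_.add_apply, _root_.smul_apply, smul_eq_mul, dd_frame_zero hz hyz,
      dd_frame_one hz hyz, mul_zero, zero_add, mul_one] at h3
    rwa [hzy] at h3
  have hB₁0 := hleaf hl₁
  have hB₂0 := hleaf hl₂
  have hB₁00 : B₁ 0 = 0 := hB₁0.self_of_nhds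
  have hB₂00 : B₂ 0 = 0 := hB₂0.self_of_nhds
  -- The order of the wedge is at least one because `B₁` and `B₂` both vanish at `0`; the order of
  -- contact `m` is one less.
  obtain ⟨m, rfl⟩ : ∃ m, n = m + 1 := by
    refine Nat.exists_eq_succ_of_ne_zero fun hn => hW0 ?_
    have := hwedge.self_of_nhds
    rw [hn, hB₁00, hB₂00] at this
    simpa using this.symm
  exact ⟨m, SymDiff.exists_strictNormalFormAt hz hpz hp0 hh hA₁ hB₁ hA₂ hB₂ hW
    (hn₁.resolve_right (not_not.2 hB₁00)) (hn₂.resolve_right (not_not.2 hB₂00)) hW0 hB₁0 hwedge hD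
    hw⟩

end

end

/-! ### Constancy of the order of contact along a component. -/

section

open Set Filter

/-- An index that exists locally and is unique at each point is a locally constant function on `S`.
-/
theorem exists_forall_of_isPreconnected {α : Type*} [TopologicalSpace α] {S : Set α}
    (hS : IsPreconnected S) (hne : S.Nonempty) {R : ℕ → α → Prop}
    (hloc : ∀ a ∈ S, ∃ n, ∀ᶠ b in 𝓝[S] a, R n b)
    (huniq : ∀ a ∈ S, ∀ n m, R n a → R m a → n = m) : ∃ n, ∀ a ∈ S, R n a := by
  have hex : ∀ a ∈ S, ∃ n, R n a := fun a ha => by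
    obtain ⟨n, hn⟩ := hloc a ha
    exact ⟨n, hn.self_of_nhdsWithin ha⟩
  choose! f hf using hex
  have hc : ContinuousOn f S := fun a ha => by
    obtain ⟨n, hn⟩ := hloc a ha
    have h1 : f a = n := huniq a ha _ _ (hf a ha) (hn.self_of_nhdsWithin ha)
    rw [ContinuousWithinAt, h1]
    refine tendsto_const_nhds.congr' ?_
    filter_upwards [hn, self_mem_nhdsWithin] with b hb hbS
    exact huniq b hbS _ _ hb (hf b hbS)
  obtain ⟨a₀, ha₀⟩ := hne
  refine ⟨f a₀, fun a ha => ?_⟩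
  rw [hS.constant hc ha₀ ha]
  exact hf a ha

section

variable {X : Type*} [TopologicalSpace X] [ChartedSpace C2 X] [IsManifold 𝓘(ℂ, C2) ω X]
  {z : OpenPartialHomeomorph X C2} {p : X} {w : Differential X}

/-- A punctured disc in the curve `D` around a smooth point of it. -/
theorem Straightens.exists_punctured_disc {D : Set X} (h : Straightens z D p) (hp : p ∈ D)
    {P : X → Prop} (hP : ∀ᶠ y in 𝓝[≠] p, P y) :
    ∃ S : Set X, IsPreconnected S ∧ S.Nonempty ∧ (∀ y ∈ S, y ∈ D ∧ P y) ∧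
      ∀ᶠ y in 𝓝[≠] p, y ∈ D → y ∈ S := by
  obtain ⟨hz, hpz, hD⟩ := h
  have hp0 : pairChart z p = (0, z p 1) := by rw [pairChart_apply, (hD p hpz).1 hp]
  set b := z p 1 with hb
  have htgt : ((0 : ℂ), b) ∈ (pairChart z).target := hp0 ▸ pairChart_mem_target z hpz
  have hsymT : Tendsto (pairChart z).symm (𝓝 (0, b)) (𝓝 p) := hp0 ▸ tendsto_pairChart_symm z hpz
  have hline : Tendsto (fun t : ℂ => ((0 : ℂ), b + t)) (𝓝 0) (𝓝 (0, b)) :=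
    (continuous_const.prodMk (continuous_const.add continuous_id)).tendsto' _ _ (by simp [hb])
  obtain ⟨V, hV, hVo, hpV⟩ := eventually_nhds_iff.1 (eventually_nhdsWithin_iff.1 hP)
  obtain ⟨r, hr, hball⟩ := Metric.eventually_nhds_iff_ball.1
    ((hline.eventually_mem ((pairChart z).open_target.mem_nhds htgt)).and
      (hline.eventually ((hsymT.eventually_mem (hVo.mem_nhds hpV)).and
        (hsymT.eventually_mem (z.open_source.mem_nhds hpz)))))
  have hval : ∀ t ∈ Metric.ball (0 : ℂ) r,
      pairChart z ((pairChart z).symm (0, b + t)) = (0, b + t) := fun t ht =>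
    (pairChart z).right_inv (hball t ht).1
  refine ⟨(fun t : ℂ => (pairChart z).symm (0, b + t)) '' (Metric.ball (0 : ℂ) r \ {0}),
    ?_, ?_, ?_, ?_⟩
  · refine (isPreconnected_ball_diff_zero r).image _ ?_
    refine (pairChart z).continuousOn_symm.comp
      (continuous_const.prodMk (continuous_const.add continuous_id)).continuousOn ?_
    exact fun t ht => (hball t ht.1).1
  · have h0 : ∀ᶠ t in 𝓝[≠] (0 : ℂ), t ∈ Metric.ball (0 : ℂ) r :=
      nhdsWithin_le_nhds (Metric.ball_mem_nhds _ hr)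
    obtain ⟨t, h1, h2⟩ := (h0.and self_mem_nhdsWithin).exists
    exact ⟨_, ⟨t, ⟨h1, h2⟩, rfl⟩⟩
  · rintro y ⟨t, ⟨ht, ht0⟩, rfl⟩
    have h1 := hval t ht
    obtain ⟨-, h2, h3⟩ := hball t ht
    refine ⟨(hD _ h3).2 (congrArg Prod.fst h1), hV _ h2 fun h4 => ht0 ?_⟩
    have h5 : (pairChart z).symm (0, b + t) = p := h4
    rw [h5, hp0] at h1
    have h6 := congrArg Prod.snd h1
    simpa using h6
  · have hT : Tendsto (fun y => z y 1 - b) (𝓝 p) (𝓝 0) := by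
      have := (hz.holoAt_one hpz).continuousAt.tendsto.sub_const b
      rwa [sub_self] at this
    filter_upwards [nhdsWithin_le_nhds (hT.eventually_mem (Metric.ball_mem_nhds 0 hr)),
      nhdsWithin_le_nhds (z.open_source.mem_nhds hpz), self_mem_nhdsWithin] with y h1 h2 h3 hyD
    have h4 : pairChart z y = (0, b + (z y 1 - b)) := by
      rw [pairChart_apply, (hD y h2).1 hyD]; simp
    have h5 : (pairChart z).symm (0, b + (z y 1 - b)) = y := by
      rw [← h4, pairChart_left_inv z h2]
    refine ⟨z y 1 - b, ⟨h1, fun h6 => h3 ?_⟩, h5⟩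
    have h7 : z y 1 - b = 0 := h6
    rw [h7, add_zero, ← hp0, pairChart_left_inv z hpz] at h5
    exact h5.symm

/-- A curve has no isolated points where it is smooth. Used to ensure that properties holding on
punctured neighbourhoods are not vacuous on the curve. -/
theorem frequently_mem_of_mem_regularPoints {D : Set X} (h : p ∈ regularPoints D) :
    ∃ᶠ y in 𝓝[≠] p, y ∈ D := by
  obtain ⟨hp, z, hz⟩ := h
  intro hev
  obtain ⟨S, -, ⟨y, hy⟩, hS, -⟩ := hz.exists_punctured_disc hp hev
  exact (hS y hy).2 (hS y hy).1

/-- The order of contact is constant along a component of the regular locus. -/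
theorem exists_order (hsplit : Split w) (hrank : RankTwo w) {x₀ : X}
    (hx₀ : x₀ ∈ regularPoints (discSupport w))
    (hL : CommonLeaf w (closure (connectedComponentIn (regularPoints (discSupport w)) x₀))) :
    ∃ m, ∀ x, ∀ᶠ p in 𝓝[≠] x,
      p ∈ closure (connectedComponentIn (regularPoints (discSupport w)) x₀) →
        p ∈ connectedComponentIn (regularPoints (discSupport w)) x₀ ∧
          StrictNormalFormAt w m p := by
  set D := discSupport w with hDdef
  set C := connectedComponentIn (regularPoints D) x₀ with hC
  have hCreg : C ⊆ regularPoints D := connectedComponentIn_subset _ _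
  have hLD : closure C ⊆ D :=
    closure_minimal (fun y hy => (hCreg hy).1) (isClosed_discSupport w)
  have hex : ∀ x, ∀ᶠ p in 𝓝[≠] x, p ∈ closure C → p ∈ C ∧ ∃ m, StrictNormalFormAt w m p := by
    intro x
    filter_upwards [eventually_productNear hsplit hrank x] with p hp hpL
    exact (hp (hLD hpL)).exists_strictNormalFormAt hL hpL
  have huniq : ∀ p ∈ C, ∀ n m, (∀ᶠ q in 𝓝[≠] p, q ∈ D → StrictNormalFormAt w n q) →
      (∀ᶠ q in 𝓝[≠] p, q ∈ D → StrictNormalFormAt w m q) → n = m := by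
    intro p hp n m hn hm
    obtain ⟨q, h1, h2, h3⟩ :=
      ((frequently_mem_of_mem_regularPoints (hCreg hp)).and_eventually (hn.and hm)).exists
    exact (h3 h1).unique (h2 h1)
  have hself : ∀ {q n}, StrictNormalFormAt w n q →
      ∀ᶠ y in 𝓝[≠] q, y ∈ D → StrictNormalFormAt w n y := fun h =>
    nhdsWithin_le_nhds h.eventually
  -- At an exceptional point `p` of `C` there may be no strict normal form, but the punctured disc
  -- of the curve around `p` is connected, so the exponent is the same at all nearby points.
  have hloc : ∀ p ∈ C, ∃ n, ∀ᶠ q in 𝓝[≠] p, q ∈ D → StrictNormalFormAt w n q := by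
    intro p hp
    obtain ⟨hpD, z, hz⟩ := hCreg hp
    obtain ⟨-, ζ, -, -, -, hζ, hpζ, hζL⟩ := closure_component_eventually_eq (isClosed_discSupport w)
      hz.1 hz.2.1 ((hz.2.2 p hz.2.1).1 hpD)
      (eventually_of_mem (z.open_source.mem_nhds hz.2.1) hz.2.2) (subset_closure hp)
    obtain ⟨S, hSp, hSne, hS, hSev⟩ := Straightens.exists_punctured_disc ⟨hζ, hpζ, hζL⟩
      (subset_closure hp) (hex p)
    obtain ⟨n, hn⟩ := exists_forall_of_isPreconnected hSp hSne
      (R := fun n y => StrictNormalFormAt w n y)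
      (fun a ha => by
        obtain ⟨h1, h2⟩ := hS a ha
        obtain ⟨-, n, hn⟩ := h2 h1
        refine ⟨n, ?_⟩
        filter_upwards [nhdsWithin_le_nhds hn.eventually, self_mem_nhdsWithin] with y h3 h4
        exact h3 (hLD (hS y h4).1))
      (fun a _ n m hn hm => hm.unique hn)
    refine ⟨n, ?_⟩
    have hDL : ∀ᶠ y in 𝓝[≠] p, y ∈ D → y ∈ closure C := by
      obtain ⟨-, ζ', hv, -, hζ'D, hζ'L⟩ := closure_component_eventually_eq
        (isClosed_discSupport w) hz.1 hz.2.1 ((hz.2.2 p hz.2.1).1 hpD)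
        (eventually_of_mem (z.open_source.mem_nhds hz.2.1) hz.2.2) (subset_closure hp)
      filter_upwards [nhdsWithin_le_nhds (ζ'.open_source.mem_nhds hζ'D.2.1)] with y hy hyD
      exact (hζ'L.2.2 y hy).2 ((hζ'D.2.2 y hy).1 hyD)
    filter_upwards [hSev, hDL] with y h1 h2 h3
    exact hn y (h1 (h2 h3))
  -- The order is attached to punctured neighbourhoods, so that it is defined at every point of `C`,
  -- exceptional or not, and connectedness of `C` applies directly.
  obtain ⟨m, hm⟩ := exists_forall_of_isPreconnected (S := C) isPreconnected_connectedComponentIn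
    ⟨x₀, mem_connectedComponentIn hx₀⟩
    (R := fun n p => ∀ᶠ q in 𝓝[≠] p, q ∈ D → StrictNormalFormAt w n q)
    (fun p hp => by
      obtain ⟨n, hn⟩ := hloc p hp
      refine ⟨n, ?_⟩
      have h1 := eventually_nhdsWithin_iff.1 hn
      filter_upwards [nhdsWithin_le_nhds h1, self_mem_nhdsWithin] with y h2 h3
      by_cases hy : y = p
      · rw [hy]; exact hn
      · exact hself (h2 hy (hCreg h3).1)) huniq
  refine ⟨m, fun x => ?_⟩
  filter_upwards [hex x] with p hp hpL
  obtain ⟨hpC, n, hn⟩ := hp hpL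
  have := huniq p hpC n m (hself hn) (hm p hpC)
  exact ⟨hpC, this ▸ hn⟩

end

end

end SymDiff

end

/-! ### The normal form along a common leaf, and its exponent. -/

open SymDiff Set Filter in
theorem lemma2p5 {X : Type*} [TopologicalSpace X] [T2Space X] [ChartedSpace SymDiff.C2 X]
    [IsManifold 𝓘(ℂ, SymDiff.C2) ω X] (w : SymDiff.Differential X)
    (hsplit : SymDiff.Split w) (hrank : SymDiff.RankTwo w)
    (L : Set X) (hL : SymDiff.CommonLeaf w L) :
    ∃ m : ℕ,
      (∃ S : Set X, IsClosed S ∧ IsDiscrete S ∧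
        ∀ x ∈ L \ S, SymDiff.NormalFormAt w m x) ∧
      (∀ x ∈ L, ∀ m' : ℕ, SymDiff.NormalFormAt w m' x → m' = m) := by
  obtain ⟨x₀, hx₀, rfl⟩ := hL.1
  obtain ⟨m, hm⟩ := exists_order hsplit hrank hx₀ hL
  set C := connectedComponentIn (regularPoints (discSupport w)) x₀ with hC
  -- The exceptional set is taken as small as possible. Since every point of `X` has a punctured
  -- neighbourhood that misses it, it is closed and discrete.
  refine ⟨m, ⟨{x | x ∈ closure C ∧ ¬ NormalFormAt w m x}, ?_, ?_, ?_⟩, ?_⟩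
  · rw [← isOpen_compl_iff, isOpen_iff_mem_nhds]
    intro x hx
    filter_upwards [eventually_nhdsWithin_iff.1 (hm x)] with y hy hyS
    by_cases hyx : y = x
    · exact hx (hyx ▸ hyS)
    · exact hyS.2 (hy hyx hyS.1).2.normalFormAt
  · refine ⟨discreteTopology_subtype_iff.2 fun x _ => ?_⟩
    rw [← disjoint_iff, disjoint_principal_right]
    filter_upwards [hm x] with y hy hyS
    exact hyS.2 (hy hyS.1).2.normalFormAt
  · rintro x ⟨hxL, hxS⟩
    by_contra hx
    exact hxS ⟨hxL, hx⟩
  · rintro x hx m' ⟨z, f, hz, hxz, -, hf⟩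
    -- The point `x` may be exceptional or singular. The chart of its normal form contains points of
    -- `C`, and near one of them, points of the leaf with a strict normal form of exponent `m`.
    obtain ⟨p, hpz, hpC⟩ := mem_closure_iff.1 hx _ z.open_source hxz
    -- For `m' = 0` the coefficient `1 + (m' + 1) z₁ ^ m' z₂` is `1 + z₂`, so on `{z₁ = 0}` it
    -- vanishes only at `(0, -1)`. Avoiding this point meets the nondegeneracy condition of the
    -- comparison; for `m' > 0` the coefficient is `1` on `{z₁ = 0}`.
    have hne : ∀ᶠ y in 𝓝[≠] p, y ≠ (pairChart z).symm (0, -1) := by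
      by_cases he : (pairChart z).symm (0, -1) = p
      · rw [he]; exact self_mem_nhdsWithin
      · exact nhdsWithin_le_nhds (isOpen_ne.mem_nhds (Ne.symm he))
    obtain ⟨hpD, z', hz'⟩ := connectedComponentIn_subset _ _ hpC
    obtain ⟨-, ζ, -, -, -, hζL⟩ := closure_component_eventually_eq (isClosed_discSupport w)
      hz'.1 hz'.2.1 ((hz'.2.2 p hz'.2.1).1 hpD)
      (eventually_of_mem (z'.open_source.mem_nhds hz'.2.1) hz'.2.2) (subset_closure hpC)
    have hreg : p ∈ regularPoints (closure C) := ⟨subset_closure hpC, ζ, hζL⟩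
    have hsrc : ∀ᶠ y in 𝓝[≠] p, y ∈ z.source :=
      nhdsWithin_le_nhds (z.open_source.mem_nhds hpz)
    obtain ⟨y, hyL, hy, hyz, hye⟩ := ((frequently_mem_of_mem_regularPoints hreg).and_eventually
      ((hm p).and (hsrc.and hne))).exists
    refine (hy hyL).2.exponent_eq hz hyz hf ?_
    by_cases h0 : z y 0 = 0
    · left
      rcases m' with _ | k
      · intro h1
        apply hye
        have h2 : pairChart z y = (0, -1) := by
          rw [pairChart_apply, h0]
          congr 1
          simp at h1
          linear_combination h1
        rw [← h2, pairChart_left_inv z hyz]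
      · simp [h0]
    · exact Or.inr h0
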